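/- Let $(X,\Sigma,P)$ be an atomless probability space and let $f=\chi_{[0,\infty)}$. Consider real martingales $\varphi=\{\varphi_n\}_{n\ge 0}$ on $X$, each adapted to some filtration $\{\mathcal F_n\}_{n\ge0}$ with $\mathcal F_0=\{\varnothing,X\}$ and every $\mathcal F_n$ a finite $\sigma$-algebra, that are simple, i.e. $\varphi_{n+1}=\varphi_n$ for all sufficiently large $n$. Write $\varphi_\infty=\lim_n\varphi_n$ and $S\varphi=\big(\sum_{n\ge0}(\varphi_{n+1}-\varphi_n)^2\big)^{1/2}$, and put $$\boldsymbol B(x,y,z)=\sup\Big\{\mathbb E\,H_f\big(\varphi_\infty,(S\varphi)^2+z^2\big)\;\Big|\;\varphi\text{ simple},\ \mathbb E\varphi_\infty=x,\ \mathbb E\varphi_\infty^2=y\Big\},$$ where $H_f(s,t)=f(s)$ for $t\in[0,1]$ and $H_f(s,t)=-\infty$ otherwise. For $\varepsilon\ge0$ let $\omega_\varepsilon=\{(x,y)\mid x^2\le y\le x^2+\varepsilon^2\}$ and, for $(x,y)\in\omega_\varepsilon$, $$b_\varepsilon(x,y)=\sup\Big\{\int_0^1 f(\psi)\;\Big|\;\psi\in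 L^2[0,1],\ \int_0^1\psi=x,\ \int_0^1\psi^2=y,\ \|\psi\|_{\mathrm{BMO}([0,1])}\le\varepsilon\Big\},$$ where $\|\psi\|^2_{\mathrm{BMO}([0,1])}$ is the supremum over all subintervals $J\subset[0,1]$ of $\frac1{|J|}\int_J\big(\psi-\frac1{|J|}\int_J\psi\big)^2$. Let $$\begin{aligned}D_1^\varepsilon&=\{(x,y)\in\omega_\varepsilon\mid y\ge2\varepsilon x,\ x\ge\varepsilon\}\cup\{(x,y)\in\omega_\varepsilon\mid y\le2\varepsilon x\},\\ D_2^\varepsilon&=\{(x,y)\in\omega_\varepsilon\mid |x|\le\varepsilon,\ y\ge2\varepsilon|x|\},\\ D_3^\varepsilon&=\{(x,y)\in\omega_\varepsilon\mid y\le-2\varepsilon x\},\\ D_4^\varepsilon&=\{(x,y)\in\omega_\varepsilon\mid x\le-\varepsilon,\ y\ge-2\varepsilon x\}.\end{aligned}$$ **Theorem.** Let $x^2\le y\le x^2+1$ and $\varepsilon=\sqrt{y-x^2}$. 1. If $(x,y)\in D_1^\varepsilon\cup D_3^\varepsilon\cup D_4^\varepsilon$, then $\boldsymbol B\big(x,y,\sqrt{1-y+x^2}\big)=b_\varepsilon(x,y)$.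 2. If $y>x^2$ and $(x,y)\in D_2^\varepsilon$, then $$\boldsymbol B\big(x,y,\sqrt{1-y+x^2}\big)=1-\frac{\sqrt{1-\rho^2}-\rho}{2\sqrt2}\,e^{-\arcsin\rho-\frac\pi4},\qquad \rho=\frac{x}{\sqrt{2(y-x^2)}}.$$ 3. If $(x,y)\in D_2^\varepsilon$ and $|x|<\varepsilon$, then $\boldsymbol B\big(x,y,\sqrt{1-y+x^2}\big)<b_\varepsilon(x,y)$. -/

import Mathlib

open MeasureTheory ProbabilityTheory Filter
open scoped ENNReal

noncomputable section

namespace SquareBellman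

/-- A measure is atomless if every measurable set of positive measure contains a measurable subset
of strictly smaller positive measure. -/
def Atomless {Ω : Type*} [MeasurableSpace Ω] (P : Measure Ω) : Prop :=
  ∀ s : Set Ω, MeasurableSet s → 0 < P s → ∃ t ⊆ s, MeasurableSet t ∧ 0 < P t ∧ P t < P s

/-- A discrete time filtration whose initial σ-algebra is trivial and all of whose σ-algebras
consist of finitely many sets. -/
structure IsFiniteFiltration {Ω : Type*} {m : MeasurableSpace Ω} (𝓕 : Filtration ℕ m) : Prop where
  zero_eq_bot : 𝓕 0 = ⊥
  finite_sets : ∀ n, {s : Set Ω | MeasurableSet[𝓕 n] s}.Finite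

/-- A process is simple if it is constant in time from some moment on. -/
def IsSimple {Ω : Type*} (φ : ℕ → Ω → ℝ) : Prop :=
  ∃ N, ∀ n, N ≤ n → φ (n + 1) = φ n

/-- The terminal value `φ_∞ = lim φ_n`. -/
def terminal {Ω : Type*} (φ : ℕ → Ω → ℝ) (ω : Ω) : ℝ :=
  limUnder atTop (fun n => φ n ω)

/-- The square function `Sφ = (∑ (φ_{n+1} - φ_n)^2)^{1/2}`. -/
def squareFunction {Ω : Type*} (φ : ℕ → Ω → ℝ) (ω : Ω) : ℝ :=
  Real.sqrt (∑' n, (φ (n + 1) ω - φ n ω) ^ 2)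

/-- The expectation of a random variable with values in `[-∞, ∞]`, as the difference of the
expectations of the positive and of the negative part. -/
def expectation {Ω : Type*} [MeasurableSpace Ω] (P : Measure Ω) (g : Ω → EReal) : EReal :=
  ((∫⁻ ω, (g ω).toENNReal ∂P : ℝ≥0∞) : EReal) - ((∫⁻ ω, (-g ω).toENNReal ∂P : ℝ≥0∞) : EReal)

open Classical in
/-- `H_f(s, t)` equals `f(s)` if `t ∈ [0, 1]` and `-∞` otherwise. -/
def penalized (f : ℝ → ℝ) (s t : ℝ) : EReal :=
  if t ∈ Set.Icc (0 : ℝ) 1 then (f s : EReal) else ⊥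

/-- The Bellman function `𝑩(x, y, z)`: the supremum of `E H_f(φ_∞, (Sφ)² + z²)` over all simple
martingales `φ` (on the probability space `(Ω, P)`, adapted to some filtration by finite
σ-algebras) such that `E φ_∞ = x` and `E φ_∞² = y`. The supremum of the empty set is `-∞`. -/
def B {Ω : Type*} [m : MeasurableSpace Ω] (P : Measure Ω) (f : ℝ → ℝ) (x y z : ℝ) : EReal :=
  sSup {v : EReal | ∃ (𝓕 : Filtration ℕ m) (φ : ℕ → Ω → ℝ),
    IsFiniteFiltration 𝓕 ∧ Martingale φ 𝓕 P ∧ IsSimple φ ∧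
    ∫ ω, terminal φ ω ∂P = x ∧ ∫ ω, (terminal φ ω) ^ 2 ∂P = y ∧
    v = expectation P (fun ω => penalized f (terminal φ ω) ((squareFunction φ ω) ^ 2 + z ^ 2))}

/-- The mean value of `ψ` over the interval with endpoints `a < b`. -/
def mean (ψ : ℝ → ℝ) (a b : ℝ) : ℝ :=
  (b - a)⁻¹ * ∫ t in a..b, ψ t

/-- The square of the (quadratic) `BMO([0, 1])` seminorm: the supremum over the subintervals of
`[0, 1]` of the mean of `(ψ - mean ψ)²`. -/
def bmoNormSq (ψ : ℝ → ℝ) : ℝ≥0∞ :=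
  ⨆ (a : ℝ) (b : ℝ) (_ : 0 ≤ a) (_ : a < b) (_ : b ≤ 1),
    ENNReal.ofReal (mean (fun t => (ψ t - mean ψ a b) ^ 2) a b)

/-- The Bellman function `b_ε(x, y)` of the space `BMO([0, 1])` (for `ε ≥ 0` and `f ≥ 0`): the
supremum of `∫₀¹ f(ψ)` over all square integrable `ψ` with `∫₀¹ ψ = x`, `∫₀¹ ψ² = y` and
`BMO([0, 1])` seminorm at most `ε`. -/
def b (f : ℝ → ℝ) (ε x y : ℝ) : EReal :=
  sSup {v : EReal | ∃ ψ : ℝ → ℝ, MemLp ψ 2 (volume.restrict (Set.Icc (0 : ℝ) 1)) ∧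
    ∫ t in (0 : ℝ)..1, ψ t = x ∧ ∫ t in (0 : ℝ)..1, (ψ t) ^ 2 = y ∧
    bmoNormSq ψ ≤ ENNReal.ofReal (ε ^ 2) ∧
    v = ((∫⁻ t in Set.Icc (0 : ℝ) 1, ENNReal.ofReal (f (ψ t)) : ℝ≥0∞) : EReal)}

/-- The parabolic strip `ω_ε`. -/
def strip (ε : ℝ) : Set (ℝ × ℝ) :=
  {p | p.1 ^ 2 ≤ p.2 ∧ p.2 ≤ p.1 ^ 2 + ε ^ 2}

def D₁ (ε : ℝ) : Set (ℝ × ℝ) :=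
  {p | p ∈ strip ε ∧ 2 * ε * p.1 ≤ p.2 ∧ ε ≤ p.1} ∪ {p | p ∈ strip ε ∧ p.2 ≤ 2 * ε * p.1}

def D₂ (ε : ℝ) : Set (ℝ × ℝ) :=
  {p | p ∈ strip ε ∧ |p.1| ≤ ε ∧ 2 * ε * |p.1| ≤ p.2}

def D₃ (ε : ℝ) : Set (ℝ × ℝ) :=
  {p | p ∈ strip ε ∧ p.2 ≤ -2 * ε * p.1}

def D₄ (ε : ℝ) : Set (ℝ × ℝ) :=
  {p | p ∈ strip ε ∧ p.1 ≤ -ε ∧ -2 * ε * p.1 ≤ p.2}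

/-- The function `χ_{[0, ∞)}`. -/
def chi : ℝ → ℝ := Set.indicator (Set.Ici 0) (fun _ => 1)

/-- `ρ(x, y) = x / √(2 (y - x²))`. -/
def rho (x y : ℝ) : ℝ := x / Real.sqrt (2 * (y - x ^ 2))

end SquareBellman

end

/-!
The square function and the terminal variance are linked by `E S² = y - x²` for every simple
martingale with `E φ_∞ = x` and `E φ_∞² = y`. At `z² = 1 - (y - x²)` the constraint `S² + z² ≤ 1`
therefore forces `S² = y - x² =: t` almost surely, and `B` becomes the largest probability of
`{φ_∞ ≥ 0}` among the martingales that start at `x` and have `S² = t` almost surely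
(`B_le_value`, `B_eq_value`).

By scaling the answer has the form `value x t = U (x / √t)`. The profile `U` is `exp (1 + ξ) / 2`
for `ξ ≤ -1` and `1` for `ξ ≥ 1`; in between it is `1 - cos η · exp (-η) / 2`, where
`ξ = sin η - cos η`. In this angle the substitution `ρ = ξ / √2 = sin (η - π / 4)` gives the formula
in terms of `ρ` (`defect_eq_rho`).

* Upper bound. The inequality `value (x + d) (t - d²) ≤ value x t + c d` with a slope `c = c(x, t)`
  (`value_add_le`) makes `value (φ_n) (t - ∑_{k < n} (φ_{k+1} - φ_k)²)` a supermartingale, whose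
  terminal value is `χ (φ_∞)` (`integral_value_le`).
* Lower bound. If `x < √t`, one side of a step is short and moves along the profile; the other side
  is a jump after which the outcome is decided: down, with `t` exhausted, if `x < -√t`, and up into
  the region `x ≥ √t` if `|x| < √t`. In the limit of short steps these trees attain `value`
  (`exists_attainable`), and an atomless space carries martingales that realize them
  (`Attainable.exists_realization`).

For the function `b` on the upper boundary `y = x² + ε²` of the strip the bounds are independent of
this.

* If `x ≥ ε`, the function with values `x ± ε` lies in the ball and is nonnegative (`one_le_b`).
* If `x ≤ -ε`, a truncated logarithm gives `b ≥ exp (1 + x / ε) / 2` (`exp_le_b`). The converse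
  bound is a sharp weak-type inequality (`b_le_exp`): by the rising sun lemma
  (`exists_intervals_mean_eq`) the set `{ψ ≥ 0}` is covered, up to a null set, by disjoint intervals
  on which the mean of `ψ` is raised by `τ ε`. Each such passage multiplies the bound by
  `(1 + τ)⁻¹`, and Chebyshev's inequality ends the induction at mean `-ε`; many small steps produce
  the exponential.
* If `|x| < ε`, the function with values `2 ε`, `0`, `-2 ε` shows `1 - b ≤ (1 - ξ)² / 8`, where
  `ξ = x / ε` (`one_sub_sq_le_b`), and this is strictly below `cos η · exp (-η) / 2` (`sq_lt_defect`).
-/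

namespace SquareBellman

/-! ### The profile of the Bellman function -/

/-- The angle `η` with `sin η - cos η = ξ`, for `ξ² ≤ 2`. -/
noncomputable def angle (ξ : ℝ) : ℝ := Real.pi / 4 + Real.arcsin (ξ / √2)

/-- The defect `1 - U` of the profile on `[-1, 1]`, namely `cos η · exp (-η) / 2`. -/
noncomputable def defect (ξ : ℝ) : ℝ := Real.cos (angle ξ) * Real.exp (-angle ξ) / 2

/-- The profile `U`: the value at `(x, t)` of the problem "maximize the probability that `φ_∞ ≥ 0`
among the martingales starting at `x` with `S² = t`" is `U (x / √t)`. -/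
noncomputable def profile (ξ : ℝ) : ℝ :=
  if ξ ≤ -1 then Real.exp (1 + ξ) / 2 else if ξ < 1 then 1 - defect ξ else 1

theorem div_sqrt_two_mem {ξ : ℝ} (h : ξ ^ 2 ≤ 2) : ξ / √2 ∈ Set.Icc (-1 : ℝ) 1 := by
  have h2 : |ξ| ≤ √2 := Real.abs_le_sqrt h
  have h3 : (0 : ℝ) < √2 := by positivity
  rw [abs_le] at h2
  constructor
  · rw [le_div_iff₀ h3]; linarith
  · rw [div_le_one h3]; exact h2.2

theorem sin_angle_sub_cos_angle {ξ : ℝ} (h : ξ ^ 2 ≤ 2) :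
    Real.sin (angle ξ) - Real.cos (angle ξ) = ξ := by
  have h3 : (0 : ℝ) < √2 := by positivity
  have h4 : √2 * √2 = (2 : ℝ) := Real.mul_self_sqrt (by norm_num)
  have hm := div_sqrt_two_mem h
  rw [angle, Real.sin_add, Real.cos_add, Real.sin_pi_div_four, Real.cos_pi_div_four,
    Real.sin_arcsin hm.1 hm.2]
  have : ξ / √2 * √2 = ξ := by field_simp
  linear_combination this

theorem sin_angle_add_cos_angle (ξ : ℝ) :
    Real.sin (angle ξ) + Real.cos (angle ξ) = √2 * Real.cos (Real.arcsin (ξ / √2)) := by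
  rw [angle, Real.sin_add, Real.cos_add, Real.sin_pi_div_four, Real.cos_pi_div_four]
  ring

theorem angle_mono : Monotone angle := by
  intro a b h
  unfold angle
  gcongr

theorem angle_sin_sub_cos {η : ℝ} (h0 : -(Real.pi / 4) ≤ η) (h1 : η ≤ 3 * Real.pi / 4) :
    angle (Real.sin η - Real.cos η) = η := by
  have h4 : √2 * √2 = (2 : ℝ) := Real.mul_self_sqrt (by norm_num)
  have : (Real.sin η - Real.cos η) / √2 = Real.sin (η - Real.pi / 4) := by
    rw [Real.sin_sub, Real.sin_pi_div_four, Real.cos_pi_div_four]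
    have h3 : (√2 : ℝ) ≠ 0 := by positivity
    field_simp
    linear_combination (Real.cos η - Real.sin η) * h4
  rw [angle, this, Real.arcsin_sin (by linarith) (by linarith)]
  ring

theorem angle_neg_one : angle (-1) = 0 := by
  simpa using angle_sin_sub_cos (η := 0) (by linarith [Real.pi_pos]) (by linarith [Real.pi_pos])

theorem angle_one : angle 1 = Real.pi / 2 := by
  simpa using angle_sin_sub_cos (η := Real.pi / 2) (by linarith [Real.pi_pos])
    (by linarith [Real.pi_pos])

theorem angle_nonneg {ξ : ℝ} (h : -1 ≤ ξ) : 0 ≤ angle ξ := angle_neg_one ▸ angle_mono h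

theorem angle_le {ξ : ℝ} (h : ξ ≤ 1) : angle ξ ≤ Real.pi / 2 := angle_one ▸ angle_mono h

theorem sq_le_two {ξ : ℝ} (h0 : -1 ≤ ξ) (h1 : ξ ≤ 1) : ξ ^ 2 ≤ 2 := by nlinarith

theorem cos_angle_nonneg {ξ : ℝ} (h0 : -1 ≤ ξ) (h1 : ξ ≤ 1) : 0 ≤ Real.cos (angle ξ) :=
  Real.cos_nonneg_of_mem_Icc ⟨by linarith [angle_nonneg h0, Real.pi_pos], angle_le h1⟩

theorem sin_angle_nonneg {ξ : ℝ} (h0 : -1 ≤ ξ) (h1 : ξ ≤ 1) : 0 ≤ Real.sin (angle ξ) :=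
  Real.sin_nonneg_of_nonneg_of_le_pi (angle_nonneg h0) (by linarith [angle_le h1, Real.pi_pos])

theorem sin_angle_add_cos_angle_pos {ξ : ℝ} (h : ξ ^ 2 < 2) :
    0 < Real.sin (angle ξ) + Real.cos (angle ξ) := by
  have h1 := sin_angle_sub_cos_angle h.le
  have h2 := Real.sin_sq_add_cos_sq (angle ξ)
  have h3 : 0 ≤ Real.sin (angle ξ) + Real.cos (angle ξ) := by
    rw [sin_angle_add_cos_angle]
    exact mul_nonneg (by positivity) (Real.cos_arcsin_nonneg _)
  refine lt_of_le_of_ne h3 fun h0 => ?_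
  have h4 : (Real.sin (angle ξ) + Real.cos (angle ξ)) ^ 2 = 0 := by rw [← h0]; norm_num
  have h5 : (Real.sin (angle ξ) - Real.cos (angle ξ)) ^ 2 = ξ ^ 2 := by rw [h1]
  linarith

theorem cos_angle_pos {ξ : ℝ} (h0 : -1 ≤ ξ) (h1 : ξ < 1) : 0 < Real.cos (angle ξ) := by
  have ha := sin_angle_sub_cos_angle (sq_le_two h0 h1.le)
  have h2 := Real.sin_sq_add_cos_sq (angle ξ)
  refine lt_of_le_of_ne (cos_angle_nonneg h0 h1.le) fun h => ?_
  rw [← h] at ha h2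
  have h3 : Real.sin (angle ξ) = ξ := by linarith
  rw [h3] at h2
  have : ξ = -1 := by nlinarith
  subst this
  rw [angle_neg_one] at h
  simp at h

theorem hasDerivAt_angle {ξ : ℝ} (h : ξ ^ 2 < 2) :
    HasDerivAt angle (1 / (Real.sin (angle ξ) + Real.cos (angle ξ))) ξ := by
  have h3 : (0 : ℝ) < √2 := by positivity
  have hm := div_sqrt_two_mem h.le
  have h4 : √2 * √2 = (2 : ℝ) := Real.mul_self_sqrt (by norm_num)
  have e : (ξ / √2) * √2 = ξ := by field_simp
  have n1 : ξ / √2 ≠ -1 := by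
    intro h0; rw [h0] at e; nlinarith
  have n2 : ξ / √2 ≠ 1 := by
    intro h0; rw [h0] at e; nlinarith
  have := ((Real.hasDerivAt_arcsin n1 n2).comp ξ ((hasDerivAt_id ξ).div_const √2)).const_add
    (Real.pi / 4)
  refine this.congr_deriv ?_
  rw [sin_angle_add_cos_angle, Real.cos_arcsin]
  simp [mul_comm]

theorem hasDerivAt_defect {ξ : ℝ} (h : ξ ^ 2 < 2) :
    HasDerivAt defect (-(Real.exp (-angle ξ) / 2)) ξ := by
  have ha := hasDerivAt_angle h
  have hp := sin_angle_add_cos_angle_pos h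
  have := ((ha.cos).mul (ha.neg.exp)).div_const 2
  refine this.congr_deriv ?_
  simp only [Pi.neg_apply]
  field_simp
  ring

theorem continuous_angle : Continuous angle := by
  unfold angle
  exact continuous_const.add (Real.continuous_arcsin.comp (continuous_id.div_const _))

theorem continuous_defect : Continuous defect := by
  unfold defect
  have := continuous_angle
  fun_prop

theorem defect_neg_one : defect (-1) = 1 / 2 := by simp [defect, angle_neg_one]

theorem defect_one : defect 1 = 0 := by simp [defect, angle_one]

theorem defect_nonneg {ξ : ℝ} (h0 : -1 ≤ ξ) (h1 : ξ ≤ 1) : 0 ≤ defect ξ := by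
  have := cos_angle_nonneg h0 h1
  unfold defect; positivity

theorem defect_pos {ξ : ℝ} (h0 : -1 ≤ ξ) (h1 : ξ < 1) : 0 < defect ξ := by
  have := cos_angle_pos h0 h1
  unfold defect; positivity

theorem defect_le_one {ξ : ℝ} (h0 : -1 ≤ ξ) : defect ξ ≤ 1 := by
  have h2 : Real.exp (-angle ξ) ≤ 1 := Real.exp_le_one_iff.2 (by linarith [angle_nonneg h0])
  have h3 := Real.cos_le_one (angle ξ)
  have h4 := Real.exp_pos (-angle ξ)
  unfold defect
  nlinarith

theorem profile_of_le {ξ : ℝ} (h : ξ ≤ -1) : profile ξ = Real.exp (1 + ξ) / 2 := if_pos h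

theorem profile_of_mem {ξ : ℝ} (h0 : -1 ≤ ξ) (h1 : ξ ≤ 1) : profile ξ = 1 - defect ξ := by
  rcases h0.eq_or_lt with rfl | h0
  · rw [profile_of_le le_rfl, defect_neg_one]; norm_num
  rw [profile, if_neg (not_le.2 h0)]
  rcases h1.eq_or_lt with rfl | h1
  · simp [defect_one]
  · rw [if_pos h1]

theorem profile_of_ge {ξ : ℝ} (h : 1 ≤ ξ) : profile ξ = 1 := by
  rw [profile, if_neg (by linarith), if_neg (by linarith)]

theorem profile_nonneg (ξ : ℝ) : 0 ≤ profile ξ := by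
  rcases le_total ξ (-1) with h | h
  · rw [profile_of_le h]; positivity
  rcases le_total ξ 1 with h1 | h1
  · rw [profile_of_mem h h1]; linarith [defect_le_one h]
  · rw [profile_of_ge h1]; norm_num

theorem profile_le_one (ξ : ℝ) : profile ξ ≤ 1 := by
  rcases le_total ξ (-1) with h | h
  · rw [profile_of_le h]
    have : Real.exp (1 + ξ) ≤ 1 := Real.exp_le_one_iff.2 (by linarith)
    linarith
  rcases le_total ξ 1 with h1 | h1
  · rw [profile_of_mem h h1]; linarith [defect_nonneg h h1]
  · rw [profile_of_ge h1]

/-! ### The one-step inequality for the profile -/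

/-- The tangent at `-1`, where the defect is convex. -/
theorem neg_div_two_le_defect {ξ : ℝ} (h0 : -1 ≤ ξ) (h1 : ξ ≤ 1) : -ξ / 2 ≤ defect ξ := by
  have ha := sin_angle_sub_cos_angle (sq_le_two h0 h1)
  rcases eq_or_lt_of_le h1 with rfl | h1
  · rw [defect_one]; norm_num
  have hc := cos_angle_pos h0 h1
  have hn := angle_nonneg h0
  have ht := Real.le_tan hn (lt_of_le_of_ne (angle_le h1.le) fun h => by
    rw [h, Real.cos_pi_div_two] at hc; exact lt_irrefl _ hc)
  rw [Real.tan_eq_sin_div_cos, le_div_iff₀ hc] at ht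
  have he := Real.add_one_le_exp (-angle ξ)
  unfold defect
  nlinarith

/-- The new position after a step `d`, rescaled to unit remaining square function. -/
noncomputable def move (ξ d : ℝ) : ℝ := (ξ + d) / √(1 - d ^ 2)

theorem hasDerivAt_move (ξ : ℝ) {d : ℝ} (hd : d ^ 2 < 1) :
    HasDerivAt (move ξ) ((1 + ξ * d) / ((1 - d ^ 2) * √(1 - d ^ 2))) d := by
  have hp : 0 < 1 - d ^ 2 := by linarith
  have hs : 0 < √(1 - d ^ 2) := Real.sqrt_pos.2 hp
  have hss : √(1 - d ^ 2) ^ 2 = 1 - d ^ 2 := Real.sq_sqrt hp.le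
  have h1 : HasDerivAt (fun d : ℝ => 1 - d ^ 2) (-(2 * d)) d := by
    simpa using ((hasDerivAt_id d).pow 2).const_sub 1
  have := ((hasDerivAt_id d).const_add ξ).div (h1.sqrt hp.ne') hs.ne'
  refine this.congr_deriv ?_
  simp only [id]
  generalize √(1 - d ^ 2) = σ at *
  rw [← hss]
  field_simp
  linear_combination hss

theorem move_mem_Ioo {ξ d : ℝ} (h0 : -1 < ξ) (h1 : ξ < 1)
    (hd0 : -Real.sin (angle ξ) < d) (hd1 : d < Real.cos (angle ξ)) :
    d ^ 2 < 1 ∧ -1 < move ξ d ∧ move ξ d < 1 := by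
  have ha := sin_angle_sub_cos_angle (sq_le_two h0.le h1.le)
  have hb := Real.sin_sq_add_cos_sq (angle ξ)
  have key : (ξ + d) ^ 2 < 1 - d ^ 2 := by
    have : 0 < (Real.sin (angle ξ) + d) * (Real.cos (angle ξ) - d) :=
      mul_pos (by linarith) (by linarith)
    generalize Real.sin (angle ξ) = s at *
    generalize Real.cos (angle ξ) = c at *
    subst ha
    nlinarith
  have hp : 0 < 1 - d ^ 2 := lt_of_le_of_lt (sq_nonneg _) key
  have hs : 0 < √(1 - d ^ 2) := Real.sqrt_pos.2 hp
  have : |ξ + d| < √(1 - d ^ 2) := Real.lt_sqrt_of_sq_lt (by rwa [sq_abs])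
  rw [abs_lt] at this
  refine ⟨by linarith, ?_, ?_⟩
  · rw [move, lt_div_iff₀ hs]; linarith
  · rw [move, div_lt_one hs]; linarith

/-- The logarithmic derivative in `d` of `defect (move ξ d) / (cos η - d)` has the sign of `d`. -/
theorem move_deriv_identity {ξ d : ℝ} (h0 : -1 < ξ) (h1 : ξ < 1)
    (hd0 : -Real.sin (angle ξ) < d) (hd1 : d < Real.cos (angle ξ)) :
    ∃ k, 0 < k ∧ 1 / (Real.cos (angle ξ) - d) - (1 + ξ * d) / ((1 - d ^ 2) * √(1 - d ^ 2)) /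
      Real.cos (angle (move ξ d)) = k * d := by
  obtain ⟨hd, hm0, hm1⟩ := move_mem_Ioo h0 h1 hd0 hd1
  have ha := sin_angle_sub_cos_angle (sq_le_two h0.le h1.le)
  have hb := Real.sin_sq_add_cos_sq (angle ξ)
  have ha' := sin_angle_sub_cos_angle (sq_le_two hm0.le hm1.le)
  have hb' := Real.sin_sq_add_cos_sq (angle (move ξ d))
  have hc' := cos_angle_pos hm0.le hm1
  have hc := cos_angle_pos h0.le h1
  have hs' := sin_angle_nonneg hm0.le hm1.le
  have hp : 0 < 1 - d ^ 2 := by linarith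
  have hs : 0 < √(1 - d ^ 2) := Real.sqrt_pos.2 hp
  have hss : √(1 - d ^ 2) ^ 2 = 1 - d ^ 2 := Real.sq_sqrt hp.le
  have hmv : √(1 - d ^ 2) * move ξ d = ξ + d := by rw [move]; field_simp
  generalize Real.sin (angle (move ξ d)) = s' at *
  generalize Real.cos (angle (move ξ d)) = c' at *
  generalize Real.sin (angle ξ) = s at *
  generalize Real.cos (angle ξ) = c at *
  generalize move ξ d = m at *
  generalize √(1 - d ^ 2) = σ at *
  obtain ⟨g, rfl⟩ : ∃ g, c = g + d := ⟨c - d, by ring⟩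
  have hg : 0 < g := by linarith
  have hSC : σ * s' - σ * c' = ξ + d := by rw [← hmv, ← ha']; ring
  have hS2 : (σ * s') ^ 2 + (σ * c') ^ 2 = 1 - d ^ 2 := by
    rw [← hss]; linear_combination σ ^ 2 * hb'
  have hS : 0 ≤ σ * s' := mul_nonneg hs.le hs'
  have hC : 0 < σ * c' := mul_pos hs hc'
  have hE : (σ * c' - g) * (σ * s' + g) = g * d := by
    have e : σ * s' = s + (σ * c' - g) := by linarith
    rw [e] at hS2 ⊢
    linear_combination hS2 / 2 - hb / 2
  have hnum : (1 - d ^ 2) * (σ * c') - (1 + ξ * d) * g =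
      (σ * c' - g) * ((σ * c') ^ 2 + g * (g + d)) := by
    have e : ξ = σ * s' - σ * c' - d := by linarith
    rw [e]
    linear_combination (-(σ * c' - g)) * hS2 + (σ * s' - σ * c') * hE + (σ * c' - g) * hE
  refine ⟨g * ((σ * c') ^ 2 + g * (g + d)) / ((σ * s' + g) * (g * ((1 - d ^ 2) * (σ * c')))), ?_, ?_⟩
  · have : 0 < σ * s' + g := by linarith
    positivity
  · have h5 : 0 < σ * s' + g := by linarith
    have e1 : 1 / (g + d - d) - (1 + ξ * d) / ((1 - d ^ 2) * σ) / c' =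
        ((1 - d ^ 2) * (σ * c') - (1 + ξ * d) * g) / (g * ((1 - d ^ 2) * (σ * c'))) := by
      rw [add_sub_cancel_right]
      field_simp
    have e2 : g * d = (σ * c' - g) * (σ * s' + g) := hE.symm
    rw [e1, hnum, div_mul_eq_mul_div, div_eq_div_iff (by positivity) (by positivity)]
    linear_combination (-(g * ((1 - d ^ 2) * (σ * c')) * ((σ * c') ^ 2 + g * (g + d)))) * e2

theorem move_zero (ξ : ℝ) : move ξ 0 = ξ := by simp [move]

/-- The line with slope `exp (-η) / 2` through the graph point of the profile lies above the profile
as long as the step does not leave the range where the profile is given by the defect. -/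
theorem tangent_le_defect_move {ξ d : ℝ} (h0 : -1 < ξ) (h1 : ξ < 1)
    (hd0 : -Real.sin (angle ξ) ≤ d) (hd1 : d < Real.cos (angle ξ)) :
    Real.exp (-angle ξ) / 2 * (Real.cos (angle ξ) - d) ≤ defect (move ξ d) := by
  have ha := sin_angle_sub_cos_angle (sq_le_two h0.le h1.le)
  have hb := Real.sin_sq_add_cos_sq (angle ξ)
  have hc := cos_angle_pos h0.le h1
  have hs := sin_angle_nonneg h0.le h1.le
  have hleft : move ξ (-Real.sin (angle ξ)) = -1 := by
    have e : 1 - (-Real.sin (angle ξ)) ^ 2 = Real.cos (angle ξ) ^ 2 := by linarith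
    rw [move, e, Real.sqrt_sq hc.le]
    field_simp
    linarith
  have hmem : ∀ e, -Real.sin (angle ξ) ≤ e → e < Real.cos (angle ξ) →
      e ^ 2 < 1 ∧ -1 ≤ move ξ e ∧ move ξ e < 1 := by
    intro e he0 he1
    rcases he0.eq_or_lt with rfl | he0
    · rw [hleft]
      refine ⟨?_, le_rfl, by norm_num⟩
      nlinarith [sq_pos_of_pos hc]
    · obtain ⟨a1, a2, a3⟩ := move_mem_Ioo h0 h1 he0 he1
      exact ⟨a1, a2.le, a3⟩
  set f : ℝ → ℝ := fun e => Real.log (defect (move ξ e)) - Real.log (Real.cos (angle ξ) - e)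
    with hf
  have hcont : ContinuousOn f (Set.Ico (-Real.sin (angle ξ)) (Real.cos (angle ξ))) := by
    intro e he
    obtain ⟨a1, a2, a3⟩ := hmem e he.1 he.2
    have c1 : ContinuousAt (fun e => defect (move ξ e)) e :=
      continuous_defect.continuousAt.comp (hasDerivAt_move ξ a1).continuousAt
    exact ((c1.log (defect_pos a2 a3).ne').sub
      ((continuousAt_const.sub continuousAt_id).log (by simpa using (sub_pos.2 he.2).ne'))
      ).continuousWithinAt
  have hder : ∀ e, -Real.sin (angle ξ) < e → e < Real.cos (angle ξ) →
      ∃ k, 0 < k ∧ HasDerivAt f (k * e) e := by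
    intro e he0 he1
    obtain ⟨k, hk, hke⟩ := move_deriv_identity h0 h1 he0 he1
    obtain ⟨a1, a2, a3⟩ := move_mem_Ioo h0 h1 he0 he1
    have hc' := cos_angle_pos a2.le a3
    refine ⟨k, hk, ?_⟩
    have d1 := ((hasDerivAt_defect (ξ := move ξ e) (by nlinarith)).comp e
      (hasDerivAt_move ξ a1)).log (defect_pos a2.le a3).ne'
    have d2 := ((hasDerivAt_id e).const_sub (Real.cos (angle ξ))).log (sub_pos.2 he1).ne'
    refine (d1.sub d2).congr_deriv ?_
    rw [← hke]
    simp only [Function.comp, defect, id]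
    have := Real.exp_pos (-angle (move ξ e))
    field_simp
    ring
  have hmain : f 0 ≤ f d := by
    rcases le_total 0 d with hd | hd
    · have : MonotoneOn f (Set.Icc 0 d) := by
        refine monotoneOn_of_deriv_nonneg (convex_Icc _ _) (hcont.mono fun e he =>
          ⟨by linarith [he.1], lt_of_le_of_lt he.2 hd1⟩) ?_ ?_
        all_goals
          intro e he
          rw [interior_Icc] at he
          obtain ⟨k, hk, hd'⟩ := hder e (by linarith [he.1]) (he.2.trans hd1)
        · exact hd'.differentiableAt.differentiableWithinAt
        · rw [hd'.deriv]; exact mul_nonneg hk.le he.1.le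
      exact this ⟨le_rfl, hd⟩ ⟨hd, le_rfl⟩ hd
    · have : AntitoneOn f (Set.Icc d 0) := by
        refine antitoneOn_of_deriv_nonpos (convex_Icc _ _) (hcont.mono fun e he =>
          ⟨hd0.trans he.1, lt_of_le_of_lt he.2 hc⟩) ?_ ?_
        all_goals
          intro e he
          rw [interior_Icc] at he
          obtain ⟨k, hk, hd'⟩ := hder e (lt_of_le_of_lt hd0 he.1) (he.2.trans hc)
        · exact hd'.differentiableAt.differentiableWithinAt
        · rw [hd'.deriv]; exact mul_nonpos_of_nonneg_of_nonpos hk.le he.2.le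
      exact this ⟨le_rfl, hd⟩ ⟨hd, le_rfl⟩ hd
  obtain ⟨a1, a2, a3⟩ := hmem d hd0 hd1
  have hpos := defect_pos a2 a3
  have hg : 0 < Real.cos (angle ξ) - d := sub_pos.2 hd1
  have he := Real.exp_pos (-angle ξ)
  simp only [hf, move_zero, sub_zero] at hmain
  rw [← Real.log_div (defect_pos h0.le h1).ne' hc.ne', ← Real.log_div hpos.ne' hg.ne'] at hmain
  have h5 := (Real.log_le_log_iff (div_pos (defect_pos h0.le h1) hc) (div_pos hpos hg)).1 hmain
  rw [le_div_iff₀ hg] at h5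
  refine le_trans (le_of_eq ?_) h5
  rw [defect]
  field_simp

theorem one_add_eq_two_div {d : ℝ} (hd : d ^ 2 < 1) :
    1 + d = 2 / (1 + ((1 - d) / √(1 - d ^ 2)) ^ 2) ∧
      √(1 - d ^ 2) = 2 * ((1 - d) / √(1 - d ^ 2)) / (1 + ((1 - d) / √(1 - d ^ 2)) ^ 2) := by
  have hp : 0 < 1 - d ^ 2 := by linarith
  have hs : 0 < √(1 - d ^ 2) := Real.sqrt_pos.2 hp
  have hss : √(1 - d ^ 2) ^ 2 = 1 - d ^ 2 := Real.sq_sqrt hp.le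
  have h1 : 0 < 1 + d := by nlinarith
  have h2 : 0 < 1 - d := by nlinarith
  generalize √(1 - d ^ 2) = σ at *
  have e : 1 + ((1 - d) / σ) ^ 2 = 2 / (1 + d) := by
    rw [div_pow, hss]
    field_simp [show 1 - d ^ 2 ≠ 0 from hp.ne']
    ring
  rw [e]
  constructor
  · field_simp
  · field_simp
    linear_combination hss

/-- The one-step inequality for `ξ ≤ -1`. -/
theorem profile_move_le_of_le_neg_one {ξ d : ℝ} (h : ξ ≤ -1) (hd : d ^ 2 < 1) :
    profile (move ξ d) ≤ Real.exp (1 + ξ) / 2 * (1 + d) := by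
  have hp : 0 < 1 - d ^ 2 := by linarith
  have hs : 0 < √(1 - d ^ 2) := Real.sqrt_pos.2 hp
  have hss : √(1 - d ^ 2) ^ 2 = 1 - d ^ 2 := Real.sq_sqrt hp.le
  have hd1 : 0 < 1 + d := by nlinarith
  have hd2 : 0 < 1 - d := by nlinarith
  have hmv : √(1 - d ^ 2) * move ξ d = ξ + d := by rw [move]; field_simp
  obtain ⟨e1, e2⟩ := one_add_eq_two_div hd
  have hq : 0 < (1 - d) / √(1 - d ^ 2) := by positivity
  have hqs : √(1 - d ^ 2) * ((1 - d) / √(1 - d ^ 2)) = 1 - d := by field_simp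
  generalize (1 - d) / √(1 - d ^ 2) = q at *
  generalize move ξ d = m at *
  generalize √(1 - d ^ 2) = σ at *
  have hσ1 : σ ≤ 1 - d ^ 2 / 2 := by nlinarith [sq_nonneg d, sq_nonneg (d ^ 2)]
  rcases le_total m (-1) with hm | hm
  · rw [profile_of_le hm]
    suffices Real.exp (m - ξ) ≤ 1 + d by
      have h3 : Real.exp (1 + m) = Real.exp (1 + ξ) * Real.exp (m - ξ) := by
        rw [← Real.exp_add]; ring_nf
      rw [h3]
      nlinarith [Real.exp_pos (1 + ξ)]
    rcases le_total 0 d with hd0 | hd0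
    · have h5 := Real.le_log_one_add_of_nonneg hd0
      rw [← Real.le_log_iff_exp_le hd1]
      refine le_trans ?_ h5
      rw [le_div_iff₀ (by linarith)]
      have : m - ξ ≤ d - d ^ 2 / 2 := by nlinarith [sq_nonneg d]
      nlinarith [pow_nonneg hd0 3]
    · have hq1 : 1 ≤ q := by nlinarith
      have h6 := Real.quadratic_le_exp_of_nonneg (sub_nonneg.2 hq1)
      have h7 : m - ξ ≤ 1 - q := by
        have : σ * (m - ξ) ≤ σ * (1 - q) := by nlinarith
        exact le_of_mul_le_mul_left this hs
      have h8 : Real.exp (m - ξ) ≤ Real.exp (1 - q) := Real.exp_le_exp.2 h7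
      have h9 : Real.exp (1 - q) * Real.exp (q - 1) = 1 := by
        rw [← Real.exp_add]; simp
      refine h8.trans ?_
      rw [e1, le_div_iff₀ (by positivity)]
      nlinarith [Real.exp_pos (1 - q)]
  · have hm0 : m ≤ 0 := by nlinarith
    obtain ⟨p, rfl⟩ : ∃ p, m = -p := ⟨-m, by ring⟩
    have hp0 : 0 ≤ p := by linarith
    have hp1 : p ≤ 1 := by linarith
    have hqp : q ≤ p := by
      have : σ * q ≤ σ * p := by linarith
      exact le_of_mul_le_mul_left this hs
    rw [profile_of_mem hm (by linarith)]
    have h3 := neg_div_two_le_defect hm (by linarith : -p ≤ 1)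
    have hx : 1 + ξ = -(σ * (p - q)) := by linarith
    have h4 : 1 - p / 2 ≤ 1 / (1 + p ^ 2) := by
      rw [le_div_iff₀ (by positivity)]
      nlinarith [mul_nonneg hp0 (sq_nonneg (1 - p))]
    have hz : 0 ≤ (p ^ 2 - q ^ 2) / (1 + q ^ 2) := div_nonneg (by nlinarith) (by positivity)
    have h5 := Real.le_log_one_add_of_nonneg hz
    have hz1 : 1 + (p ^ 2 - q ^ 2) / (1 + q ^ 2) = (1 + p ^ 2) / (1 + q ^ 2) := by
      field_simp; ring
    have h6 : σ * (p - q) ≤ Real.log ((1 + p ^ 2) / (1 + q ^ 2)) := by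
      rw [← hz1]
      refine le_trans ?_ h5
      have e3 : 2 * ((p ^ 2 - q ^ 2) / (1 + q ^ 2)) / ((p ^ 2 - q ^ 2) / (1 + q ^ 2) + 2) =
          2 * (p ^ 2 - q ^ 2) / (2 + p ^ 2 + q ^ 2) := by
        have : (p ^ 2 - q ^ 2) / (1 + q ^ 2) + 2 = (2 + p ^ 2 + q ^ 2) / (1 + q ^ 2) := by
          field_simp; ring
        rw [this]
        field_simp
      rw [e3, e2, div_mul_eq_mul_div, div_le_div_iff₀ (by positivity) (by positivity)]
      have : 0 ≤ (p - q) * ((p - q) * (1 - p * q)) :=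
        mul_nonneg (by linarith) (mul_nonneg (by linarith) (by nlinarith))
      nlinarith
    rw [Real.le_log_iff_exp_le (by positivity), le_div_iff₀ (by positivity)] at h6
    have h7 : Real.exp (1 + ξ) * Real.exp (σ * (p - q)) = 1 := by
      rw [← Real.exp_add, hx]; simp
    have h8 : 1 / (1 + p ^ 2) ≤ Real.exp (1 + ξ) / 2 * (1 + d) := by
      rw [e1, div_mul_div_comm, div_le_div_iff₀ (by positivity) (by positivity)]
      nlinarith [Real.exp_pos (1 + ξ)]
    linarith

theorem monotoneOn_exp_mul_sin_add_cos :
    MonotoneOn (fun η => Real.exp η * (Real.sin η + Real.cos η)) (Set.Icc 0 (Real.pi / 2)) := by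
  have hd : ∀ η, HasDerivAt (fun η => Real.exp η * (Real.sin η + Real.cos η))
      (2 * (Real.exp η * Real.cos η)) η := fun η =>
    ((Real.hasDerivAt_exp η).mul ((Real.hasDerivAt_sin η).add (Real.hasDerivAt_cos η))).congr_deriv
      (by simp only [Pi.add_apply]; ring)
  refine monotoneOn_of_deriv_nonneg (convex_Icc _ _) (fun η _ => (hd η).continuousAt.continuousWithinAt)
    (fun η _ => (hd η).differentiableAt.differentiableWithinAt) fun η hη => ?_
  rw [interior_Icc] at hη
  rw [(hd η).deriv]
  have := Real.cos_nonneg_of_mem_Icc (x := η) ⟨by linarith [hη.1, Real.pi_pos], hη.2.le⟩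
  positivity

/-- For a fixed step `d ≤ 0`, with `σ = √(1 - d²)`, this is one plus the excess, at the point reached
by the step, of the exponential part of the profile over the supporting line at `ζ`. -/
theorem convexOn_exp_add_defect {d σ : ℝ} (hd : d ≤ 0) (hσ : 0 < σ) :
    ConvexOn ℝ (Set.Icc (-1 : ℝ) 1) fun ζ =>
      Real.exp (1 + (ζ + d) / σ) / 2 + defect ζ + -d * Real.exp (-angle ζ) / 2 := by
  have hder : ∀ ζ ∈ Set.Ioo (-1 : ℝ) 1, HasDerivAt (fun ζ =>
      Real.exp (1 + (ζ + d) / σ) / 2 + defect ζ + -d * Real.exp (-angle ζ) / 2)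
      (Real.exp (1 + (ζ + d) / σ) / (2 * σ) + -(Real.exp (-angle ζ) / 2) + d / 2 *
        (Real.exp (angle ζ) * (Real.sin (angle ζ) + Real.cos (angle ζ)))⁻¹) ζ := by
    intro ζ hζ
    have h2 : ζ ^ 2 < 2 := by nlinarith [hζ.1, hζ.2]
    have hp := sin_angle_add_cos_angle_pos h2
    have d1 := (((((hasDerivAt_id ζ).add_const d).div_const σ).const_add 1).exp).div_const 2
    have d3 := (((hasDerivAt_angle h2).fun_neg.exp).const_mul (-d)).div_const 2
    refine ((d1.add (hasDerivAt_defect h2)).add d3).congr_deriv ?_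
    simp only [id, Real.exp_neg]
    field_simp
  have hcont : Continuous fun ζ =>
      Real.exp (1 + (ζ + d) / σ) / 2 + defect ζ + -d * Real.exp (-angle ζ) / 2 := by
    have := continuous_angle
    have := continuous_defect
    fun_prop
  refine MonotoneOn.convexOn_of_deriv (convex_Icc _ _) hcont.continuousOn ?_ ?_
  · rw [interior_Icc]
    exact fun ζ hζ => (hder ζ hζ).differentiableAt.differentiableWithinAt
  · rw [interior_Icc]
    intro a ha b hb hab
    rw [(hder a ha).deriv, (hder b hb).deriv]
    have hang := angle_mono hab
    have hm := monotoneOn_exp_mul_sin_add_cos ⟨angle_nonneg ha.1.le, angle_le ha.2.le⟩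
      ⟨angle_nonneg hb.1.le, angle_le hb.2.le⟩ hang
    have hp := sin_angle_add_cos_angle_pos (ξ := a) (by nlinarith [ha.1, ha.2])
    have hpos := mul_pos (Real.exp_pos (angle a)) hp
    have h1 : Real.exp (1 + (a + d) / σ) / (2 * σ) ≤ Real.exp (1 + (b + d) / σ) / (2 * σ) := by
      gcongr
    have h2 : Real.exp (-angle b) ≤ Real.exp (-angle a) := Real.exp_le_exp.2 (by linarith)
    have h3 := inv_anti₀ hpos hm
    have h4 : d / 2 * (Real.exp (angle a) * (Real.sin (angle a) + Real.cos (angle a)))⁻¹ ≤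
        d / 2 * (Real.exp (angle b) * (Real.sin (angle b) + Real.cos (angle b)))⁻¹ :=
      mul_le_mul_of_nonpos_left h3 (by linarith)
    linarith

/-- The one-step inequality for `|ξ| < 1` and a long step down, after which the position is at most
`-1`. By convexity in `ξ` it is enough to look at `ξ = -1` and at the `ξ` for which the new position
is exactly `-1`. -/
theorem exp_move_le_of_lt_neg_sin {ξ d : ℝ} (h0 : -1 < ξ) (h1 : ξ < 1)
    (hd0 : d < -Real.sin (angle ξ)) (hd : d ^ 2 < 1) :
    Real.exp (1 + move ξ d) / 2 ≤ 1 - Real.exp (-angle ξ) / 2 * (Real.cos (angle ξ) - d) := by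
  have hp : 0 < 1 - d ^ 2 := by linarith
  have hs : 0 < √(1 - d ^ 2) := Real.sqrt_pos.2 hp
  have hsin := sin_angle_nonneg h0.le h1.le
  have hdneg : d < 0 := by linarith
  have hd1 : -1 < d := by nlinarith
  have hpi := Real.pi_pos
  obtain ⟨γ, hγ0, hγ1, hγ⟩ : ∃ γ, 0 < γ ∧ γ < Real.pi / 2 ∧ Real.sin γ = -d :=
    ⟨Real.arcsin (-d), Real.arcsin_pos.2 (by linarith), Real.arcsin_lt_pi_div_two.2 (by linarith),
      Real.sin_arcsin (by linarith) (by linarith)⟩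
  have hcγ : Real.cos γ = √(1 - d ^ 2) := by
    rw [← Real.sqrt_sq (Real.cos_nonneg_of_mem_Icc ⟨by linarith, hγ1.le⟩), Real.cos_sq', hγ]
    congr 1; ring
  have hang : angle (-d - √(1 - d ^ 2)) = γ := by
    rw [← hγ, ← hcγ]; exact angle_sin_sub_cos (by linarith) (by linarith)
  have hlt : angle ξ < γ := by
    by_contra hle
    have := Real.sin_le_sin_of_le_of_le_pi_div_two (by linarith) (angle_le h1.le) (not_lt.1 hle)
    linarith
  have hcos : Real.cos γ < Real.cos (angle ξ) :=
    Real.cos_lt_cos_of_nonneg_of_le_pi (angle_nonneg h0.le) (by linarith) hlt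
  have hle : ξ ≤ -d - √(1 - d ^ 2) := by
    have := sin_angle_sub_cos_angle (sq_le_two h0.le h1.le)
    linarith
  have hlt1 : -d - √(1 - d ^ 2) < 1 := by linarith
  have hconv := (convexOn_exp_add_defect hdneg.le hs).le_max_of_mem_Icc
    (x := -1) (y := -d - √(1 - d ^ 2)) (z := ξ) ⟨le_rfl, by norm_num⟩ ⟨by linarith, hlt1.le⟩ ⟨h0.le, hle⟩
  have hfirst : Real.exp (1 + (-1 + d) / √(1 - d ^ 2)) / 2 + defect (-1) +
      -d * Real.exp (-angle (-1)) / 2 ≤ 1 := by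
    have h3 := profile_move_le_of_le_neg_one (le_refl (-1 : ℝ)) hd
    have h4 : move (-1) d ≤ -1 := by
      rw [move, div_le_iff₀ hs]
      have : √(1 - d ^ 2) ≤ 1 := Real.sqrt_le_one.2 (by nlinarith)
      linarith
    rw [profile_of_le h4] at h3
    rw [defect_neg_one, angle_neg_one]
    simp only [move] at h3
    simp only [neg_zero, Real.exp_zero, add_neg_cancel] at h3 ⊢
    linarith
  have hsecond : Real.exp (1 + (-d - √(1 - d ^ 2) + d) / √(1 - d ^ 2)) / 2 +
      defect (-d - √(1 - d ^ 2)) + -d * Real.exp (-angle (-d - √(1 - d ^ 2))) / 2 ≤ 1 := by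
    have h3 := tangent_le_defect_move (ξ := -d - √(1 - d ^ 2)) (d := d) (by linarith) hlt1
      (by rw [hang, hγ]; linarith) (by rw [hang, hcγ]; linarith)
    have e : (-d - √(1 - d ^ 2) + d) / √(1 - d ^ 2) = -1 := by
      field_simp; ring
    rw [move, e, defect_neg_one] at h3
    rw [e, defect]
    simp only [add_neg_cancel, Real.exp_zero]
    linarith
  have := hconv.trans (max_le hfirst hsecond)
  simp only [move]
  rw [defect] at this
  linarith

/-- The slope of a supporting line of the profile with respect to admissible steps. -/
noncomputable def slope (ξ : ℝ) : ℝ :=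
  if ξ ≤ -1 then Real.exp (1 + ξ) / 2 else if ξ < 1 then Real.exp (-angle ξ) / 2 else 0

/-- The one-step inequality for the profile. For `|ξ| < 1` the step `d` leads to the region `ξ ≥ 1`
if `d ≥ cos η` and to the region `ξ ≤ -1` if `d ≤ -sin η`. -/
theorem profile_move_le (ξ : ℝ) {d : ℝ} (hd : d ^ 2 < 1) :
    profile (move ξ d) ≤ profile ξ + slope ξ * d := by
  rcases le_or_gt ξ (-1) with h | h
  · rw [slope, if_pos h, profile_of_le h]
    linarith [profile_move_le_of_le_neg_one h hd]
  rcases le_or_gt 1 ξ with h1 | h1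
  · rw [slope, if_neg (by linarith), if_neg (by linarith), profile_of_ge h1]
    linarith [profile_le_one (move ξ d)]
  rw [slope, if_neg (by linarith), if_pos h1, profile_of_mem h.le h1.le]
  have hdef : 1 - defect ξ + Real.exp (-angle ξ) / 2 * d =
      1 - Real.exp (-angle ξ) / 2 * (Real.cos (angle ξ) - d) := by rw [defect]; ring
  rw [hdef]
  rcases le_or_gt (Real.cos (angle ξ)) d with hc | hc
  · have := profile_le_one (move ξ d)
    nlinarith [Real.exp_pos (-angle ξ)]
  rcases lt_or_ge d (-Real.sin (angle ξ)) with hs | hs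
  · have h3 := exp_move_le_of_lt_neg_sin h h1 hs hd
    rcases le_total (move ξ d) (-1) with hm | hm
    · rwa [profile_of_le hm]
    · exfalso
      have hp : 0 < √(1 - d ^ 2) := Real.sqrt_pos.2 (by linarith)
      have hss : √(1 - d ^ 2) ^ 2 = 1 - d ^ 2 := Real.sq_sqrt (by linarith)
      rw [move, le_div_iff₀ hp] at hm
      have ha := sin_angle_sub_cos_angle (sq_le_two h.le h1.le)
      have hb := Real.sin_sq_add_cos_sq (angle ξ)
      have hc := cos_angle_pos h.le h1
      have hsn := sin_angle_nonneg h.le h1.le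
      nlinarith
  · have h3 := tangent_le_defect_move h h1 hs hc
    have hm : -1 ≤ move ξ d ∧ move ξ d ≤ 1 := by
      have hb := Real.sin_sq_add_cos_sq (angle ξ)
      have ha := sin_angle_sub_cos_angle (sq_le_two h.le h1.le)
      have hp : 0 < √(1 - d ^ 2) := Real.sqrt_pos.2 (by linarith)
      have : |ξ + d| ≤ √(1 - d ^ 2) := Real.abs_le_sqrt (by
        have : 0 ≤ (Real.sin (angle ξ) + d) * (Real.cos (angle ξ) - d) :=
          mul_nonneg (by linarith) (by linarith)
        generalize Real.sin (angle ξ) = s at *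
        generalize Real.cos (angle ξ) = c at *
        subst ha
        nlinarith)
      rw [abs_le] at this
      rw [move, le_div_iff₀ hp, div_le_one hp]
      constructor <;> linarith
    rw [profile_of_mem hm.1 hm.2]
    linarith

theorem chi_of_nonneg {x : ℝ} (h : 0 ≤ x) : chi x = 1 := Set.indicator_of_mem (by exact h) _

theorem chi_of_neg {x : ℝ} (h : x < 0) : chi x = 0 := Set.indicator_of_notMem (by simpa using h) _

/-- The one-step inequality for the step up that exhausts the square function. -/
theorem chi_add_one_le (ξ : ℝ) : chi (ξ + 1) ≤ profile ξ + slope ξ := by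
  rcases lt_or_ge ξ (-1) with h | h
  · rw [chi_of_neg (by linarith), slope, if_pos h.le]
    have := profile_nonneg ξ
    positivity
  rw [chi_of_nonneg (by linarith)]
  rcases h.eq_or_lt with rfl | h
  · rw [slope, if_pos le_rfl, profile_of_le le_rfl]; norm_num
  rcases le_or_gt 1 ξ with h1 | h1
  · rw [slope, if_neg (by linarith), if_neg (by linarith), profile_of_ge h1]; norm_num
  rw [slope, if_neg (by linarith), if_pos h1, profile_of_mem h.le h1.le, defect]
  nlinarith [Real.exp_pos (-angle ξ), Real.cos_le_one (angle ξ)]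

/-- The one-step inequality for the step down that exhausts the square function. -/
theorem chi_sub_one_le (ξ : ℝ) : chi (ξ - 1) ≤ profile ξ - slope ξ := by
  rcases le_or_gt 1 ξ with h1 | h1
  · rw [slope, if_neg (by linarith), if_neg (by linarith), profile_of_ge h1,
      chi_of_nonneg (by linarith)]
    norm_num
  rw [chi_of_neg (by linarith)]
  rcases le_or_gt ξ (-1) with h | h
  · rw [slope, if_pos h, profile_of_le h]; norm_num
  rw [slope, if_neg (by linarith), if_pos h1, profile_of_mem h.le h1.le, defect]
  have h2 : Real.exp (-angle ξ) ≤ 1 := Real.exp_le_one_iff.2 (by linarith [angle_nonneg h.le])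
  nlinarith [Real.exp_pos (-angle ξ), Real.cos_le_one (angle ξ)]

/-- The Bellman function on the boundary in question, as a function of the position `x` and of the
prescribed remaining square function `t`. -/
noncomputable def value (x t : ℝ) : ℝ := if t ≤ 0 then chi x else profile (x / √t)

theorem value_zero (x : ℝ) : value x 0 = chi x := if_pos le_rfl

theorem value_of_pos (x : ℝ) {t : ℝ} (h : 0 < t) : value x t = profile (x / √t) :=
  if_neg (not_le.2 h)

/-- The one-step inequality: along the steps `d` with `d² ≤ t` the function `value` lies below a
supporting line. -/
theorem value_add_le (x t : ℝ) {d : ℝ} (hd : d ^ 2 ≤ t) :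
    value (x + d) (t - d ^ 2) ≤ value x t + slope (x / √t) / √t * d := by
  rcases (le_trans (sq_nonneg d) hd).eq_or_lt with rfl | ht
  · have : d = 0 := by nlinarith
    subst this
    simp
  have hr : 0 < √t := Real.sqrt_pos.2 ht
  have hrr : √t ^ 2 = t := Real.sq_sqrt ht.le
  rw [value_of_pos x ht]
  have hdr : d = √t * (d / √t) := by field_simp
  rcases hd.eq_or_lt with he | hlt
  · have h0 : t - d ^ 2 = 0 := by linarith
    rw [h0, value_zero]
    have : (d - √t) * (d + √t) = 0 := by nlinarith
    rcases mul_eq_zero.1 this with h | h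
    · have e : d = √t := by linarith
      have h3 := chi_add_one_le (x / √t)
      have e2 : chi (x / √t + 1) = chi (x + d) := by
        rw [e]
        have : x / √t + 1 = (x + √t) / √t := by field_simp
        rw [this]
        rcases lt_or_ge (x + √t) 0 with h | h
        · rw [chi_of_neg h, chi_of_neg (div_neg_of_neg_of_pos h hr)]
        · rw [chi_of_nonneg h, chi_of_nonneg (by positivity)]
      rw [← e2, e, div_mul_cancel₀ _ hr.ne']
      exact h3
    · have e : d = -√t := by linarith
      have h3 := chi_sub_one_le (x / √t)
      have e2 : chi (x / √t - 1) = chi (x + d) := by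
        rw [e]
        have : x / √t - 1 = (x + -√t) / √t := by field_simp; ring
        rw [this]
        rcases lt_or_ge (x + -√t) 0 with h | h
        · rw [chi_of_neg h, chi_of_neg (div_neg_of_neg_of_pos h hr)]
        · rw [chi_of_nonneg h, chi_of_nonneg (by positivity)]
      rw [← e2, e, mul_neg, div_mul_cancel₀ _ hr.ne']
      exact h3
  · rw [value_of_pos _ (by linarith)]
    have h1 : (d / √t) ^ 2 < 1 := by rw [div_pow, hrr, div_lt_one ht]; exact hlt
    have h3 := profile_move_le (x / √t) h1
    have e : move (x / √t) (d / √t) = (x + d) / √(t - d ^ 2) := by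
      have : 1 - (d / √t) ^ 2 = (t - d ^ 2) / t := by rw [div_pow, hrr]; field_simp
      rw [move, this, Real.sqrt_div (by linarith), ← add_div]
      rw [div_div_div_cancel_right₀ hr.ne']
    rw [e] at h3
    refine h3.trans (le_of_eq ?_)
    ring

/-! ### The upper bound for martingales -/

section Upper

variable {Ω : Type*} {m : MeasurableSpace Ω}

theorem finite_range_of_finite_sets {m' : MeasurableSpace Ω}
    (hfin : {s : Set Ω | MeasurableSet[m'] s}.Finite) {α : Type*} [MeasurableSpace α]
    [MeasurableSingletonClass α] {X : Ω → α} (hX : Measurable[m'] X) : (Set.range X).Finite := by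
  refine Set.Finite.of_injOn (f := fun a => X ⁻¹' {a}) (fun a _ => hX (measurableSet_singleton a))
    ?_ hfin
  rintro _ ⟨ω, rfl⟩ b _ hab
  have : ω ∈ X ⁻¹' {b} := by rw [← show X ⁻¹' {X ω} = X ⁻¹' {b} from hab]; rfl
  exact this

theorem measurable_comp_of_finite_range {m' : MeasurableSpace Ω} {α β : Type*} [MeasurableSpace α]
    [MeasurableSingletonClass α] [MeasurableSpace β] {X : Ω → α} (hX : Measurable[m'] X)
    (hfin : (Set.range X).Finite) (g : α → β) : Measurable[m'] fun ω => g (X ω) :=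
  ((@SimpleFunc.mk Ω m' α X (fun a => hX (measurableSet_singleton a)) hfin).map g).measurable

theorem exists_bound_of_finite_range {X : Ω → ℝ} (hfin : (Set.range X).Finite) :
    ∃ C, ∀ ω, ‖X ω‖ ≤ C := by
  obtain ⟨C, hC⟩ := (hfin.image norm).bddAbove
  exact ⟨C, fun ω => hC ⟨X ω, ⟨ω, rfl⟩, rfl⟩⟩

theorem integrable_of_finite_range {P : Measure Ω} [IsFiniteMeasure P] {X : Ω → ℝ}
    (hX : Measurable X) (hfin : (Set.range X).Finite) : Integrable X P := by
  obtain ⟨C, hC⟩ := exists_bound_of_finite_range hfin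
  exact Integrable.of_bound hX.aestronglyMeasurable C (Eventually.of_forall hC)

variable {P : Measure Ω} {𝓕 : Filtration ℕ m} {φ : ℕ → Ω → ℝ}

theorem measurable_partial_sum (hφ : Martingale φ 𝓕 P) (n : ℕ) :
    Measurable[𝓕 n] fun ω => ∑ k ∈ Finset.range n, (φ (k + 1) ω - φ k ω) ^ 2 := by
  refine @Finset.measurable_fun_sum ℝ ℕ Ω _ _ _ (𝓕 n) _ _ fun k hk => ?_
  rw [Finset.mem_range] at hk
  have h1 : Measurable[𝓕 n] (φ (k + 1)) :=
    (hφ.stronglyMeasurable (k + 1)).measurable.mono (𝓕.mono hk) le_rfl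
  have h2 : Measurable[𝓕 n] (φ k) := (hφ.stronglyMeasurable k).measurable.mono (𝓕.mono hk.le) le_rfl
  exact (h1.sub h2).pow_const 2

variable [IsProbabilityMeasure P]

theorem IsFiniteFiltration.finite_range (hF : IsFiniteFiltration 𝓕) {α : Type*} [MeasurableSpace α]
    [MeasurableSingletonClass α] {n : ℕ} {X : Ω → α} (hX : Measurable[𝓕 n] X) :
    (Set.range X).Finite :=
  finite_range_of_finite_sets (hF.finite_sets n) hX

theorem integral_mul_increment (hF : IsFiniteFiltration 𝓕) (hφ : Martingale φ 𝓕 P) {n : ℕ}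
    {h : Ω → ℝ} (hh : Measurable[𝓕 n] h) :
    Integrable (fun ω => h ω * (φ (n + 1) ω - φ n ω)) P ∧
      ∫ ω, h ω * (φ (n + 1) ω - φ n ω) ∂P = 0 := by
  obtain ⟨C, hC⟩ := exists_bound_of_finite_range (hF.finite_range hh)
  have hd : Integrable (φ (n + 1) - φ n) P := (hφ.integrable _).sub (hφ.integrable _)
  have hint : Integrable (h * (φ (n + 1) - φ n)) P :=
    hd.bdd_mul (hh.mono (𝓕.le n) le_rfl).aestronglyMeasurable (Eventually.of_forall hC)
  refine ⟨hint, ?_⟩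
  have h1 := condExp_mul_of_stronglyMeasurable_left hh.stronglyMeasurable hint hd
  have h2 : P[φ (n + 1) - φ n | 𝓕 n] =ᵐ[P] 0 := by
    refine (condExp_sub (hφ.integrable _) (hφ.integrable _) _).trans ?_
    filter_upwards [hφ.condExp_ae_eq n.le_succ, hφ.condExp_ae_eq (le_refl n)] with ω h3 h4
    simp [h3, h4]
  calc ∫ ω, h ω * (φ (n + 1) ω - φ n ω) ∂P = ∫ ω, (P[h * (φ (n + 1) - φ n) | 𝓕 n]) ω ∂P :=
        (integral_condExp (𝓕.le n)).symm
    _ = ∫ ω, (0 : ℝ) ∂P := by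
        refine integral_congr_ae ?_
        filter_upwards [h1, h2] with ω h3 h4
        rw [h3, Pi.mul_apply, h4]
        simp
    _ = 0 := by simp

/-- As `𝓕 0` is trivial, a martingale starts at a constant, its expectation. -/
theorem martingale_zero_eq (hF : IsFiniteFiltration 𝓕) (hφ : Martingale φ 𝓕 P) (N : ℕ) (ω : Ω) :
    φ 0 ω = ∫ ω, φ N ω ∂P := by
  have h0 : StronglyMeasurable[⊥] (φ 0) := hF.zero_eq_bot ▸ hφ.stronglyMeasurable 0
  obtain ⟨c, hc⟩ := stronglyMeasurable_bot_iff.1 h0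
  have : ∫ ω, φ 0 ω ∂P = ∫ ω, φ N ω ∂P := by
    simpa using hφ.setIntegral_eq (Nat.zero_le N) MeasurableSet.univ
  rw [← this, hc]
  simp

theorem integral_sum_increments_sq (hF : IsFiniteFiltration 𝓕) (hφ : Martingale φ 𝓕 P) (N : ℕ) :
    ∫ ω, ∑ k ∈ Finset.range N, (φ (k + 1) ω - φ k ω) ^ 2 ∂P =
      ∫ ω, φ N ω ^ 2 ∂P - (∫ ω, φ N ω ∂P) ^ 2 := by
  have hsq : ∀ n, Integrable (fun ω => φ n ω ^ 2) P := fun n => by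
    have : Measurable[𝓕 n] fun ω => φ n ω ^ 2 := (hφ.stronglyMeasurable n).measurable.pow_const 2
    exact integrable_of_finite_range (this.mono (𝓕.le n) le_rfl) (hF.finite_range this)
  have hstep : ∀ n, Integrable (fun ω => (φ (n + 1) ω - φ n ω) ^ 2) P ∧
      ∫ ω, (φ (n + 1) ω - φ n ω) ^ 2 ∂P = ∫ ω, φ (n + 1) ω ^ 2 ∂P - ∫ ω, φ n ω ^ 2 ∂P := by
    intro n
    obtain ⟨i1, i2⟩ := integral_mul_increment hF hφ (hφ.stronglyMeasurable n).measurable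
    have e : (fun ω => (φ (n + 1) ω - φ n ω) ^ 2) = fun ω =>
        (φ (n + 1) ω ^ 2 - φ n ω ^ 2) - 2 * (φ n ω * (φ (n + 1) ω - φ n ω)) := by
      funext ω; ring
    rw [e]
    have i3 : Integrable (fun ω => φ (n + 1) ω ^ 2 - φ n ω ^ 2) P := (hsq (n + 1)).sub (hsq n)
    refine ⟨i3.sub (i1.const_mul 2), ?_⟩
    rw [integral_sub i3 (i1.const_mul 2), integral_const_mul, i2,
      integral_sub (hsq (n + 1)) (hsq n)]
    ring
  rw [integral_finsetSum _ fun k _ => (hstep k).1, Finset.sum_congr rfl fun k _ => (hstep k).2,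
    Finset.sum_range_sub (fun n => ∫ ω, φ n ω ^ 2 ∂P)]
  congr 1
  simp [martingale_zero_eq hF hφ N]

/-- The process `value (φ_n, t - ∑_{k<n} (φ_{k+1} - φ_k)²)` is a supermartingale, hence the
expectation of its final value is at most the initial value. -/
theorem integral_value_le (hF : IsFiniteFiltration 𝓕) (hφ : Martingale φ 𝓕 P) (t : ℝ)
    (ht : ∀ n, ∀ᵐ ω ∂P, ∑ k ∈ Finset.range n, (φ (k + 1) ω - φ k ω) ^ 2 ≤ t) (x : ℝ)
    (hx : ∀ ω, φ 0 ω = x) (n : ℕ) :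
    Integrable (fun ω => value (φ n ω)
      (t - ∑ k ∈ Finset.range n, (φ (k + 1) ω - φ k ω) ^ 2)) P ∧
    ∫ ω, value (φ n ω) (t - ∑ k ∈ Finset.range n, (φ (k + 1) ω - φ k ω) ^ 2) ∂P ≤ value x t := by
  have hX : ∀ n, Measurable[𝓕 n] fun ω => (φ n ω,
      t - ∑ k ∈ Finset.range n, (φ (k + 1) ω - φ k ω) ^ 2) := fun n =>
    (hφ.stronglyMeasurable n).measurable.prodMk ((measurable_partial_sum hφ n).const_sub t)
  have hint : ∀ n, Integrable (fun ω => value (φ n ω)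
      (t - ∑ k ∈ Finset.range n, (φ (k + 1) ω - φ k ω) ^ 2)) P := by
    intro n
    have h1 := measurable_comp_of_finite_range (hX n) (hF.finite_range (hX n))
      fun p => value p.1 p.2
    exact integrable_of_finite_range (h1.mono (𝓕.le n) le_rfl) (hF.finite_range h1)
  refine ⟨hint n, ?_⟩
  induction n with
  | zero => simp [hx]
  | succ n ih =>
    refine le_trans ?_ ih
    have h1 := measurable_comp_of_finite_range (hX n) (hF.finite_range (hX n))
      fun p => slope (p.1 / √p.2) / √p.2
    obtain ⟨i1, i2⟩ := integral_mul_increment hF hφ h1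
    have h3 := integral_mono_ae (hint (n + 1)) ((hint n).add i1) (by
      filter_upwards [ht (n + 1)] with ω hω
      rw [Finset.sum_range_succ] at hω
      have := value_add_le (φ n ω) (t - ∑ k ∈ Finset.range n, (φ (k + 1) ω - φ k ω) ^ 2)
        (d := φ (n + 1) ω - φ n ω) (by linarith)
      rw [Finset.sum_range_succ, ← sub_sub]
      simpa using this)
    refine h3.trans (le_of_eq ?_)
    simp only [Pi.add_apply]
    rw [integral_add (hint n) i1, i2, add_zero]

theorem expectation_chi {X : Ω → ℝ} (hX : Measurable X) {g : Ω → EReal}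
    (hg : ∀ᵐ ω ∂P, g ω = (chi (X ω) : EReal)) :
    expectation P g = ((P.real {ω | 0 ≤ X ω} : ℝ) : EReal) := by
  have hms : MeasurableSet {ω | 0 ≤ X ω} := measurableSet_le measurable_const hX
  have h1 : ∫⁻ ω, (g ω).toENNReal ∂P = P {ω | 0 ≤ X ω} := by
    rw [← lintegral_indicator_one hms]
    refine lintegral_congr_ae ?_
    filter_upwards [hg] with ω hω
    rw [hω]
    by_cases h : 0 ≤ X ω
    · rw [chi_of_nonneg h, Set.indicator_of_mem (by exact h), EReal.real_coe_toENNReal]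
      simp
    · rw [chi_of_neg (not_le.1 h), Set.indicator_of_notMem (by exact h)]; simp
  have h2 : ∫⁻ ω, (-g ω).toENNReal ∂P = 0 := by
    rw [← lintegral_zero (μ := P)]
    refine lintegral_congr_ae ?_
    filter_upwards [hg] with ω hω
    rw [hω]
    by_cases h : 0 ≤ X ω
    · rw [chi_of_nonneg h]; simp [EReal.toENNReal_of_nonpos]
    · rw [chi_of_neg (not_le.1 h)]; simp
  rw [expectation, h1, h2, Measure.real]
  simp [← EReal.coe_ennreal_toReal (measure_ne_top P _)]

end Upper

theorem terminal_eq {Ω : Type*} {φ : ℕ → Ω → ℝ} {N : ℕ} (hN : ∀ n, N ≤ n → φ (n + 1) = φ n) :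
    terminal φ = φ N := by
  have hc : ∀ n, N ≤ n → φ n = φ N := fun n hn => by
    induction n, hn using Nat.le_induction with
    | base => rfl
    | succ n hn ih => rw [hN n hn, ih]
  funext ω
  refine (tendsto_const_nhds.congr' ?_).limUnder_eq
  filter_upwards [eventually_ge_atTop N] with n hn
  rw [hc n hn]

theorem squareFunction_sq {Ω : Type*} {φ : ℕ → Ω → ℝ} {N : ℕ}
    (hN : ∀ n, N ≤ n → φ (n + 1) = φ n) (ω : Ω) :
    squareFunction φ ω ^ 2 = ∑ k ∈ Finset.range N, (φ (k + 1) ω - φ k ω) ^ 2 := by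
  have h : ∑' n, (φ (n + 1) ω - φ n ω) ^ 2 =
      ∑ k ∈ Finset.range N, (φ (k + 1) ω - φ k ω) ^ 2 := tsum_eq_sum fun n hn => by
    rw [hN n (by simpa using hn)]; simp
  rw [squareFunction, h, Real.sq_sqrt (Finset.sum_nonneg fun _ _ => sq_nonneg _)]

/-- If the penalized expectation is not `-∞`, then `S² ≤ y - x²` almost surely; as the expectation
of `S²` is `y - x²`, equality holds almost surely, and `integral_value_le` applies. -/
theorem B_le_value {Ω : Type*} [m : MeasurableSpace Ω] (P : Measure Ω) [IsProbabilityMeasure P]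
    {x y : ℝ} (hyx : y ≤ x ^ 2 + 1) :
    B P chi x y (√(1 - y + x ^ 2)) ≤ (value x (y - x ^ 2) : EReal) := by
  refine sSup_le ?_
  rintro _ ⟨𝓕, φ, hF, hφ, ⟨N, hN⟩, hx, hy, rfl⟩
  rw [terminal_eq hN] at hx hy
  have hz : √(1 - y + x ^ 2) ^ 2 = 1 - y + x ^ 2 := Real.sq_sqrt (by linarith)
  set S : Ω → ℝ := fun ω => ∑ k ∈ Finset.range N, (φ (k + 1) ω - φ k ω) ^ 2 with hS
  have hg : (fun ω => penalized chi (terminal φ ω) (squareFunction φ ω ^ 2 + √(1 - y + x ^ 2) ^ 2)) =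
      fun ω => penalized chi (φ N ω) (S ω + (1 - y + x ^ 2)) := by
    funext ω
    rw [terminal_eq hN, squareFunction_sq hN, hz]
  rw [hg]
  have hS0 : ∀ ω, 0 ≤ S ω := fun ω => Finset.sum_nonneg fun _ _ => sq_nonneg _
  have hSm : Measurable[𝓕 N] S := measurable_partial_sum hφ N
  have hX : Measurable[𝓕 N] fun ω => (φ N ω, S ω) := (hφ.stronglyMeasurable N).measurable.prodMk hSm
  have hφN : Measurable (φ N) := (hφ.stronglyMeasurable N).measurable.mono (𝓕.le N) le_rfl
  by_cases hle : ∀ᵐ ω ∂P, S ω ≤ y - x ^ 2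
  · have hSint : Integrable S P :=
      integrable_of_finite_range (hSm.mono (𝓕.le N) le_rfl) (hF.finite_range hSm)
    have hSeq : ∀ᵐ ω ∂P, S ω = y - x ^ 2 := by
      have h1 : ∫ ω, (y - x ^ 2 - S ω) ∂P = 0 := by
        rw [integral_sub (integrable_const _) hSint, integral_sum_increments_sq hF hφ N, hx, hy]
        simp
      have h2 := (integral_eq_zero_iff_of_nonneg_ae (by
        filter_upwards [hle] with ω hω using sub_nonneg.2 hω)
        ((integrable_const _).sub hSint)).1 h1
      filter_upwards [h2] with ω hω
      simp only [Pi.zero_apply, Pi.sub_apply] at hω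
      linarith
    rw [expectation_chi hφN (by
      filter_upwards [hle] with ω hω
      exact if_pos ⟨by linarith [hS0 ω], by linarith⟩)]
    rw [EReal.coe_le_coe_iff]
    have ht : ∀ n, ∀ᵐ ω ∂P, ∑ k ∈ Finset.range n, (φ (k + 1) ω - φ k ω) ^ 2 ≤ y - x ^ 2 := by
      intro n
      filter_upwards [hle] with ω hω
      refine le_trans ?_ hω
      have e1 : S ω = ∑ k ∈ Finset.range (max n N), (φ (k + 1) ω - φ k ω) ^ 2 :=
        (squareFunction_sq hN ω).symm.trans
          (squareFunction_sq (fun k hk => hN k (le_trans (le_max_right _ _) hk)) ω)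
      rw [e1]
      exact Finset.sum_le_sum_of_subset_of_nonneg
        (Finset.range_mono (le_max_left _ _)) fun _ _ _ => sq_nonneg _
    obtain ⟨-, h3⟩ := integral_value_le hF hφ _ ht x
      (fun ω => by rw [martingale_zero_eq hF hφ N ω, hx]) N
    refine le_trans (le_of_eq ?_) h3
    rw [← integral_indicator_one (measurableSet_le measurable_const hφN)]
    refine integral_congr_ae ?_
    filter_upwards [hSeq] with ω hω
    rw [show ∑ k ∈ Finset.range N, (φ (k + 1) ω - φ k ω) ^ 2 = y - x ^ 2 from hω, sub_self,
      value_zero]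
    by_cases h : 0 ≤ φ N ω
    · rw [chi_of_nonneg h, Set.indicator_of_mem (by exact h)]; simp
    · rw [chi_of_neg (not_le.1 h), Set.indicator_of_notMem (by exact h)]
  · have htop : ∫⁻ ω, (-penalized chi (φ N ω) (S ω + (1 - y + x ^ 2))).toENNReal ∂P = ⊤ := by
      by_contra hne
      have hmeas := measurable_comp_of_finite_range hX (hF.finite_range hX)
        fun p => (-penalized chi p.1 (p.2 + (1 - y + x ^ 2))).toENNReal
      refine hle ?_
      filter_upwards [ae_lt_top (hmeas.mono (𝓕.le N) le_rfl) hne] with ω hω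
      by_contra hcon
      rw [penalized, if_neg (fun h => hcon (by linarith [h.2]))] at hω
      simp at hω
    rw [expectation, htop]
    simp

/-! ### Almost optimal trees -/

/-- `Attainable x t v`: there is a finite binary tree of mean-zero steps from `x` such that the
squares of the steps along each path add up to `t`, and such that `v` is the probability to end in
`[0, ∞)`. -/
inductive Attainable : ℝ → ℝ → ℝ → Prop
  | leaf (x : ℝ) : Attainable x 0 (chi x)
  | branch {x t d₁ d₂ v₁ v₂ : ℝ} (h₁ : 0 < d₁) (h₂ : 0 < d₂)
      (up : Attainable (x + d₁) (t - d₁ ^ 2) v₁) (down : Attainable (x - d₂) (t - d₂ ^ 2) v₂) :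
      Attainable x t ((d₂ * v₁ + d₁ * v₂) / (d₁ + d₂))

theorem attainable_symmetric (x : ℝ) {t : ℝ} (ht : 0 < t) :
    Attainable x t ((chi (x + √t) + chi (x - √t)) / 2) := by
  have hr : 0 < √t := Real.sqrt_pos.2 ht
  have h0 : t - √t ^ 2 = 0 := by rw [Real.sq_sqrt ht.le, sub_self]
  have := Attainable.branch (x := x) (t := t) hr hr (by rw [h0]; exact .leaf _)
    (by rw [h0]; exact .leaf _)
  convert this using 1
  field_simp
  norm_num

theorem attainable_one {x t : ℝ} (ht : 0 ≤ t) (h : √t ≤ x) : Attainable x t 1 := by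
  rcases ht.eq_or_lt with rfl | ht
  · rw [Real.sqrt_zero] at h
    simpa [chi_of_nonneg h] using Attainable.leaf x
  · have := attainable_symmetric x ht
    have hr : 0 < √t := Real.sqrt_pos.2 ht
    rwa [chi_of_nonneg (by linarith), chi_of_nonneg (by linarith), add_self_div_two] at this

/-- The value `v` is attainable from all points `(x, t)` with `x / √t = ξ`. -/
def AttainableRatio (ξ v : ℝ) : Prop := ∀ t, 0 < t → Attainable (ξ * √t) t v

theorem attainableRatio_neg_one : AttainableRatio (-1) (1 / 2) := by
  intro t ht
  have hr : 0 < √t := Real.sqrt_pos.2 ht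
  have := attainable_symmetric (-1 * √t) ht
  rwa [chi_of_nonneg (by linarith), chi_of_neg (by linarith), add_zero] at this

theorem move_mul_sqrt (ξ : ℝ) {d t : ℝ} (hd : d ^ 2 < 1) (ht : 0 < t) :
    0 < t - (d * √t) ^ 2 ∧ move ξ d * √(t - (d * √t) ^ 2) = ξ * √t + d * √t := by
  have e : t - (d * √t) ^ 2 = (1 - d ^ 2) * t := by rw [mul_pow, Real.sq_sqrt ht.le]; ring
  have hp : 0 < 1 - d ^ 2 := by linarith
  have hs : 0 < √(1 - d ^ 2) := Real.sqrt_pos.2 hp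
  rw [e]
  refine ⟨by positivity, ?_⟩
  rw [Real.sqrt_mul hp.le, move]
  field_simp

/-- A short step up, or a jump down that exhausts the square function. -/
theorem AttainableRatio.step_up {ξ δ v : ℝ} (hξ : ξ < 1) (h0 : 0 < δ) (h1 : δ < 1)
    (h : AttainableRatio (move ξ δ) v) : AttainableRatio ξ (v / (1 + δ)) := by
  intro t ht
  have hr : 0 < √t := Real.sqrt_pos.2 ht
  obtain ⟨hp, he⟩ := move_mul_sqrt ξ (by nlinarith : δ ^ 2 < 1) ht
  have hup := h _ hp
  rw [he] at hup
  have hdown : Attainable (ξ * √t - √t) (t - √t ^ 2) 0 := by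
    rw [Real.sq_sqrt ht.le, sub_self]
    have := Attainable.leaf (ξ * √t - √t)
    rwa [chi_of_neg (show ξ * √t - √t < 0 by nlinarith)] at this
  have := Attainable.branch (mul_pos h0 hr) hr hup hdown
  convert this using 1
  field_simp
  ring

/-- A short step down, or a jump up to the region where `[0, ∞)` is reached with certainty. -/
theorem AttainableRatio.step_down {ξ δ v : ℝ} (hξ0 : -1 < ξ) (hξ1 : ξ < 1) (h0 : 0 < δ) (h1 : δ < 1)
    (h : AttainableRatio (move ξ (-δ)) v) :
    AttainableRatio ξ ((δ + Real.cos (angle ξ) * v) / (Real.cos (angle ξ) + δ)) := by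
  intro t ht
  have hr : 0 < √t := Real.sqrt_pos.2 ht
  have hc := cos_angle_pos hξ0.le hξ1
  have hs := sin_angle_nonneg hξ0.le hξ1.le
  have ha := sin_angle_sub_cos_angle (sq_le_two hξ0.le hξ1.le)
  have hb := Real.sin_sq_add_cos_sq (angle ξ)
  obtain ⟨hp, he⟩ := move_mul_sqrt ξ (by nlinarith : (-δ) ^ 2 < 1) ht
  have hdown := h _ hp
  have e1 : ξ * √t + -δ * √t = ξ * √t - δ * √t := by ring
  have e2 : (-δ * √t) ^ 2 = (δ * √t) ^ 2 := by ring
  rw [he, e1, e2] at hdown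
  have hup : Attainable (ξ * √t + Real.cos (angle ξ) * √t) (t - (Real.cos (angle ξ) * √t) ^ 2) 1 := by
    have e3 : t - (Real.cos (angle ξ) * √t) ^ 2 = (Real.sin (angle ξ) * √t) ^ 2 := by
      rw [mul_pow, mul_pow, Real.sq_sqrt ht.le]
      linear_combination (-t) * hb
    refine attainable_one (by rw [e3]; positivity) ?_
    rw [e3, Real.sqrt_sq (by positivity), ← add_mul]
    exact mul_le_mul_of_nonneg_right (by linarith) hr.le
  have := Attainable.branch (mul_pos hc hr) (mul_pos h0 hr) hup hdown
  convert this using 1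
  field_simp

/-- The step up from `-(p + h)` to `-p` has length `h` up to an error of second order. -/
theorem exists_step_up {p M h : ℝ} (hp : 1 ≤ p) (hpM : p ≤ M) (hh : 0 < h) (hMh : 4 * M * h ≤ 1) :
    ∃ δ, 0 < δ ∧ δ < 1 ∧ δ ≤ h + 4 * M * h ^ 2 ∧ move (-(p + h)) δ = -p := by
  have hK : 4 * M * h ^ 2 ≤ h := by nlinarith
  have hh4 : h ≤ 1 / 4 := by nlinarith
  set e := h + 4 * M * h ^ 2 with he
  have hM0 : 0 < M := by linarith
  have he0 : 0 < e := by positivity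
  have he2 : e ≤ 2 * h := by linarith
  have hcont : ContinuousOn (fun δ : ℝ => √(1 - δ ^ 2) * p + δ - (p + h)) (Set.Icc 0 e) := by
    fun_prop
  have hsq : 1 - e ^ 2 ≤ √(1 - e ^ 2) := by
    have h1 : e ^ 2 ≤ 1 := by nlinarith
    exact Real.le_sqrt_of_sq_le (by nlinarith [sq_nonneg e])
  have hroot : (0 : ℝ) ∈ Set.Icc ((fun δ : ℝ => √(1 - δ ^ 2) * p + δ - (p + h)) 0)
      ((fun δ : ℝ => √(1 - δ ^ 2) * p + δ - (p + h)) e) := by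
    constructor
    · simp [hh.le]
    · simp only
      have h1 : (1 - e ^ 2) * p ≤ √(1 - e ^ 2) * p := mul_le_mul_of_nonneg_right hsq (by linarith)
      have h2 : e ^ 2 * p ≤ (2 * h) ^ 2 * M := mul_le_mul (by gcongr) hpM (by linarith) (by positivity)
      nlinarith
  obtain ⟨δ, hδ, hδ0⟩ := intermediate_value_Icc he0.le hcont hroot
  have hδpos : 0 < δ := by
    refine lt_of_le_of_ne hδ.1 fun h => ?_
    rw [← h] at hδ0
    simp at hδ0
    linarith
  have hδ1 : δ < 1 := by linarith [hδ.2]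
  refine ⟨δ, hδpos, hδ1, hδ.2, ?_⟩
  have hs : 0 < √(1 - δ ^ 2) := Real.sqrt_pos.2 (by nlinarith)
  rw [move, div_eq_iff hs.ne']
  simp only at hδ0
  linarith

/-- The path from `ξ` to `-1` is divided into `n` equal parts. A step up of length `δ` succeeds with
probability `1 / (1 + δ)`, and the product of these factors tends to `exp (1 + ξ)`. -/
theorem exists_attainable_of_lt_neg_one {ξ : ℝ} (hξ : ξ < -1) {η : ℝ} (hη : 0 < η) :
    ∃ v, AttainableRatio ξ v ∧ Real.exp (1 + ξ) / 2 - η < v := by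
  set D := -1 - ξ with hD
  have hDpos : 0 < D := by linarith
  set M := 1 + D with hM
  have hmain : ∀ n : ℕ, 4 * M * D ≤ n → 0 < n →
      ∃ v, AttainableRatio ξ v ∧ Real.exp (-(D + 4 * M * D ^ 2 / n)) / 2 ≤ v := by
    intro n hn hn0
    have hn' : (0 : ℝ) < n := by exact_mod_cast hn0
    set h := D / n with hh
    have hhpos : 0 < h := by positivity
    have hnh : n * h = D := by rw [hh]; field_simp
    have hMh : 4 * M * h ≤ 1 := by
      rw [hh, ← mul_div_assoc, div_le_one hn']; exact hn
    have hind : ∀ k : ℕ, k ≤ n → ∃ v, AttainableRatio (-(1 + k * h)) v ∧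
        Real.exp (-(k * (h + 4 * M * h ^ 2))) / 2 ≤ v := by
      intro k
      induction k with
      | zero => exact fun _ => ⟨1 / 2, by simpa using attainableRatio_neg_one, by simp⟩
      | succ k ih =>
        intro hk
        obtain ⟨v, hv, hv'⟩ := ih (Nat.le_of_succ_le hk)
        have hkn : (k : ℝ) * h ≤ D := by
          rw [← hnh]; gcongr; exact Nat.le_of_succ_le hk
        obtain ⟨δ, h0, h1, h2, h3⟩ := exists_step_up (p := 1 + k * h) (M := M) (h := h)
          (by linarith [mul_nonneg (Nat.cast_nonneg (α := ℝ) k) hhpos.le]) (by linarith) hhpos hMh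
        have e : -(1 + ((k + 1 : ℕ) : ℝ) * h) = -(1 + k * h + h) := by push_cast; ring
        refine ⟨v / (1 + δ), ?_, ?_⟩
        · rw [e]
          refine AttainableRatio.step_up ?_ h0 h1 (by rw [h3]; exact hv)
          linarith [mul_nonneg (Nat.cast_nonneg (α := ℝ) k) hhpos.le]
        · have h5 : 1 + δ ≤ Real.exp (h + 4 * M * h ^ 2) := by
            linarith [Real.add_one_le_exp (h + 4 * M * h ^ 2)]
          rw [le_div_iff₀ (by linarith)]
          have e2 : Real.exp (-(k * (h + 4 * M * h ^ 2))) =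
              Real.exp (-(((k + 1 : ℕ) : ℝ) * (h + 4 * M * h ^ 2))) *
                Real.exp (h + 4 * M * h ^ 2) := by
            rw [← Real.exp_add]; congr 1; push_cast; ring
          rw [e2] at hv'
          have h6 := mul_le_mul_of_nonneg_left h5
            (Real.exp_pos (-(((k + 1 : ℕ) : ℝ) * (h + 4 * M * h ^ 2)))).le
          linarith
    obtain ⟨v, hv, hv'⟩ := hind n le_rfl
    refine ⟨v, ?_, ?_⟩
    · have : -(1 + (n : ℝ) * h) = ξ := by rw [hnh]; linarith
      rwa [this] at hv
    · have : (n : ℝ) * (h + 4 * M * h ^ 2) = D + 4 * M * D ^ 2 / n := by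
        rw [mul_add, hnh]; rw [hh]; field_simp
      rwa [this] at hv'
  have hlim : Tendsto (fun n : ℕ => Real.exp (-(D + 4 * M * D ^ 2 / n)) / 2) atTop
      (nhds (Real.exp (1 + ξ) / 2)) := by
    have h1 := tendsto_const_div_atTop_nhds_zero_nat (4 * M * D ^ 2)
    have h2 : Tendsto (fun n : ℕ => -(D + 4 * M * D ^ 2 / n)) atTop (nhds (1 + ξ)) := by
      have := (h1.const_add D).neg
      convert this using 2
      rw [hD]; ring
    exact ((Real.continuous_exp.tendsto _).comp h2).div_const 2
  have hev := hlim.eventually (lt_mem_nhds (show Real.exp (1 + ξ) / 2 - η < Real.exp (1 + ξ) / 2 by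
    linarith))
  obtain ⟨n, h1, h2, h3⟩ := (hev.and ((eventually_ge_atTop ⌈4 * M * D⌉₊).and
    (eventually_gt_atTop 0))).exists
  obtain ⟨v, hv, hv'⟩ := hmain n ((Nat.le_ceil _).trans (by exact_mod_cast h2)) h3
  exact ⟨v, hv, lt_of_lt_of_le h1 hv'⟩

/-- The step down of length `δ` that decreases the angle from `η + h` to `η`. By
`AttainableRatio.step_down` it divides `(1 - v) / cos` by `(cos (η + h) + δ) / cos η`, which is `exp h`
up to an error of second order. -/
theorem exists_step_down {η₀ η h : ℝ} (hη : 0 ≤ η) (hh : 0 < h) (hle : η + h ≤ η₀)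
    (hη₀ : η₀ < Real.pi / 2) (hh16 : h ≤ 1 / 16) :
    ∃ δ, 0 < δ ∧ δ < 1 ∧
      move (Real.sin (η + h) - Real.cos (η + h)) (-δ) = Real.sin η - Real.cos η ∧
      Real.cos η * Real.exp h ≤
        (Real.cos (η + h) + δ) * (1 + 18 / Real.cos η₀ * h ^ 2) := by
  have hpi := Real.pi_pos
  have hc0 : 0 < Real.cos η₀ := Real.cos_pos_of_mem_Ioo ⟨by linarith, hη₀⟩
  have hcc : Real.cos η₀ ≤ Real.cos (η + h) :=
    Real.cos_le_cos_of_nonneg_of_le_pi (by linarith) (by linarith) hle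
  have hcl : Real.cos (η + h) < Real.cos η :=
    Real.cos_lt_cos_of_nonneg_of_le_pi hη (by linarith) (by linarith)
  have hsl : Real.sin η < Real.sin (η + h) :=
    Real.sin_lt_sin_of_lt_of_le_pi_div_two (by linarith) (by linarith) (by linarith)
  have hs0 : 0 ≤ Real.sin η := Real.sin_nonneg_of_nonneg_of_le_pi hη (by linarith)
  have hs1 := Real.sin_le_one η
  have hc1 := Real.cos_le_one η
  have hsinh : h - h ^ 3 / 4 ≤ Real.sin h := by
    have := Real.sin_gt_sub_cube hh
    nlinarith [pow_pos hh 3]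
  have hsinh' : Real.sin h ≤ h := Real.sin_le hh.le
  have hcosh := Real.one_sub_sq_div_two_le_cos (x := h)
  have hcosh' := Real.cos_le_one h
  have es : Real.sin (η + h) = Real.sin η * Real.cos h + Real.cos η * Real.sin h := Real.sin_add _ _
  have ec : Real.cos (η + h) = Real.cos η * Real.cos h - Real.sin η * Real.sin h := Real.cos_add _ _
  have hcη : 0 < Real.cos η := by linarith
  have hh3 : h ^ 3 / 4 ≤ h ^ 2 / 2 := by nlinarith [sq_nonneg h]
  have hslow : Real.cos η * h - h ^ 2 ≤ Real.sin (η + h) - Real.sin η := by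
    rw [es]
    have h1 : Real.sin η * (1 - h ^ 2 / 2) ≤ Real.sin η * Real.cos h :=
      mul_le_mul_of_nonneg_left hcosh hs0
    have h2 : Real.cos η * (h - h ^ 3 / 4) ≤ Real.cos η * Real.sin h :=
      mul_le_mul_of_nonneg_left hsinh hcη.le
    have h3 : Real.cos η * (h ^ 3 / 4) ≤ h ^ 2 / 2 :=
      le_trans (mul_le_of_le_one_left (by positivity) hc1) hh3
    have h4 : Real.sin η * (h ^ 2 / 2) ≤ h ^ 2 / 2 := mul_le_of_le_one_left (by positivity) hs1
    linarith
  have hdiff : (Real.cos η - Real.sin η) - (Real.cos (η + h) - Real.sin (η + h)) ≤ 3 * h := by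
    rw [es, ec]
    have h1 : Real.sin η * Real.cos h ≤ Real.sin η := mul_le_of_le_one_right hs0 hcosh'
    have h2 : Real.cos η * Real.sin h ≤ h :=
      le_trans (mul_le_of_le_one_left (by nlinarith) hc1) hsinh'
    have h3 : Real.sin η * Real.sin h ≤ h :=
      le_trans (mul_le_of_le_one_left (by nlinarith) hs1) hsinh'
    have h4 : Real.cos η * (1 - h ^ 2 / 2) ≤ Real.cos η * Real.cos h :=
      mul_le_mul_of_nonneg_left hcosh hcη.le
    have h5 : Real.cos η * (h ^ 2 / 2) ≤ h ^ 2 / 2 := mul_le_of_le_one_left (by positivity) hc1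
    nlinarith
  set a := Real.cos η - Real.sin η with ha
  set b := Real.cos (η + h) - Real.sin (η + h) with hb
  have ha1 : a ≤ 1 := by linarith
  have ha0 : -1 ≤ a := by linarith
  have hcont : ContinuousOn (fun δ : ℝ => δ + b - √(1 - δ ^ 2) * a) (Set.Icc 0 (4 * h)) := by
    fun_prop
  have hsqle : ∀ δ : ℝ, 0 ≤ δ → δ ≤ 1 → 1 - δ ^ 2 ≤ √(1 - δ ^ 2) ∧ √(1 - δ ^ 2) ≤ 1 := by
    intro δ h0 h1
    have : δ ^ 2 ≤ 1 := by nlinarith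
    exact ⟨Real.le_sqrt_of_sq_le (by nlinarith [sq_nonneg δ]),
      Real.sqrt_le_one.2 (by nlinarith [sq_nonneg δ])⟩
  have hroot : (0 : ℝ) ∈ Set.Icc ((fun δ : ℝ => δ + b - √(1 - δ ^ 2) * a) 0)
      ((fun δ : ℝ => δ + b - √(1 - δ ^ 2) * a) (4 * h)) := by
    constructor
    · simp; linarith
    · simp only
      obtain ⟨s1, s2⟩ := hsqle (4 * h) (by positivity) (by linarith)
      have : (1 - √(1 - (4 * h) ^ 2)) * (-a) ≤ (4 * h) ^ 2 * 1 :=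
        le_trans (mul_le_mul_of_nonneg_left (by linarith) (by linarith))
          (mul_le_mul_of_nonneg_right (by linarith) zero_le_one)
      linarith [mul_le_mul_of_nonneg_left hh16 hh.le]
  obtain ⟨δ, hδ, hδ0⟩ := intermediate_value_Icc (by positivity : (0 : ℝ) ≤ 4 * h) hcont hroot
  simp only at hδ0
  have hδpos : 0 < δ := by
    refine lt_of_le_of_ne hδ.1 fun h0 => ?_
    rw [← h0] at hδ0
    simp at hδ0
    linarith
  have hδ4 := hδ.2
  obtain ⟨s1, s2⟩ := hsqle δ hδ.1 (by linarith)
  have hs : 0 < √(1 - δ ^ 2) := Real.sqrt_pos.2 (by nlinarith)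
  refine ⟨δ, hδpos, by linarith, ?_, ?_⟩
  · rw [move, neg_sq, div_eq_iff hs.ne']
    linarith
  · have h1 : a - δ ^ 2 ≤ √(1 - δ ^ 2) * a := by
      have : (1 - √(1 - δ ^ 2)) * a ≤ δ ^ 2 * 1 :=
        le_trans (mul_le_mul_of_nonneg_left ha1 (by linarith))
          (mul_le_mul_of_nonneg_right (by linarith) zero_le_one)
      linarith
    have h2 : δ ^ 2 ≤ (4 * h) ^ 2 := by gcongr
    have h3 := Real.abs_exp_sub_one_sub_id_le (x := h) (by rw [abs_of_pos hh]; linarith)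
    rw [abs_le] at h3
    have h4 : Real.cos η * Real.exp h ≤ Real.cos η * (1 + h) + h ^ 2 := by
      have h5 : Real.cos η * Real.exp h ≤ Real.cos η * (1 + h + h ^ 2) :=
        mul_le_mul_of_nonneg_left (by linarith) hcη.le
      have h6 : Real.cos η * h ^ 2 ≤ h ^ 2 := mul_le_of_le_one_left (by positivity) hc1
      linarith
    have h7 : Real.cos η * Real.exp h ≤ Real.cos (η + h) + δ + 18 * h ^ 2 := by linarith
    have h8 : 18 * h ^ 2 ≤ (Real.cos (η + h) + δ) * (18 / Real.cos η₀ * h ^ 2) := by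
      have e1 : 18 * h ^ 2 = Real.cos η₀ * (18 / Real.cos η₀ * h ^ 2) := by field_simp
      rw [e1]
      exact mul_le_mul_of_nonneg_right (by linarith) (by positivity)
    linarith

/-- The angle is raised from `0` to `angle ξ` in `n` equal steps. Each of them multiplies
`(1 - v) / cos η` by `exp (-h)`, up to errors whose product tends to `1`. -/
theorem exists_attainable_of_mem_Ioo {ξ : ℝ} (h0 : -1 < ξ) (h1 : ξ < 1) {κ : ℝ} (hκ : 0 < κ) :
    ∃ v, AttainableRatio ξ v ∧ 1 - defect ξ - κ < v := by
  have hpi := Real.pi_pos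
  have hc := cos_angle_pos h0.le h1
  have hξ := sin_angle_sub_cos_angle (sq_le_two h0.le h1.le)
  have hη0 : 0 < angle ξ := by
    refine lt_of_le_of_ne (angle_nonneg h0.le) fun h => ?_
    rw [← h] at hξ
    simp at hξ
    linarith
  have hη1 : angle ξ < Real.pi / 2 := by
    refine lt_of_le_of_ne (angle_le h1.le) fun h => ?_
    rw [h, Real.cos_pi_div_two] at hc
    exact lt_irrefl _ hc
  set η₀ := angle ξ with hη₀
  set K := 18 / Real.cos η₀ with hK
  have hKpos : 0 < K := by positivity
  have hmain : ∀ n : ℕ, 16 * η₀ ≤ n → 0 < n →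
      ∃ v, AttainableRatio ξ v ∧ 1 - v ≤ defect ξ * Real.exp (K * η₀ ^ 2 / n) := by
    intro n hn hn0
    have hn' : (0 : ℝ) < n := by exact_mod_cast hn0
    set h := η₀ / n with hh
    have hhpos : 0 < h := by positivity
    have hnh : n * h = η₀ := by rw [hh]; field_simp
    have hh16 : h ≤ 1 / 16 := by
      rw [hh, div_le_div_iff₀ hn' (by norm_num)]; linarith
    have hind : ∀ k : ℕ, k ≤ n → ∃ v,
        AttainableRatio (Real.sin (k * h) - Real.cos (k * h)) v ∧
        1 - v ≤ Real.cos (k * h) * Real.exp (-(k * h)) / 2 * (1 + K * h ^ 2) ^ k := by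
      intro k
      induction k with
      | zero => exact fun _ => ⟨1 / 2, by simpa using attainableRatio_neg_one, by norm_num⟩
      | succ k ih =>
        intro hk
        obtain ⟨v, hv, hv'⟩ := ih (Nat.le_of_succ_le hk)
        have hk0 : (0 : ℝ) ≤ k * h := by positivity
        have e : ((k + 1 : ℕ) : ℝ) * h = k * h + h := by push_cast; ring
        have hkn : k * h + h ≤ η₀ := by
          rw [← hnh, ← e]; gcongr
        obtain ⟨δ, hδ0, hδ1, h3, h4⟩ := exists_step_down hk0 hhpos hkn hη1 hh16
        have hang : angle (Real.sin (k * h + h) - Real.cos (k * h + h)) = k * h + h :=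
          angle_sin_sub_cos (by linarith) (by linarith)
        have hcpos : 0 < Real.cos (k * h + h) :=
          Real.cos_pos_of_mem_Ioo ⟨by linarith, by linarith⟩
        have hspos : 0 < Real.sin (k * h + h) := Real.sin_pos_of_pos_of_lt_pi (by linarith) (by linarith)
        have hstep := AttainableRatio.step_down (ξ := Real.sin (k * h + h) - Real.cos (k * h + h))
          (v := v) (δ := δ) (by linarith [Real.cos_le_one (k * h + h)])
          (by linarith [Real.sin_le_one (k * h + h)]) hδ0 hδ1 (by rw [h3]; exact hv)
        rw [hang] at hstep
        rw [e]
        refine ⟨_, hstep, ?_⟩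
        have e1 : 1 - (δ + Real.cos (k * h + h) * v) / (Real.cos (k * h + h) + δ) =
            Real.cos (k * h + h) * ((1 - v) / (Real.cos (k * h + h) + δ)) := by
          have hden : Real.cos (k * h + h) + δ ≠ 0 := by linarith
          rw [eq_comm, ← mul_div_assoc, eq_sub_iff_add_eq, ← add_div, div_eq_one_iff_eq hden]
          ring
        have e2 : Real.cos (k * h + h) * Real.exp (-(k * h + h)) / 2 * (1 + K * h ^ 2) ^ (k + 1) =
            Real.cos (k * h + h) *
              (Real.exp (-(k * h + h)) / 2 * (1 + K * h ^ 2) ^ (k + 1)) := by ring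
        rw [e1, e2]
        refine mul_le_mul_of_nonneg_left ?_ hcpos.le
        rw [div_le_iff₀ (by linarith)]
        have e3 : Real.exp (-(k * h)) = Real.exp (-(k * h + h)) * Real.exp h := by
          rw [← Real.exp_add]; congr 1; ring
        calc 1 - v ≤ Real.exp (-(k * h + h)) / 2 * (1 + K * h ^ 2) ^ k *
              (Real.cos (k * h) * Real.exp h) := by
              refine hv'.trans (le_of_eq ?_)
              rw [e3]; ring
          _ ≤ Real.exp (-(k * h + h)) / 2 * (1 + K * h ^ 2) ^ k *
              ((Real.cos (k * h + h) + δ) * (1 + K * h ^ 2)) := by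
              refine mul_le_mul_of_nonneg_left h4 (by positivity)
          _ = _ := by ring
    obtain ⟨v, hv, hv'⟩ := hind n le_rfl
    rw [hnh, hξ] at hv
    rw [hnh] at hv'
    refine ⟨v, hv, hv'.trans ?_⟩
    have h5 : (1 + K * h ^ 2) ^ n ≤ Real.exp (K * η₀ ^ 2 / n) := by
      have h6 : 1 + K * h ^ 2 ≤ Real.exp (K * h ^ 2) := by
        linarith [Real.add_one_le_exp (K * h ^ 2)]
      refine (pow_le_pow_left₀ (by positivity) h6 n).trans (le_of_eq ?_)
      rw [← Real.exp_nat_mul, hh]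
      congr 1
      field_simp
    exact mul_le_mul_of_nonneg_left h5 (defect_nonneg h0.le h1.le)
  have hlim : Tendsto (fun n : ℕ => defect ξ * Real.exp (K * η₀ ^ 2 / n)) atTop
      (nhds (defect ξ)) := by
    have h2 := (Real.continuous_exp.tendsto _).comp
      (tendsto_const_div_atTop_nhds_zero_nat (K * η₀ ^ 2))
    simpa using h2.const_mul (defect ξ)
  have hev := hlim.eventually (gt_mem_nhds (show defect ξ < defect ξ + κ by linarith))
  obtain ⟨n, h2, h3, h4⟩ := (hev.and ((eventually_ge_atTop ⌈16 * η₀⌉₊).and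
    (eventually_gt_atTop 0))).exists
  obtain ⟨v, hv, hv'⟩ := hmain n ((Nat.le_ceil _).trans (by exact_mod_cast h3)) h4
  exact ⟨v, hv, by linarith⟩

theorem exists_attainable (x : ℝ) {t : ℝ} (ht : 0 ≤ t) {κ : ℝ} (hκ : 0 < κ) :
    ∃ v, Attainable x t v ∧ value x t - κ < v := by
  rcases ht.eq_or_lt with rfl | ht
  · exact ⟨chi x, .leaf x, by rw [value_zero]; linarith⟩
  rw [value_of_pos x ht]
  have hr : 0 < √t := Real.sqrt_pos.2 ht
  have e : x / √t * √t = x := by field_simp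
  suffices ∃ v, AttainableRatio (x / √t) v ∧ profile (x / √t) - κ < v by
    obtain ⟨v, hv, hv'⟩ := this
    have := hv t ht
    rw [e] at this
    exact ⟨v, this, hv'⟩
  generalize x / √t = ξ
  rcases lt_trichotomy ξ (-1) with h | rfl | h
  · rw [profile_of_le h.le]
    exact exists_attainable_of_lt_neg_one h hκ
  · refine ⟨1 / 2, attainableRatio_neg_one, ?_⟩
    rw [profile_of_le le_rfl]
    simp [hκ]
  rcases lt_or_ge ξ 1 with h1 | h1
  · rw [profile_of_mem h.le h1.le]
    exact exists_attainable_of_mem_Ioo h h1 hκ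
  · refine ⟨1, fun t ht => attainable_one ht.le ?_, by rw [profile_of_ge h1]; linarith⟩
    exact le_mul_of_one_le_left (Real.sqrt_nonneg t) h1

/-! ### Subsets of prescribed probability -/

section Realize

variable {Ω : Type*} {m : MeasurableSpace Ω} {P : Measure Ω}

theorem Atomless.exists_small [IsProbabilityMeasure P] (hP : Atomless P) {A : Set Ω}
    (hA : MeasurableSet A)
    (hpos : 0 < P.real A) (n : ℕ) :
    ∃ T ⊆ A, MeasurableSet T ∧ 0 < P.real T ∧ P.real T ≤ P.real A / 2 ^ n := by
  induction n with
  | zero => exact ⟨A, subset_rfl, hA, hpos, by simp⟩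
  | succ n ih =>
    obtain ⟨T, hTA, hT, hT0, hTn⟩ := ih
    obtain ⟨s, hsT, hs, hs0, hs1⟩ := hP T hT (ENNReal.toReal_pos_iff.1 hT0).1
    have hs0' : 0 < P.real s := ENNReal.toReal_pos hs0.ne' (measure_ne_top _ _)
    have hs1' : P.real s < P.real T := (ENNReal.toReal_lt_toReal (by finiteness) (by finiteness)).2 hs1
    have hdiff : P.real (T \ s) = P.real T - P.real s := measureReal_sdiff hsT hs
    have e : P.real A / 2 ^ (n + 1) = P.real A / 2 ^ n / 2 := by rw [pow_succ]; field_simp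
    rcases le_total (P.real s) (P.real T / 2) with h | h
    · exact ⟨s, hsT.trans hTA, hs, hs0', by rw [e]; linarith⟩
    · exact ⟨T \ s, Set.sdiff_subset.trans hTA, hT.diff hs, by linarith, by rw [e]; linarith⟩

/-- Sierpiński's theorem: an atomless measure takes all intermediate values. -/
theorem Atomless.exists_measureReal_eq [IsProbabilityMeasure P] (hP : Atomless P) {A : Set Ω}
    (hA : MeasurableSet A)
    {c : ℝ} (hc0 : 0 ≤ c) (hc : c ≤ P.real A) : ∃ T ⊆ A, MeasurableSet T ∧ P.real T = c := by
  set Q : Set Ω → Prop := fun T => T ⊆ A ∧ MeasurableSet T ∧ P.real T ≤ c with hQ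
  -- a greedy step realizes at least half of the possible gain
  have step : ∀ T, Q T → ∃ T', Q T' ∧ T ⊆ T' ∧
      ∀ T'', Q T'' → T ⊆ T'' → P.real T'' - P.real T ≤ 2 * (P.real T' - P.real T) := by
    intro T hT
    set R : Set ℝ := {r | ∃ T'', Q T'' ∧ T ⊆ T'' ∧ P.real T'' = r} with hR
    have hbdd : BddAbove R := ⟨c, by rintro _ ⟨T'', h, -, rfl⟩; exact h.2.2⟩
    have hmem : P.real T ∈ R := ⟨T, hT, subset_rfl, rfl⟩
    rcases (le_csSup hbdd hmem).eq_or_lt with h | h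
    · refine ⟨T, hT, subset_rfl, fun T'' h1 h2 => ?_⟩
      have := le_csSup hbdd ⟨T'', h1, h2, rfl⟩
      linarith
    · obtain ⟨_, ⟨T', h1, h2, rfl⟩, h3⟩ := exists_lt_of_lt_csSup ⟨_, hmem⟩
        (show (sSup R + P.real T) / 2 < sSup R by linarith)
      refine ⟨T', h1, h2, fun T'' h4 h5 => ?_⟩
      have := le_csSup hbdd ⟨T'', h4, h5, rfl⟩
      linarith
  choose! next hnext using step
  set T : ℕ → Set Ω := fun n => next^[n] ∅ with hTdef
  have hTs : ∀ n, T (n + 1) = next (T n) := fun n => Function.iterate_succ_apply' _ _ _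
  have hTQ : ∀ n, Q (T n) := by
    intro n
    induction n with
    | zero => exact ⟨Set.empty_subset _, MeasurableSet.empty, by simpa [hTdef] using hc0⟩
    | succ n ih => rw [hTs]; exact (hnext _ ih).1
  have hmono : Monotone T := monotone_nat_of_le_succ fun n => by
    rw [hTs]; exact (hnext _ (hTQ n)).2.1
  have hlim : Tendsto (fun n => P.real (T n)) atTop (nhds (P.real (⋃ n, T n))) :=
    (ENNReal.tendsto_toReal (by finiteness)).comp (tendsto_measure_iUnion_atTop hmono)
  have hU : Q (⋃ n, T n) := ⟨Set.iUnion_subset fun n => (hTQ n).1,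
    MeasurableSet.iUnion fun n => (hTQ n).2.1, le_of_tendsto' hlim fun n => (hTQ n).2.2⟩
  refine ⟨_, hU.1, hU.2.1, ?_⟩
  by_contra hne
  have hlt : P.real (⋃ n, T n) < c := lt_of_le_of_ne hU.2.2 hne
  have hrest : P.real (A \ ⋃ n, T n) = P.real A - P.real (⋃ n, T n) :=
    measureReal_sdiff hU.1 hU.2.1
  obtain ⟨k, hk⟩ := exists_pow_lt_of_lt_one (show 0 < c - P.real (⋃ n, T n) by linarith)
    (show (1 / 2 : ℝ) < 1 by norm_num)
  obtain ⟨E, hE, hEm, hE0, hE1⟩ := hP.exists_small (hA.diff hU.2.1)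
    (by rw [hrest]; linarith) k
  have hEle : P.real E ≤ c - P.real (⋃ n, T n) := by
    refine hE1.trans (le_trans ?_ hk.le)
    rw [one_div, inv_pow, div_eq_mul_inv]
    exact mul_le_of_le_one_left (by positivity) measureReal_le_one
  have hdisj : Disjoint (⋃ n, T n) E :=
    Set.disjoint_left.2 fun ω h1 h2 => (hE h2).2 h1
  have hadd : P.real ((⋃ n, T n) ∪ E) = P.real (⋃ n, T n) + P.real E :=
    measureReal_union hdisj hEm
  have hQ' : Q ((⋃ n, T n) ∪ E) := ⟨Set.union_subset hU.1 (hE.trans Set.sdiff_subset),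
    hU.2.1.union hEm, by rw [hadd]; linarith⟩
  have hgain : ∀ n, P.real E ≤ 2 * (P.real (T (n + 1)) - P.real (T n)) := by
    intro n
    have h1 := (hnext _ (hTQ n)).2.2 _ hQ'
      ((Set.subset_iUnion T n).trans Set.subset_union_left)
    rw [← hTs, hadd] at h1
    have : P.real (T n) ≤ P.real (⋃ n, T n) := measureReal_mono (Set.subset_iUnion T n)
    linarith
  have hzero : Tendsto (fun n => 2 * (P.real (T (n + 1)) - P.real (T n))) atTop (nhds 0) := by
    simpa using ((hlim.comp (tendsto_add_atTop_nat 1)).sub hlim).const_mul 2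
  exact absurd (ge_of_tendsto' hzero hgain) (not_le.2 hE0)

/-! ### Realizing trees by martingales -/

/-- The process `φ`, observed on the event `A`, realizes a tree of the kind described by
`Attainable x t v`. The martingale property on `A` is stated with respect to the events that depend
on the path of the process up to time `n`. -/
structure Realization (P : Measure Ω) (A : Set Ω) (x t v : ℝ) (N : ℕ) (φ : ℕ → Ω → ℝ) : Prop where
  measurable : ∀ n, Measurable (φ n)
  finite : ∀ n, (Set.range (φ n)).Finite
  start : ∀ ω, φ 0 ω = x
  eq_of_le : ∀ n, N ≤ n → φ (n + 1) = φ n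
  sum : ∀ ω ∈ A, ∑ k ∈ Finset.range N, (φ (k + 1) ω - φ k ω) ^ 2 = t
  prob : P.real (A ∩ {ω | 0 ≤ φ N ω}) = v * P.real A
  orth : ∀ (n : ℕ) (H : Set (ℕ → ℝ)), MeasurableSet H →
    ∫ ω in A ∩ {ω | (fun k => φ (min k n) ω) ∈ H}, (φ (n + 1) ω - φ n ω) ∂P = 0

theorem Realization.succ {A : Set Ω} {x t v : ℝ} {N : ℕ} {φ : ℕ → Ω → ℝ}
    (h : Realization P A x t v N φ) : Realization P A x t v (N + 1) φ :=
  { h with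
    eq_of_le := fun n hn => h.eq_of_le n (Nat.le_of_succ_le hn)
    sum := fun ω hω => by rw [Finset.sum_range_succ, h.sum ω hω, h.eq_of_le N le_rfl]; simp
    prob := by rw [h.eq_of_le N le_rfl]; exact h.prob }

theorem Realization.mono {A : Set Ω} {x t v : ℝ} {N N' : ℕ} {φ : ℕ → Ω → ℝ}
    (h : Realization P A x t v N φ) (hN : N ≤ N') : Realization P A x t v N' φ := by
  induction N', hN using Nat.le_induction with
  | base => exact h
  | succ n hn ih => exact ih.succ

open Classical in
/-- The process that starts at `x` and continues as `φ₁` on `A₁` and as `φ₂` elsewhere. -/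
noncomputable def gluedProcess (A₁ : Set Ω) (x : ℝ) (φ₁ φ₂ : ℕ → Ω → ℝ) : ℕ → Ω → ℝ
  | 0, _ => x
  | n + 1, ω => if ω ∈ A₁ then φ₁ n ω else φ₂ n ω

theorem gluedProcess_succ_of_mem {A₁ : Set Ω} {x : ℝ} {φ₁ φ₂ : ℕ → Ω → ℝ} {n : ℕ} {ω : Ω}
    (h : ω ∈ A₁) :
    gluedProcess A₁ x φ₁ φ₂ (n + 1) ω = φ₁ n ω := if_pos h

theorem gluedProcess_succ_of_notMem {A₁ : Set Ω} {x : ℝ} {φ₁ φ₂ : ℕ → Ω → ℝ} {n : ℕ} {ω : Ω}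
    (h : ω ∉ A₁) : gluedProcess A₁ x φ₁ φ₂ (n + 1) ω = φ₂ n ω := if_neg h

/-- A path with the value `x` put in front. -/
def consPath (x : ℝ) (p : ℕ → ℝ) : ℕ → ℝ
  | 0 => x
  | k + 1 => p k

theorem measurable_consPath (x : ℝ) : Measurable (consPath x) := by
  refine measurable_pi_lambda _ fun k => ?_
  cases k with
  | zero => exact measurable_const
  | succ k => exact measurable_pi_apply k

theorem gluedProcess_path_eq {A₁ : Set Ω} {x : ℝ} {φ₁ φ₂ ψ : ℕ → Ω → ℝ} {ω : Ω}
    (h : ∀ n, gluedProcess A₁ x φ₁ φ₂ (n + 1) ω = ψ n ω) (n : ℕ) :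
    (fun k => gluedProcess A₁ x φ₁ φ₂ (min k (n + 1)) ω) = consPath x fun k => ψ (min k n) ω := by
  funext k
  cases k with
  | zero => simp [gluedProcess, consPath]
  | succ k => rw [Nat.add_min_add_right, h]; rfl

theorem gluedProcess_set_eq {A₁ B : Set Ω} {x : ℝ} {φ₁ φ₂ ψ : ℕ → Ω → ℝ}
    (h : ∀ n, ∀ ω ∈ B, gluedProcess A₁ x φ₁ φ₂ (n + 1) ω = ψ n ω) (n : ℕ) (H : Set (ℕ → ℝ)) :
    B ∩ {ω | (fun k => gluedProcess A₁ x φ₁ φ₂ (min k (n + 1)) ω) ∈ H} =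
      B ∩ {ω | (fun k => ψ (min k n) ω) ∈ consPath x ⁻¹' H} := by
  ext ω
  refine and_congr_right fun hω => ?_
  simp only [Set.mem_ofPred_eq, Set.mem_preimage, gluedProcess_path_eq (fun n => h n ω hω)]

variable [IsProbabilityMeasure P]

/-- A realization of a tree on `A` from realizations of its two branches on `A₁` and `A \ A₁`. -/
theorem Realization.glue {A A₁ : Set Ω} (hA : MeasurableSet A) (hA₁ : MeasurableSet A₁)
    (hsub : A₁ ⊆ A) {x t d₁ d₂ v₁ v₂ : ℝ} (h₁ : 0 < d₁) (h₂ : 0 < d₂)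
    (hmass : P.real A₁ = d₂ / (d₁ + d₂) * P.real A) {N : ℕ} {φ₁ φ₂ : ℕ → Ω → ℝ}
    (r₁ : Realization P A₁ (x + d₁) (t - d₁ ^ 2) v₁ N φ₁)
    (r₂ : Realization P (A \ A₁) (x - d₂) (t - d₂ ^ 2) v₂ N φ₂) :
    Realization P A x t ((d₂ * v₁ + d₁ * v₂) / (d₁ + d₂)) (N + 1) (gluedProcess A₁ x φ₁ φ₂) := by
  have e₁ : ∀ n, ∀ ω ∈ A₁, gluedProcess A₁ x φ₁ φ₂ (n + 1) ω = φ₁ n ω :=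
    fun n ω hω => gluedProcess_succ_of_mem hω
  have e₂ : ∀ n, ∀ ω ∈ A \ A₁, gluedProcess A₁ x φ₁ φ₂ (n + 1) ω = φ₂ n ω :=
    fun n ω hω => gluedProcess_succ_of_notMem hω.2
  have hmass₂ : P.real (A \ A₁) = d₁ / (d₁ + d₂) * P.real A := by
    rw [measureReal_sdiff hsub hA₁, hmass]; field_simp; ring
  have hunion : A = A₁ ∪ A \ A₁ := (Set.union_sdiff_cancel hsub).symm
  have hdisj : Disjoint A₁ (A \ A₁) := Set.disjoint_sdiff_right
  have hmeas : ∀ n, Measurable (gluedProcess A₁ x φ₁ φ₂ n) := by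
    intro n
    cases n with
    | zero => exact measurable_const
    | succ n => exact Measurable.ite hA₁ (r₁.measurable n) (r₂.measurable n)
  have hfin : ∀ n, (Set.range (gluedProcess A₁ x φ₁ φ₂ n)).Finite := by
    intro n
    cases n with
    | zero => exact (Set.finite_singleton x).subset (by rintro _ ⟨ω, rfl⟩; rfl)
    | succ n =>
      refine ((r₁.finite n).union (r₂.finite n)).subset ?_
      rintro _ ⟨ω, rfl⟩
      by_cases h : ω ∈ A₁
      · rw [gluedProcess_succ_of_mem h]; exact Or.inl ⟨ω, rfl⟩
      · rw [gluedProcess_succ_of_notMem h]; exact Or.inr ⟨ω, rfl⟩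
  refine ⟨hmeas, hfin, fun _ => rfl, ?_, ?_, ?_, ?_⟩
  · intro n hn
    obtain ⟨k, rfl⟩ : ∃ k, n = k + 1 := ⟨n - 1, by omega⟩
    funext ω
    by_cases h : ω ∈ A₁
    · rw [gluedProcess_succ_of_mem h, gluedProcess_succ_of_mem h, r₁.eq_of_le k (by omega)]
    · rw [gluedProcess_succ_of_notMem h, gluedProcess_succ_of_notMem h, r₂.eq_of_le k (by omega)]
  · intro ω hω
    rw [Finset.sum_range_succ']
    by_cases h : ω ∈ A₁
    · simp only [e₁ _ ω h]
      rw [r₁.sum ω h, r₁.start]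
      simp [gluedProcess]
    · simp only [e₂ _ ω ⟨hω, h⟩]
      rw [r₂.sum ω ⟨hω, h⟩, r₂.start]
      simp [gluedProcess]
  · have hset : A ∩ {ω | 0 ≤ gluedProcess A₁ x φ₁ φ₂ (N + 1) ω} =
        (A₁ ∩ {ω | 0 ≤ φ₁ N ω}) ∪ ((A \ A₁) ∩ {ω | 0 ≤ φ₂ N ω}) := by
      ext ω
      by_cases h : ω ∈ A₁
      · simp [h, hsub h, gluedProcess_succ_of_mem h]
      · simp [h, gluedProcess_succ_of_notMem h]
    rw [hset, measureReal_union (hdisj.mono Set.inter_subset_left Set.inter_subset_left)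
      ((hA.diff hA₁).inter (measurableSet_le measurable_const (r₂.measurable N))),
      r₁.prob, r₂.prob, hmass, hmass₂]
    field_simp
  · intro n H hH
    have hint : ∀ s : Set Ω, IntegrableOn (fun ω => gluedProcess A₁ x φ₁ φ₂ (n + 1) ω -
        gluedProcess A₁ x φ₁ φ₂ n ω) s P := fun s =>
      ((integrable_of_finite_range (hmeas _) (hfin _)).sub
        (integrable_of_finite_range (hmeas _) (hfin _))).integrableOn
    have hpath : MeasurableSet {ω | (fun k => gluedProcess A₁ x φ₁ φ₂ (min k n) ω) ∈ H} :=
      (measurable_pi_lambda _ fun k => hmeas (min k n)) hH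
    have hsplit : A ∩ {ω | (fun k => gluedProcess A₁ x φ₁ φ₂ (min k n) ω) ∈ H} =
        (A₁ ∩ {ω | (fun k => gluedProcess A₁ x φ₁ φ₂ (min k n) ω) ∈ H}) ∪
        ((A \ A₁) ∩ {ω | (fun k => gluedProcess A₁ x φ₁ φ₂ (min k n) ω) ∈ H}) := by
      rw [← Set.union_inter_distrib_right, ← hunion]
    rw [hsplit, setIntegral_union (hdisj.mono Set.inter_subset_left Set.inter_subset_left)
      ((hA.diff hA₁).inter hpath) (hint _) (hint _)]
    cases n with
    | zero =>
      by_cases hx : (fun _ => x) ∈ H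
      · have huniv : {ω : Ω | (fun k => gluedProcess A₁ x φ₁ φ₂ (min k 0) ω) ∈ H} =
            Set.univ := by
          ext ω; simp [gluedProcess, hx]
        rw [huniv, Set.inter_univ, Set.inter_univ]
        rw [setIntegral_congr_fun (g := fun _ => d₁) hA₁ fun ω hω => by
            change gluedProcess A₁ x φ₁ φ₂ (0 + 1) ω - x = d₁
            rw [e₁ 0 ω hω, r₁.start]
            ring,
          setIntegral_congr_fun (g := fun _ => -d₂) (hA.diff hA₁) fun ω hω => by
            change gluedProcess A₁ x φ₁ φ₂ (0 + 1) ω - x = -d₂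
            rw [e₂ 0 ω hω, r₂.start]
            ring,
          setIntegral_const, setIntegral_const, hmass, hmass₂]
        simp only [smul_eq_mul]
        field_simp
        ring
      · have hempty : {ω : Ω | (fun k => gluedProcess A₁ x φ₁ φ₂ (min k 0) ω) ∈ H} = ∅ := by
          ext ω; simp [gluedProcess, hx]
        rw [hempty]
        simp
    | succ n =>
      rw [gluedProcess_set_eq e₁, gluedProcess_set_eq e₂]
      have hH' := measurable_consPath x hH
      have hm₁ : MeasurableSet (A₁ ∩ {ω | (fun k => φ₁ (min k n) ω) ∈ consPath x ⁻¹' H}) :=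
        hA₁.inter ((measurable_pi_lambda _ fun k => r₁.measurable (min k n)) hH')
      have hm₂ : MeasurableSet ((A \ A₁) ∩ {ω | (fun k => φ₂ (min k n) ω) ∈ consPath x ⁻¹' H}) :=
        (hA.diff hA₁).inter ((measurable_pi_lambda _ fun k => r₂.measurable (min k n)) hH')
      rw [setIntegral_congr_fun hm₁ fun ω hω => by simp only [e₁ _ ω hω.1]; rfl,
        setIntegral_congr_fun hm₂ fun ω hω => by simp only [e₂ _ ω hω.1]; rfl,
        r₁.orth n _ hH', r₂.orth n _ hH', add_zero]

theorem Attainable.exists_realization (hP : Atomless P) {x t v : ℝ} (h : Attainable x t v) :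
    ∀ A : Set Ω, MeasurableSet A → ∃ N φ, Realization P A x t v N φ := by
  induction h with
  | leaf x =>
    intro A hA
    refine ⟨0, fun _ _ => x, fun _ => measurable_const, fun _ => Set.finite_range_const, fun _ => rfl,
      fun _ _ => rfl, fun _ _ => by simp, ?_, fun n H _ => by simp⟩
    by_cases hx : 0 ≤ x
    · simp [hx, chi_of_nonneg hx]
    · simp [hx, chi_of_neg (not_le.1 hx)]
  | @branch x t d₁ d₂ v₁ v₂ h₁ h₂ _ _ ih₁ ih₂ =>
    intro A hA
    obtain ⟨A₁, hsub, hA₁, hmass⟩ := hP.exists_measureReal_eq hA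
      (c := d₂ / (d₁ + d₂) * P.real A) (by positivity)
      (mul_le_of_le_one_left measureReal_nonneg (by rw [div_le_one (by positivity)]; linarith))
    obtain ⟨N₁, φ₁, r₁⟩ := ih₁ A₁ hA₁
    obtain ⟨N₂, φ₂, r₂⟩ := ih₂ (A \ A₁) (hA.diff hA₁)
    exact ⟨_, _, Realization.glue hA hA₁ hsub h₁ h₂ hmass (r₁.mono (le_max_left N₁ N₂))
      (r₂.mono (le_max_right N₁ N₂))⟩

/-- The filtration generated by the path of a process. -/
def pathFiltration (φ : ℕ → Ω → ℝ) (hφ : ∀ n, Measurable (φ n)) : Filtration ℕ m where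
  seq n := MeasurableSpace.comap (fun ω k => φ (min k n) ω) MeasurableSpace.pi
  mono' i j hij := by
    have hm : Measurable fun (p : ℕ → ℝ) (k : ℕ) => p (min k i) :=
      measurable_pi_lambda _ fun k => measurable_pi_apply _
    rintro _ ⟨H, hH, rfl⟩
    refine ⟨_, hm hH, ?_⟩
    ext ω
    simp only [Set.mem_preimage]
    have : (fun k => φ (min (min k i) j) ω) = fun k => φ (min k i) ω := by
      funext k
      rw [min_eq_left ((min_le_right k i).trans hij)]
    rw [this]
  le' n := (measurable_pi_lambda _ fun k => hφ (min k n)).comap_le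

theorem isFiniteFiltration_pathFiltration {φ : ℕ → Ω → ℝ} (hφ : ∀ n, Measurable (φ n))
    (hfin : ∀ n, (Set.range (φ n)).Finite) {x : ℝ} (hx : ∀ ω, φ 0 ω = x) :
    IsFiniteFiltration (pathFiltration φ hφ) := by
  constructor
  · have : (fun (ω : Ω) (k : ℕ) => φ (min k 0) ω) = fun _ _ => x := by
      funext ω k; rw [Nat.min_zero, hx]
    change MeasurableSpace.comap (fun (ω : Ω) (k : ℕ) => φ (min k 0) ω) _ = ⊥
    rw [this, MeasurableSpace.comap_const]
  · intro n
    have hrange : (Set.range fun (ω : Ω) (k : ℕ) => φ (min k n) ω).Finite := by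
      have h1 : {p : Fin (n + 1) → ℝ | ∀ i : Fin (n + 1), p i ∈ Set.range (φ i)}.Finite :=
        Set.Finite.pi' fun i => hfin i
      refine (h1.image fun p k => p ⟨min k n, by omega⟩).subset ?_
      rintro _ ⟨ω, rfl⟩
      exact ⟨fun i => φ i ω, fun i => ⟨ω, rfl⟩, rfl⟩
    refine (hrange.powerset.image fun T => (fun (ω : Ω) (k : ℕ) => φ (min k n) ω) ⁻¹' T).subset ?_
    rintro _ ⟨H, -, rfl⟩
    exact ⟨H ∩ Set.range _, Set.inter_subset_right, by simp⟩

theorem Realization.martingale {x t v : ℝ} {N : ℕ} {φ : ℕ → Ω → ℝ}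
    (r : Realization P Set.univ x t v N φ) : Martingale φ (pathFiltration φ r.measurable) P := by
  have hint : ∀ n, Integrable (φ n) P := fun n =>
    integrable_of_finite_range (r.measurable n) (r.finite n)
  refine martingale_of_setIntegral_eq_succ (fun n => ?_) hint fun n s hs => ?_
  · refine Measurable.stronglyMeasurable ?_
    have h1 : Measurable[pathFiltration φ r.measurable n]
        fun (ω : Ω) (k : ℕ) => φ (min k n) ω := comap_measurable _
    have := (measurable_pi_apply n).comp h1
    simpa [Function.comp_def] using this
  · obtain ⟨H, hH, rfl⟩ := hs
    have := r.orth n H hH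
    rw [Set.univ_inter, integral_sub (hint _).integrableOn (hint _).integrableOn] at this
    exact (sub_eq_zero.1 this).symm

theorem Attainable.le_B (hP : Atomless P) {x y v : ℝ} (h : Attainable x (y - x ^ 2) v)
    (hyx : y ≤ x ^ 2 + 1) : (v : EReal) ≤ B P chi x y (√(1 - y + x ^ 2)) := by
  obtain ⟨N, φ, r⟩ := h.exists_realization hP Set.univ MeasurableSet.univ
  have hF := isFiniteFiltration_pathFiltration r.measurable r.finite r.start
  have hφ := r.martingale
  have hz : √(1 - y + x ^ 2) ^ 2 = 1 - y + x ^ 2 := Real.sq_sqrt (by linarith)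
  have hmean : ∫ ω, φ N ω ∂P = x := by
    obtain ⟨ω⟩ : Nonempty Ω := nonempty_of_isProbabilityMeasure P
    rw [← martingale_zero_eq hF hφ N ω, r.start]
  refine le_sSup ⟨pathFiltration φ r.measurable, φ, hF, hφ, ⟨N, r.eq_of_le⟩, ?_, ?_, ?_⟩
  · rw [terminal_eq r.eq_of_le, hmean]
  · have h1 := integral_sum_increments_sq hF hφ N
    rw [integral_congr_ae (Eventually.of_forall fun ω => r.sum ω (Set.mem_univ ω)), hmean] at h1
    rw [terminal_eq r.eq_of_le]
    simp at h1
    linarith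
  · rw [expectation_chi (r.measurable N) (Eventually.of_forall fun ω => ?_)]
    · have := r.prob
      rw [Set.univ_inter] at this
      rw [this]
      simp
    · rw [terminal_eq r.eq_of_le, squareFunction_sq r.eq_of_le, r.sum ω (Set.mem_univ ω), hz]
      refine if_pos ⟨?_, ?_⟩ <;> linarith

theorem B_eq_value (hP : Atomless P) {x y : ℝ} (hxy : x ^ 2 ≤ y) (hyx : y ≤ x ^ 2 + 1) :
    B P chi x y (√(1 - y + x ^ 2)) = (value x (y - x ^ 2) : EReal) := by
  refine le_antisymm (B_le_value P hyx) ?_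
  by_contra hlt
  obtain ⟨r, hr, hr'⟩ := EReal.lt_iff_exists_real_btwn.1 (not_le.1 hlt)
  rw [EReal.coe_lt_coe_iff] at hr'
  obtain ⟨v, hv, hv'⟩ := exists_attainable x (sub_nonneg.2 hxy) (sub_pos.2 hr')
  have h1 := (hv.le_B hP hyx).trans_lt hr
  rw [EReal.coe_lt_coe_iff] at h1
  linarith

end Realize

/-! ### Functions of bounded mean oscillation -/

section BMO

variable {ψ : ℝ → ℝ}

theorem MemLp.intervalIntegrable_unit (hψ : MemLp ψ 2 (volume.restrict (Set.Icc (0 : ℝ) 1)))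
    {u v : ℝ} (hu : 0 ≤ u) (huv : u ≤ v) (hv : v ≤ 1) : IntervalIntegrable ψ volume u v := by
  rw [intervalIntegrable_iff_integrableOn_Icc_of_le huv]
  exact IntegrableOn.mono_set (hψ.integrable (by norm_num)) (Set.Icc_subset_Icc hu hv)

theorem MemLp.intervalIntegrable_sub_sq_unit
    (hψ : MemLp ψ 2 (volume.restrict (Set.Icc (0 : ℝ) 1))) (k : ℝ)
    {u v : ℝ} (hu : 0 ≤ u) (huv : u ≤ v) (hv : v ≤ 1) :
    IntervalIntegrable (fun s => (ψ s - k) ^ 2) volume u v := by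
  rw [intervalIntegrable_iff_integrableOn_Icc_of_le huv]
  exact IntegrableOn.mono_set (hψ.sub (memLp_const k)).integrable_sq (Set.Icc_subset_Icc hu hv)

theorem integral_sub_sq (hψ : MemLp ψ 2 (volume.restrict (Set.Icc (0 : ℝ) 1))) (k : ℝ)
    {u v : ℝ} (hu : 0 ≤ u) (huv : u ≤ v) (hv : v ≤ 1) :
    ∫ s in u..v, (ψ s - k) ^ 2 = (∫ s in u..v, ψ s ^ 2) - 2 * k * (∫ s in u..v, ψ s) +
      k ^ 2 * (v - u) := by
  have h1 := MemLp.intervalIntegrable_unit hψ hu huv hv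
  have h2 : IntervalIntegrable (fun s => ψ s ^ 2) volume u v := by
    simpa using MemLp.intervalIntegrable_sub_sq_unit hψ 0 hu huv hv
  have e : (fun s => (ψ s - k) ^ 2) = fun s => ψ s ^ 2 - 2 * k * ψ s + k ^ 2 := by
    funext s; ring
  rw [e, intervalIntegral.integral_add (h2.sub (h1.const_mul _)) intervalIntegrable_const,
    intervalIntegral.integral_sub h2 (h1.const_mul _), intervalIntegral.integral_const_mul,
    intervalIntegral.integral_const, smul_eq_mul]
  ring

theorem integral_sub_mean_sq (hψ : MemLp ψ 2 (volume.restrict (Set.Icc (0 : ℝ) 1))) (k : ℝ)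
    {u v : ℝ} (hu : 0 ≤ u) (huv : u < v) (hv : v ≤ 1) :
    ∫ s in u..v, (ψ s - k) ^ 2 =
      (∫ s in u..v, (ψ s - mean ψ u v) ^ 2) + (mean ψ u v - k) ^ 2 * (v - u) := by
  have h0 : v - u ≠ 0 := (sub_pos.2 huv).ne'
  have : ∫ s in u..v, ψ s = mean ψ u v * (v - u) := by rw [mean]; field_simp
  rw [integral_sub_sq hψ k hu huv.le hv, integral_sub_sq hψ _ hu huv.le hv, this]
  ring

theorem bmoNormSq_le (hψ : MemLp ψ 2 (volume.restrict (Set.Icc (0 : ℝ) 1))) {C : ℝ}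
    (h : ∀ u v, 0 ≤ u → u < v → v ≤ 1 → ∃ k, ∫ s in u..v, (ψ s - k) ^ 2 ≤ C * (v - u)) :
    bmoNormSq ψ ≤ ENNReal.ofReal C := by
  refine iSup_le fun u => iSup_le fun v => iSup_le fun hu => iSup_le fun huv => iSup_le fun hv => ?_
  obtain ⟨k, hk⟩ := h u v hu huv hv
  refine ENNReal.ofReal_le_ofReal ?_
  have h0 : 0 < v - u := sub_pos.2 huv
  rw [integral_sub_mean_sq hψ k hu huv hv] at hk
  rw [SquareBellman.mean, inv_mul_le_iff₀ h0]
  nlinarith [mul_nonneg (sq_nonneg (mean ψ u v - k)) h0.le]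

theorem integral_sub_mean_sq_le {C : ℝ} (hC : 0 ≤ C) (h : bmoNormSq ψ ≤ ENNReal.ofReal C)
    {u v : ℝ} (hu : 0 ≤ u) (huv : u < v) (hv : v ≤ 1) :
    ∫ s in u..v, (ψ s - mean ψ u v) ^ 2 ≤ C * (v - u) := by
  have h1 : ENNReal.ofReal (mean (fun s => (ψ s - mean ψ u v) ^ 2) u v) ≤ ENNReal.ofReal C := by
    refine le_trans ?_ h
    exact le_iSup_of_le u <| le_iSup_of_le v <| le_iSup_of_le hu <| le_iSup_of_le huv <|
      le_iSup_of_le hv le_rfl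
  rw [ENNReal.ofReal_le_ofReal_iff hC, SquareBellman.mean, inv_mul_le_iff₀ (sub_pos.2 huv)] at h1
  linarith

theorem lintegral_chi (hψ : AEMeasurable ψ (volume.restrict (Set.Icc (0 : ℝ) 1))) :
    ∫⁻ s in Set.Icc (0 : ℝ) 1, ENNReal.ofReal (chi (ψ s)) =
      (volume.restrict (Set.Icc (0 : ℝ) 1)) {s | 0 ≤ ψ s} := by
  have hm : NullMeasurableSet {s | 0 ≤ ψ s} (volume.restrict (Set.Icc (0 : ℝ) 1)) :=
    nullMeasurableSet_le aemeasurable_const hψ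
  rw [← lintegral_indicator_one₀ hm]
  refine lintegral_congr fun s => ?_
  by_cases h : 0 ≤ ψ s
  · rw [chi_of_nonneg h, Set.indicator_of_mem (by exact h)]; simp
  · rw [chi_of_neg (not_le.1 h), Set.indicator_of_notMem (by exact h)]; simp

/-- A test function for the lower bounds: bounded, with prescribed moments, and with the mean
oscillation controlled by comparison with suitable constants. -/
theorem le_b_of_test (hψ : Measurable ψ) {K : ℝ} (hK : ∀ s ∈ Set.Icc (0 : ℝ) 1, |ψ s| ≤ K)
    {ε x y p : ℝ} (hx : ∫ s in (0 : ℝ)..1, ψ s = x) (hy : ∫ s in (0 : ℝ)..1, (ψ s) ^ 2 = y)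
    (h : ∀ u v, 0 ≤ u → u < v → v ≤ 1 → ∃ k, ∫ s in u..v, (ψ s - k) ^ 2 ≤ ε ^ 2 * (v - u))
    (hp : Set.Ioc 0 p ⊆ {s | 0 ≤ ψ s}) (hp0 : 0 ≤ p) (hp1 : p ≤ 1) : (p : EReal) ≤ b chi ε x y := by
  have hmem : MemLp ψ 2 (volume.restrict (Set.Icc (0 : ℝ) 1)) := by
    refine MemLp.of_bound hψ.aestronglyMeasurable K ?_
    filter_upwards [ae_restrict_mem measurableSet_Icc] with s hs using hK s hs
  refine le_trans ?_ (le_sSup ⟨ψ, hmem, hx, hy, bmoNormSq_le hmem h, rfl⟩)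
  rw [lintegral_chi hψ.aemeasurable]
  have h1 : ENNReal.ofReal p ≤ (volume.restrict (Set.Icc (0 : ℝ) 1)) {s | 0 ≤ ψ s} := by
    rw [Measure.restrict_apply (measurableSet_le measurable_const hψ)]
    calc ENNReal.ofReal p = volume (Set.Ioc 0 p) := by rw [Real.volume_Ioc, sub_zero]
      _ ≤ volume ({s | 0 ≤ ψ s} ∩ Set.Icc 0 1) :=
        measure_mono fun s hs => ⟨hp hs, hs.1.le, hs.2.trans hp1⟩
  have h2 : (p : EReal) = ((ENNReal.ofReal p : ℝ≥0∞) : EReal) := by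
    rw [EReal.coe_ennreal_ofReal, max_eq_left hp0]
  rw [h2]
  exact_mod_cast h1

theorem b_le_one {ε x y : ℝ} : b chi ε x y ≤ 1 := by
  refine sSup_le ?_
  rintro _ ⟨ψ, hψ, -, -, -, rfl⟩
  rw [lintegral_chi hψ.aestronglyMeasurable.aemeasurable]
  have : (volume.restrict (Set.Icc (0 : ℝ) 1)) {s | 0 ≤ ψ s} ≤ 1 := by
    refine (measure_mono (Set.subset_univ _)).trans ?_
    simp
  exact_mod_cast this

theorem intervalIntegral_eq_of_Ioc {F G : ℝ → ℝ} {u v : ℝ} (huv : u ≤ v)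
    (h : ∀ s, u < s → s ≤ v → F s = G s) : ∫ s in u..v, F s = ∫ s in u..v, G s := by
  rw [intervalIntegral.integral_of_le huv, intervalIntegral.integral_of_le huv]
  exact setIntegral_congr_fun measurableSet_Ioc fun s hs => h s hs.1 hs.2

theorem intervalIntegral_eq_const {F : ℝ → ℝ} {u v c : ℝ} (huv : u ≤ v)
    (h : ∀ s, u < s → s ≤ v → F s = c) : ∫ s in u..v, F s = (v - u) * c := by
  rw [intervalIntegral_eq_of_Ioc huv h, intervalIntegral.integral_const, smul_eq_mul]

/-- The function with the two values `x ± ε` on the halves of `[0, 1]` competes. -/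
theorem one_le_b {x ε : ℝ} (hε : 0 ≤ ε) (h : ε ≤ x) : 1 ≤ b chi ε x (x ^ 2 + ε ^ 2) := by
  set ψ : ℝ → ℝ := fun s => if s ≤ 1 / 2 then x + ε else x - ε with hψ
  have hm : Measurable ψ := Measurable.ite measurableSet_Iic measurable_const measurable_const
  have h1 : ∀ s, s ≤ 1 / 2 → ψ s = x + ε := fun s hs => if_pos hs
  have h2 : ∀ s, 1 / 2 < s → ψ s = x - ε := fun s hs => if_neg (not_le.2 hs)
  have hsq : ∀ s, (ψ s - x) ^ 2 = ε ^ 2 := fun s => by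
    rcases le_or_gt s (1 / 2) with hs | hs
    · rw [h1 s hs]; ring
    · rw [h2 s hs]; ring
  have hb : ∀ s, |ψ s| ≤ x + ε := fun s => by
    rcases le_or_gt s (1 / 2) with hs | hs
    · rw [h1 s hs, abs_of_nonneg (by linarith)]
    · rw [h2 s hs, abs_of_nonneg (by linarith)]; linarith
  have hmem : MemLp ψ 2 (volume.restrict (Set.Icc (0 : ℝ) 1)) :=
    MemLp.of_bound hm.aestronglyMeasurable (x + ε) (Eventually.of_forall hb)
  have hx : ∫ s in (0 : ℝ)..1, ψ s = x := by
    rw [← intervalIntegral.integral_add_adjacent_intervals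
      (MemLp.intervalIntegrable_unit hmem le_rfl (by norm_num : (0 : ℝ) ≤ 1 / 2) (by norm_num))
      (MemLp.intervalIntegrable_unit hmem (by norm_num) (by norm_num) le_rfl),
      intervalIntegral_eq_const (by norm_num) fun s _ hs => h1 s hs,
      intervalIntegral_eq_const (by norm_num) fun s hs _ => h2 s hs]
    ring
  have hy : ∫ s in (0 : ℝ)..1, (ψ s) ^ 2 = x ^ 2 + ε ^ 2 := by
    have := integral_sub_sq hmem x le_rfl zero_le_one le_rfl
    rw [intervalIntegral_eq_const zero_le_one fun s _ _ => hsq s, hx] at this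
    linarith
  have := le_b_of_test (p := 1) hm (fun s _ => hb s) hx hy (fun u v hu huv hv => ⟨x, by
    rw [intervalIntegral_eq_const huv.le fun s _ _ => hsq s, mul_comm]⟩)
    (fun s hs => by
      rcases le_or_gt s (1 / 2) with hs | hs
      · simp only [Set.mem_ofPred_eq, h1 s hs]; linarith
      · simp only [Set.mem_ofPred_eq, h2 s hs]; linarith) zero_le_one le_rfl
  exact_mod_cast this

/-- The variance of a function with the values `2 ε`, `0`, `-2 ε` on sets of measure `r`,
`(3 - ξ²) / 4`, `w`. -/
theorem three_value_variance_le {ξ ε r w : ℝ} (h0 : -1 ≤ ξ) (h1 : ξ ≤ 1) (hr0 : 0 ≤ r)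
    (hr1 : r ≤ (1 + ξ) ^ 2 / 8) (hw0 : 0 ≤ w) (hw1 : w ≤ (1 - ξ) ^ 2 / 8) :
    r * (2 * ε - 2 * ε * (r - w) / (r + (3 - ξ ^ 2) / 4 + w)) ^ 2 +
      (3 - ξ ^ 2) / 4 * (2 * ε * (r - w) / (r + (3 - ξ ^ 2) / 4 + w)) ^ 2 +
      w * (2 * ε + 2 * ε * (r - w) / (r + (3 - ξ ^ 2) / 4 + w)) ^ 2 ≤
      ε ^ 2 * (r + (3 - ξ ^ 2) / 4 + w) := by
  obtain ⟨n, hn⟩ : ∃ n, n = (3 - ξ ^ 2) / 4 := ⟨_, rfl⟩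
  have hξ : 0 ≤ 1 - ξ ^ 2 := by nlinarith
  have key : 4 * ((r + w) * (r + n + w) - (r - w) ^ 2) ≤ (r + n + w) ^ 2 := by
    have h3 : r * w ≤ (1 + ξ) ^ 2 / 8 * ((1 - ξ) ^ 2 / 8) := mul_le_mul hr1 hw1 hw0 (by positivity)
    have h4 : (1 - ξ ^ 2) / 2 ≤ n - r - w := by rw [hn]; linarith
    have h5 : ((1 - ξ ^ 2) / 2) ^ 2 ≤ (n - r - w) ^ 2 := pow_le_pow_left₀ (by linarith) h4 2
    have e : (r + n + w) ^ 2 - 4 * ((r + w) * (r + n + w) - (r - w) ^ 2) =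
        (n - r - w) ^ 2 - 16 * (r * w) := by ring
    linarith
  have hT : 0 < r + n + w := by linarith
  rw [← hn]
  obtain ⟨T, hTn⟩ : ∃ T, T = r + n + w := ⟨_, rfl⟩
  have hn' : n = T - r - w := by linarith
  rw [← hTn] at key hT ⊢
  rw [hn']
  have e : r * (2 * ε - 2 * ε * (r - w) / T) ^ 2 + (T - r - w) * (2 * ε * (r - w) / T) ^ 2 +
      w * (2 * ε + 2 * ε * (r - w) / T) ^ 2 =
      ε ^ 2 * (4 * ((r + w) * T - (r - w) ^ 2) / T) := by
    field_simp
    ring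
  rw [e]
  refine mul_le_mul_of_nonneg_left ?_ (sq_nonneg ε)
  rw [div_le_iff₀ hT]
  linarith

/-- Three values `2 ε`, `0`, `-2 ε`. The two outer values are taken on sets that are as large as
the bound on the mean oscillation over the whole interval permits. -/
theorem one_sub_sq_le_b {ξ ε : ℝ} (hε : 0 ≤ ε) (h0 : -1 ≤ ξ) (h1 : ξ ≤ 1) :
    ((1 - (1 - ξ) ^ 2 / 8 : ℝ) : EReal) ≤ b chi ε (ε * ξ) ((ε * ξ) ^ 2 + ε ^ 2) := by
  set c := (1 + ξ) ^ 2 / 8 with hc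
  set d := 1 - (1 - ξ) ^ 2 / 8 with hd
  have hc0 : 0 ≤ c := by positivity
  have hc1 : c ≤ 1 / 2 := by rw [hc]; nlinarith
  have hd0 : 1 / 2 ≤ d := by rw [hd]; nlinarith
  have hd1 : d ≤ 1 := by rw [hd]; nlinarith [sq_nonneg (1 - ξ)]
  set ψ : ℝ → ℝ := fun s => if s ≤ c then 2 * ε else if s ≤ d then 0 else -(2 * ε) with hψ
  have hm : Measurable ψ := Measurable.ite measurableSet_Iic measurable_const
    (Measurable.ite measurableSet_Iic measurable_const measurable_const)
  have v1 : ∀ s, s ≤ c → ψ s = 2 * ε := fun s hs => if_pos hs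
  have v2 : ∀ s, c < s → s ≤ d → ψ s = 0 := fun s hs hs' => by
    rw [hψ]; simp only; rw [if_neg (not_le.2 hs), if_pos hs']
  have v3 : ∀ s, d < s → ψ s = -(2 * ε) := fun s hs => by
    rw [hψ]; simp only; rw [if_neg (by linarith), if_neg (not_le.2 hs)]
  have hb : ∀ s, |ψ s| ≤ 2 * ε := fun s => by
    rcases le_or_gt s c with hs | hs
    · rw [v1 s hs, abs_of_nonneg (by linarith)]
    rcases le_or_gt s d with hs' | hs'
    · rw [v2 s hs hs']; simpa using hε
    · rw [v3 s hs', abs_neg, abs_of_nonneg (by linarith)]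
  have hmem : MemLp ψ 2 (volume.restrict (Set.Icc (0 : ℝ) 1)) :=
    MemLp.of_bound hm.aestronglyMeasurable _ (Eventually.of_forall hb)
  have hlong : ∀ u v k, 0 ≤ u → u ≤ c → d ≤ v → v ≤ 1 → ∫ s in u..v, (ψ s - k) ^ 2 =
      (c - u) * (2 * ε - k) ^ 2 + (d - c) * k ^ 2 + (v - d) * (2 * ε + k) ^ 2 := by
    intro u v k hu huc hdv hv
    have i := fun (a b : ℝ) ha hab hb =>
      MemLp.intervalIntegrable_sub_sq_unit hmem k (u := a) (v := b) ha hab hb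
    rw [← intervalIntegral.integral_add_adjacent_intervals (i u c hu huc (by linarith))
      (i c v hc0 (by linarith) hv),
      ← intervalIntegral.integral_add_adjacent_intervals (i c d hc0 (by linarith) hd1)
      (i d v (by linarith) hdv hv),
      intervalIntegral_eq_const huc fun s _ hs => by rw [v1 s hs],
      intervalIntegral_eq_const (by linarith) fun s hs hs' => by rw [v2 s hs hs'],
      intervalIntegral_eq_const hdv fun s hs _ => by rw [v3 s hs]]
    ring
  have hx : ∫ s in (0 : ℝ)..1, ψ s = ε * ξ := by
    have i := fun (a b : ℝ) ha hab hb =>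
      MemLp.intervalIntegrable_unit hmem (u := a) (v := b) ha hab hb
    rw [← intervalIntegral.integral_add_adjacent_intervals (i 0 c le_rfl hc0 (by linarith))
      (i c 1 hc0 (by linarith) le_rfl),
      ← intervalIntegral.integral_add_adjacent_intervals (i c d hc0 (by linarith) hd1)
      (i d 1 (by linarith) hd1 le_rfl),
      intervalIntegral_eq_const hc0 fun s _ hs => v1 s hs,
      intervalIntegral_eq_const (by linarith) fun s hs hs' => v2 s hs hs',
      intervalIntegral_eq_const hd1 fun s hs _ => v3 s hs, hc, hd]
    ring
  have hy : ∫ s in (0 : ℝ)..1, (ψ s) ^ 2 = (ε * ξ) ^ 2 + ε ^ 2 := by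
    have := hlong 0 1 0 le_rfl hc0 hd1 le_rfl
    simp only [sub_zero] at this
    rw [this, hc, hd]
    ring
  refine le_b_of_test hm (fun s _ => hb s) hx hy ?_ (fun s hs => ?_) (by linarith) hd1
  · intro u v hu huv hv
    rcases le_or_gt v d with hvd | hvd
    · refine ⟨ε, le_of_eq ?_⟩
      rw [intervalIntegral_eq_const (c := ε ^ 2) huv.le fun s _ hs => ?_, mul_comm]
      rcases le_or_gt s c with hsc | hsc
      · rw [v1 s hsc]; ring
      · rw [v2 s hsc (hs.trans hvd)]; ring
    rcases le_or_gt c u with hcu | hcu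
    · refine ⟨-ε, le_of_eq ?_⟩
      rw [intervalIntegral_eq_const (c := ε ^ 2) huv.le fun s hs _ => ?_, mul_comm]
      rcases le_or_gt s d with hsd | hsd
      · rw [v2 s (hcu.trans_lt hs) hsd]; ring
      · rw [v3 s hsd]; ring
    -- compare with the mean
    have hr0 : 0 ≤ c - u := by linarith
    have hr1 : c - u ≤ (1 + ξ) ^ 2 / 8 := by linarith
    have hs0 : 0 ≤ v - d := by linarith
    have hs1 : v - d ≤ (1 - ξ) ^ 2 / 8 := by linarith
    have hM : d - c = (3 - ξ ^ 2) / 4 := by rw [hc, hd]; ring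
    have hvu : v - u = (c - u) + (d - c) + (v - d) := by ring
    refine ⟨2 * ε * ((c - u) - (v - d)) / (v - u), ?_⟩
    rw [hlong u v _ hu hcu.le hvd.le hv, hvu]
    rw [hM]
    exact three_value_variance_le h0 h1 hr0 hr1 hs0 hs1
  · rcases le_or_gt s c with hsc | hsc
    · simp only [Set.mem_ofPred_eq, v1 s hsc]; linarith
    · simp only [Set.mem_ofPred_eq, v2 s hsc hs.2]; exact le_rfl

theorem integral_one_add_log_sq {w v : ℝ} (hw : 0 < w) (hwv : w ≤ v) :
    ∫ s in w..v, (1 + Real.log (s / v)) ^ 2 = v - w * (Real.log (w / v) ^ 2 + 1) := by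
  have hv : 0 < v := by linarith
  have hd : ∀ s ∈ Set.uIcc w v, HasDerivAt (fun s => s * (Real.log (s / v) ^ 2 + 1))
      ((1 + Real.log (s / v)) ^ 2) s := by
    intro s hs
    rw [Set.uIcc_of_le hwv] at hs
    have hs0 : 0 < s := by linarith [hs.1]
    have h1 := ((hasDerivAt_id s).div_const v).log (div_pos hs0 hv).ne'
    refine ((hasDerivAt_id s).mul ((h1.pow 2).add_const 1)).congr_deriv ?_
    simp only [id, Pi.pow_apply]
    field_simp
    ring
  have hcont : ContinuousOn (fun s => (1 + Real.log (s / v)) ^ 2) (Set.uIcc w v) := by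
    intro s hs
    rw [Set.uIcc_of_le hwv] at hs
    have hs0 : 0 < s := by linarith [hs.1]
    have : ContinuousAt (fun s => Real.log (s / v)) s :=
      (continuousAt_id.div_const v).log (div_pos hs0 hv).ne'
    exact ((continuousAt_const.add this).pow 2).continuousWithinAt
  rw [intervalIntegral.integral_eq_sub_of_hasDerivAt hd hcont.intervalIntegrable]
  simp [div_self hv.ne']

theorem integral_one_add_log {w : ℝ} (hw : 0 < w) (hw1 : w ≤ 1) :
    ∫ s in w..1, (1 + Real.log s) = -(w * Real.log w) := by
  have hd : ∀ s ∈ Set.uIcc w 1, HasDerivAt (fun s => s * Real.log s) (1 + Real.log s) s := by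
    intro s hs
    rw [Set.uIcc_of_le hw1] at hs
    have hs0 : 0 < s := by linarith [hs.1]
    refine ((hasDerivAt_id s).mul (Real.hasDerivAt_log hs0.ne')).congr_deriv ?_
    simp only [id]
    field_simp
    ring
  have hcont : ContinuousOn (fun s => 1 + Real.log s) (Set.uIcc w 1) := by
    intro s hs
    rw [Set.uIcc_of_le hw1] at hs
    have hs0 : 0 < s := by linarith [hs.1]
    exact (continuousAt_const.add (Real.continuousAt_log hs0.ne')).continuousWithinAt
  rw [intervalIntegral.integral_eq_sub_of_hasDerivAt hd hcont.intervalIntegrable]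
  simp

/-- A logarithm, preceded by the two values `0` and `-2 ε`. An interval `[u, v]` that reaches into
the logarithmic part is compared with the mean over `[0, v]`. -/
theorem exp_le_b {ξ ε : ℝ} (hε : 0 < ε) (hξ : ξ ≤ -1) :
    ((Real.exp (1 + ξ) / 2 : ℝ) : EReal) ≤ b chi ε (ε * ξ) ((ε * ξ) ^ 2 + ε ^ 2) := by
  set l := Real.exp (1 + ξ) / 2 with hl
  have hl0 : 0 < l := by positivity
  have hl1 : 2 * l ≤ 1 := by
    have : Real.exp (1 + ξ) ≤ 1 := Real.exp_le_one_iff.2 (by linarith)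
    rw [hl]; linarith
  have hlog : Real.log (2 * l) = 1 + ξ := by
    rw [hl, mul_div_cancel₀ _ two_ne_zero, Real.log_exp]
  set ψ : ℝ → ℝ := fun s => if s ≤ l then 0 else if s ≤ 2 * l then -(2 * ε) else
    -ε * (2 + Real.log (s / (2 * l))) with hψ
  have hm : Measurable ψ := Measurable.ite measurableSet_Iic measurable_const
    (Measurable.ite measurableSet_Iic measurable_const (by fun_prop))
  have v1 : ∀ s, s ≤ l → ψ s = 0 := fun s hs => if_pos hs
  have v2 : ∀ s, l < s → s ≤ 2 * l → ψ s = -(2 * ε) := fun s hs hs' => by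
    rw [hψ]; simp only; rw [if_neg (not_le.2 hs), if_pos hs']
  have v3 : ∀ s, 2 * l < s → ψ s = -ε * (2 + Real.log (s / (2 * l))) := fun s hs => by
    rw [hψ]; simp only; rw [if_neg (by linarith), if_neg (not_le.2 hs)]
  have hb : ∀ s ∈ Set.Icc (0 : ℝ) 1, |ψ s| ≤ ε * (1 - ξ) := fun s hs1 => by
    rcases le_or_gt s l with hs | hs
    · rw [v1 s hs, abs_zero]; nlinarith
    rcases le_or_gt s (2 * l) with hs' | hs'
    · rw [v2 s hs hs', abs_neg, abs_of_nonneg (by linarith)]; nlinarith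
    · have h1 : 0 ≤ Real.log (s / (2 * l)) :=
        Real.log_nonneg (by rw [le_div_iff₀ (by linarith)]; linarith)
      have h2 : Real.log (s / (2 * l)) ≤ -(1 + ξ) := by
        rw [Real.log_div (by linarith) (by linarith), hlog]
        have := Real.log_nonpos hs1.1 hs1.2
        linarith
      rw [v3 s hs', neg_mul, abs_neg, abs_of_nonneg (by positivity)]
      nlinarith
  have hmem : MemLp ψ 2 (volume.restrict (Set.Icc (0 : ℝ) 1)) := by
    refine MemLp.of_bound hm.aestronglyMeasurable (ε * (1 - ξ)) ?_
    filter_upwards [ae_restrict_mem measurableSet_Icc] with s hs using hb s hs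
  -- the comparison constant for an interval that ends at `v` is `-ε (1 + log (v / 2l))`
  have hpart : ∀ w v, 2 * l ≤ w → w ≤ v →
      ∫ s in w..v, (ψ s - -ε * (1 + Real.log (v / (2 * l)))) ^ 2 =
        ε ^ 2 * (v - w * (Real.log (w / v) ^ 2 + 1)) := by
    intro w v hw hwv
    rw [← integral_one_add_log_sq (by linarith) hwv, ← intervalIntegral.integral_const_mul]
    refine intervalIntegral_eq_of_Ioc hwv fun s hs _ => ?_
    rw [v3 s (by linarith), Real.log_div (by linarith) (by linarith),
      Real.log_div (by linarith) (by linarith), Real.log_div (by linarith) (by linarith)]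
    ring
  have hlong : ∀ u v, 0 ≤ u → u ≤ 2 * l → 2 * l ≤ v → v ≤ 1 →
      ∫ s in u..v, (ψ s - -ε * (1 + Real.log (v / (2 * l)))) ^ 2 =
        (∫ s in u..2 * l, (ψ s - -ε * (1 + Real.log (v / (2 * l)))) ^ 2) +
        ε ^ 2 * (v - 2 * l * (Real.log (v / (2 * l)) ^ 2 + 1)) := by
    intro u v hu hul hlv hv
    have i := fun (a b : ℝ) ha hab hb => MemLp.intervalIntegrable_sub_sq_unit hmem
      (-ε * (1 + Real.log (v / (2 * l)))) (u := a) (v := b) ha hab hb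
    rw [← intervalIntegral.integral_add_adjacent_intervals (i u (2 * l) hu hul hl1)
      (i (2 * l) v (by linarith) hlv hv), hpart _ v le_rfl hlv]
    have : Real.log (2 * l / v) = -Real.log (v / (2 * l)) := by rw [← Real.log_inv, inv_div]
    rw [this]
    ring
  have hshort : ∀ u k, 0 ≤ u → u ≤ l →
      ∫ s in u..2 * l, (ψ s - k) ^ 2 = (l - u) * k ^ 2 + l * (2 * ε + k) ^ 2 := by
    intro u k hu hul
    have i := fun (a b : ℝ) ha hab hb => MemLp.intervalIntegrable_sub_sq_unit hmem
      k (u := a) (v := b) ha hab hb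
    rw [← intervalIntegral.integral_add_adjacent_intervals (i u l hu hul (by linarith))
      (i l (2 * l) (by linarith) (by linarith) hl1),
      intervalIntegral_eq_const hul fun s _ hs => by rw [v1 s hs],
      intervalIntegral_eq_const (by linarith) fun s hs hs' => by rw [v2 s hs hs']]
    ring
  have hlog1 : Real.log (1 / (2 * l)) = -(1 + ξ) := by rw [one_div, Real.log_inv, hlog]
  have hx : ∫ s in (0 : ℝ)..1, ψ s = ε * ξ := by
    have i := fun (a b : ℝ) ha hab hb =>
      MemLp.intervalIntegrable_unit hmem (u := a) (v := b) ha hab hb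
    have h3 : ∫ s in (2 * l)..1, ψ s = ∫ s in (2 * l)..1, (-ε * (1 + Real.log s) + ε * ξ) := by
      refine intervalIntegral_eq_of_Ioc hl1 fun s hs _ => ?_
      rw [v3 s hs, Real.log_div (by linarith) (by linarith), hlog]
      ring
    have h4 : IntervalIntegrable (fun s => -ε * (1 + Real.log s)) volume (2 * l) 1 := by
      refine IntervalIntegrable.const_mul ?_ _
      exact intervalIntegrable_const.add intervalIntegral.intervalIntegrable_log'
    rw [← intervalIntegral.integral_add_adjacent_intervals (i 0 l le_rfl hl0.le (by linarith))
      (i l 1 hl0.le (by linarith) le_rfl),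
      ← intervalIntegral.integral_add_adjacent_intervals (i l (2 * l) hl0.le (by linarith) hl1)
      (i (2 * l) 1 (by linarith) hl1 le_rfl), h3,
      intervalIntegral.integral_add h4 intervalIntegrable_const,
      intervalIntegral.integral_const_mul, integral_one_add_log (by linarith) hl1, hlog,
      intervalIntegral.integral_const,
      intervalIntegral_eq_const hl0.le fun s _ hs => v1 s hs,
      intervalIntegral_eq_const (by linarith) fun s hs hs' => v2 s hs hs', smul_eq_mul]
    ring
  have hy : ∫ s in (0 : ℝ)..1, (ψ s) ^ 2 = (ε * ξ) ^ 2 + ε ^ 2 := by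
    have h3 := hlong 0 1 le_rfl (by linarith) hl1 le_rfl
    rw [hshort 0 _ le_rfl hl0.le, hlog1, integral_sub_sq hmem _ le_rfl zero_le_one le_rfl, hx] at h3
    linarith
  refine le_b_of_test hm hb hx hy ?_ (fun s hs => ?_) hl0.le (by linarith)
  · intro u v hu huv hv
    rcases le_or_gt v (2 * l) with hvl | hvl
    · refine ⟨-ε, le_of_eq ?_⟩
      rw [intervalIntegral_eq_const (c := ε ^ 2) huv.le fun s _ hs => ?_, mul_comm]
      rcases le_or_gt s l with hsl | hsl
      · rw [v1 s hsl]; ring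
      · rw [v2 s hsl (hs.trans hvl)]; ring
    refine ⟨-ε * (1 + Real.log (v / (2 * l))), ?_⟩
    rcases le_or_gt (2 * l) u with hlu | hlu
    · rw [hpart u v hlu huv.le]
      have : 0 ≤ u * Real.log (u / v) ^ 2 := by positivity
      nlinarith [sq_nonneg ε]
    rw [hlong u v hu hlu.le hvl.le hv]
    have hL : 0 ≤ Real.log (v / (2 * l)) :=
      Real.log_nonneg (by rw [le_div_iff₀ (by linarith)]; linarith)
    generalize Real.log (v / (2 * l)) = L at *
    rcases le_or_gt u l with hul | hul
    · rw [hshort u _ hu hul]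
      have : 0 ≤ u * (L ^ 2 + 2 * L) := by positivity
      nlinarith [mul_nonneg (sq_nonneg ε) this]
    · rw [intervalIntegral_eq_const hlu.le fun s hs hs' => by rw [v2 s (hul.trans hs) hs']]
      have : 0 ≤ u * L ^ 2 + 2 * (2 * l - u) * L :=
        add_nonneg (by positivity) (mul_nonneg (by linarith) hL)
      nlinarith [mul_nonneg (sq_nonneg ε) this]
  · simp only [Set.mem_ofPred_eq, v1 s hs.2]; exact le_rfl

end BMO

/-! ### The rising sun lemma -/

section RisingSun

/-- The pairs of endpoints of the bounded components of an open set. -/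
def gaps (O : Set ℝ) : Set (ℝ × ℝ) :=
  {p | p.1 < p.2 ∧ p.1 ∉ O ∧ p.2 ∉ O ∧ Set.Ioo p.1 p.2 ⊆ O}

theorem pairwiseDisjoint_gaps (O : Set ℝ) :
    (gaps O).PairwiseDisjoint fun p => Set.Ioo p.1 p.2 := by
  rintro ⟨c, d⟩ ⟨-, hc, hd, hO⟩ ⟨c', d'⟩ ⟨-, hc', hd', hO'⟩ hne
  refine Set.disjoint_left.2 fun z hz hz' => hne ?_
  simp only at *
  have h1 : c = c' := by
    rcases lt_trichotomy c c' with h | h | h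
    · exact absurd (hO ⟨h, hz'.1.trans hz.2⟩) hc'
    · exact h
    · exact absurd (hO' ⟨h, hz.1.trans hz'.2⟩) hc
  have h2 : d = d' := by
    rcases lt_trichotomy d d' with h | h | h
    · exact absurd (hO' ⟨hz'.1.trans hz.2, h⟩) hd
    · exact h
    · exact absurd (hO ⟨hz.1.trans hz'.2, h⟩) hd'
  rw [h1, h2]

theorem countable_gaps (O : Set ℝ) : (gaps O).Countable :=
  (pairwiseDisjoint_gaps O).countable_of_isOpen (fun _ _ => isOpen_Ioo)
    fun _ hp => Set.nonempty_Ioo.2 hp.1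

theorem exists_gap {O : Set ℝ} (hO : IsOpen O) {a b : ℝ} (hsub : O ⊆ Set.Ioo a b) {t : ℝ}
    (ht : t ∈ O) : ∃ p ∈ gaps O, t ∈ Set.Ioo p.1 p.2 := by
  have hab := hsub ht
  have haO : a ∉ O := fun h => lt_irrefl _ (hsub h).1
  have hbO : b ∉ O := fun h => lt_irrefl _ (hsub h).2
  set L : Set ℝ := Oᶜ ∩ Set.Iic t with hL
  set R : Set ℝ := Oᶜ ∩ Set.Ici t with hR
  have hLb : BddAbove L := ⟨t, fun s hs => hs.2⟩
  have hRb : BddBelow R := ⟨t, fun s hs => hs.2⟩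
  have hLm : sSup L ∈ L := (hO.isClosed_compl.inter isClosed_Iic).csSup_mem ⟨a, haO, hab.1.le⟩ hLb
  have hRm : sInf R ∈ R := (hO.isClosed_compl.inter isClosed_Ici).csInf_mem ⟨b, hbO, hab.2.le⟩ hRb
  have h1 : sSup L < t := lt_of_le_of_ne hLm.2 fun h => hLm.1 (h ▸ ht)
  have h2 : t < sInf R := lt_of_le_of_ne hRm.2 fun h => hRm.1 (h ▸ ht)
  refine ⟨(sSup L, sInf R), ⟨h1.trans h2, hLm.1, hRm.1, fun s hs => ?_⟩, h1, h2⟩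
  by_contra hsO
  rcases le_total s t with h | h
  · exact absurd (le_csSup hLb ⟨hsO, h⟩) (not_le.2 hs.1)
  · exact absurd (csInf_le hRb ⟨hsO, h⟩) (not_le.2 hs.2)

/-- The points of `(a, b)` from which the graph of `F` is in the shadow of a later point, where
the height `F a` counts as high in any case. -/
def shadow (F : ℝ → ℝ) (a b : ℝ) : Set ℝ :=
  {t | t ∈ Set.Ioo a b ∧ ∃ s ∈ Set.Ioc t b, F t < F s ∨ F a ≤ F s}

variable {F : ℝ → ℝ} {a b : ℝ}

theorem isOpen_shadow (hF : Continuous F) : IsOpen (shadow F a b) := by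
  have : shadow F a b = Set.Ioo a b ∩ ⋃ s ∈ Set.Iic b,
      (Set.Iio s ∩ ({t | F t < F s} ∪ {_t | F a ≤ F s})) := by
    ext t
    simp only [shadow, Set.mem_ofPred_eq, Set.mem_inter_iff, Set.mem_iUnion, Set.mem_Iic,
      Set.mem_Iio, Set.mem_union, Set.mem_Ioc]
    constructor
    · rintro ⟨h, s, ⟨h1, h2⟩, h3⟩; exact ⟨h, s, h2, h1, h3⟩
    · rintro ⟨h, s, h2, h1, h3⟩; exact ⟨h, s, ⟨h1, h2⟩, h3⟩
  rw [this]
  exact isOpen_Ioo.inter (isOpen_biUnion fun s _ => isOpen_Iio.inter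
    ((isOpen_lt hF continuous_const).union isOpen_const))

theorem shadow_gap_bounds {p : ℝ × ℝ} (hp : p ∈ gaps (shadow F a b)) : a ≤ p.1 ∧ p.2 ≤ b :=
  (Set.Ioo_subset_Ioo_iff hp.1).1 (hp.2.2.2.trans fun _ h => h.1)

/-- The rising sun lemma: `F` has the same height at both ends of a component of the shadow. -/
theorem shadow_gap_eq (hF : Continuous F) (hab : F b < F a) {p : ℝ × ℝ}
    (hp : p ∈ gaps (shadow F a b)) : F p.1 = F p.2 := by
  obtain ⟨hac, hdb⟩ := shadow_gap_bounds hp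
  obtain ⟨c, d⟩ := p
  obtain ⟨hcd, hc, hd, hO⟩ := hp
  simp only at *
  have hright : ∀ s ∈ Set.Ioc d b, F s ≤ F d ∧ F s < F a := by
    intro s hs
    have hdlt : d < b := hs.1.trans_le hs.2
    constructor
    · by_contra h
      exact hd ⟨⟨hac.trans_lt hcd, hdlt⟩, s, hs, Or.inl (not_le.1 h)⟩
    · by_contra h
      exact hd ⟨⟨hac.trans_lt hcd, hdlt⟩, s, hs, Or.inr (not_lt.1 h)⟩
  have hleft : a < c → ∀ s ∈ Set.Ioc c b, F s ≤ F c ∧ F s < F a := by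
    intro h s hs
    constructor
    · by_contra h'
      exact hc ⟨⟨h, hs.1.trans_le hs.2⟩, s, hs, Or.inl (not_le.1 h')⟩
    · by_contra h'
      exact hc ⟨⟨h, hs.1.trans_le hs.2⟩, s, hs, Or.inr (not_lt.1 h')⟩
  rcases lt_trichotomy (F c) (F d) with h | h | h
  · exfalso
    rcases hac.eq_or_lt with rfl | hac
    · have hdb' : d < b := lt_of_le_of_ne hdb fun e => by rw [e] at h; linarith
      obtain ⟨s, hs, hFs⟩ := intermediate_value_Icc' hdb hF.continuousOn
        (show F a ∈ Set.Icc (F b) (F d) from ⟨hab.le, h.le⟩)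
      have hds : d < s := lt_of_le_of_ne hs.1 fun e => by rw [← e] at hFs; linarith
      exact absurd (hright s ⟨hds, hs.2⟩).2 (by rw [hFs]; exact lt_irrefl _)
    · exact absurd (hleft hac d ⟨hcd, hdb⟩).1 (not_le.2 h)
  · exact h
  · exfalso
    -- the last point of `[c, d]` at an intermediate height `θ` cannot be in the shadow
    obtain ⟨θ, hθ1, hθ2⟩ := exists_between h
    set R : Set ℝ := Set.Icc c d ∩ {s | θ ≤ F s} with hR
    have hRb : BddAbove R := ⟨d, fun s hs => hs.1.2⟩
    have hRm : sSup R ∈ R := (isClosed_Icc.inter (isClosed_le continuous_const hF)).csSup_mem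
      ⟨c, ⟨le_rfl, hcd.le⟩, hθ2.le⟩ hRb
    have hlast : ∀ s, sSup R < s → s ≤ d → F s < θ := by
      intro s hs hsd
      by_contra h'
      exact absurd (le_csSup hRb ⟨⟨hRm.1.1.trans hs.le, hsd⟩, not_lt.1 h'⟩) (not_le.2 hs)
    have hrd : sSup R < d := lt_of_le_of_ne hRm.1.2 fun e => by
      have := hRm.2
      rw [e] at this
      exact absurd this (not_le.2 hθ1)
    have hcr : c < sSup R := by
      refine lt_of_le_of_ne hRm.1.1 fun e => ?_
      obtain ⟨s, hs, hFs⟩ := intermediate_value_Icc' hcd.le hF.continuousOn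
        (show θ ∈ Set.Icc (F d) (F c) from ⟨hθ1.le, hθ2.le⟩)
      have hcs : c < s := lt_of_le_of_ne hs.1 fun e' => by rw [← e'] at hFs; linarith
      have := hlast s (e ▸ hcs) hs.2
      linarith
    obtain ⟨-, s, hs, hor⟩ := hO ⟨hcr, hrd⟩
    rcases le_or_gt s d with hsd | hsd
    · have h1 := hlast s hs.1 hsd
      have h2 : θ ≤ F (sSup R) := hRm.2
      rcases hor with h3 | h3
      · linarith
      · rcases hac.eq_or_lt with rfl | hac
        · linarith
        · exact absurd (hleft hac s ⟨hcr.trans hs.1, hs.2⟩).2 (not_lt.2 h3)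
    · have h1 := hright s ⟨hsd, hs.2⟩
      have h2 : θ ≤ F (sSup R) := hRm.2
      rcases hor with h3 | h3 <;> linarith

/-- A function with mean less than `β` over `[a, b]` is at most `β` almost everywhere outside
countably many disjoint intervals on which its mean is exactly `β`. -/
theorem exists_intervals_mean_eq {ψ : ℝ → ℝ} {β : ℝ} (hab : a < b)
    (hψ : IntegrableOn ψ (Set.Icc a b)) (hβ : mean ψ a b < β) :
    ∃ I : Set (ℝ × ℝ), I.Countable ∧ (I.PairwiseDisjoint fun p => Set.Ioo p.1 p.2) ∧
      (∀ p ∈ I, a ≤ p.1 ∧ p.1 < p.2 ∧ p.2 ≤ b ∧ mean ψ p.1 p.2 = β) ∧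
      ∀ᵐ t, t ∈ Set.Ioo a b → (∀ p ∈ I, t ∉ Set.Ioo p.1 p.2) → ψ t ≤ β := by
  set g : ℝ → ℝ := Set.indicator (Set.Icc a b) fun s => ψ s - β with hg
  have hgint : Integrable g :=
    (hψ.sub (integrableOn_const (by simp))).integrable_indicator measurableSet_Icc
  set F : ℝ → ℝ := fun t => ∫ s in a..t, g s with hF
  have hFc : Continuous F :=
    intervalIntegral.continuous_primitive (fun _ _ => hgint.intervalIntegrable) a
  have hval : ∀ u v, a ≤ u → u < v → v ≤ b → F v - F u = (mean ψ u v - β) * (v - u) := by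
    intro u v hau huv hvb
    have h0 : v - u ≠ 0 := (sub_pos.2 huv).ne'
    have hi : IntervalIntegrable ψ volume u v := by
      rw [intervalIntegrable_iff_integrableOn_Icc_of_le huv.le]
      exact hψ.mono_set (Set.Icc_subset_Icc hau hvb)
    simp only [hF]
    rw [intervalIntegral.integral_interval_sub_left hgint.intervalIntegrable
      hgint.intervalIntegrable, intervalIntegral_eq_of_Ioc (G := fun s => ψ s - β) huv.le fun s h1 h2 =>
        Set.indicator_of_mem (show s ∈ Set.Icc a b from ⟨by linarith, by linarith⟩) _,
      intervalIntegral.integral_sub hi intervalIntegrable_const, intervalIntegral.integral_const,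
      mean, smul_eq_mul]
    field_simp
  have hFab : F b < F a := by
    have := hval a b le_rfl hab le_rfl
    nlinarith
  refine ⟨gaps (shadow F a b), countable_gaps _, pairwiseDisjoint_gaps _, fun p hp => ?_, ?_⟩
  · obtain ⟨h1, h2⟩ := shadow_gap_bounds hp
    refine ⟨h1, hp.1, h2, ?_⟩
    have h3 := hval p.1 p.2 h1 hp.1 h2
    rw [shadow_gap_eq hFc hFab hp, sub_self] at h3
    rcases mul_eq_zero.1 h3.symm with h4 | h4
    · linarith
    · exact absurd h4 (sub_pos.2 hp.1).ne'
  · filter_upwards [LocallyIntegrable.ae_hasDerivAt_integral hgint.locallyIntegrable] with t ht htab hout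
    have hO : t ∉ shadow F a b := fun h => by
      obtain ⟨p, hp, htp⟩ := exists_gap (isOpen_shadow hFc) (fun _ h => h.1) h
      exact hout p hp htp
    have hgt : g t = ψ t - β := Set.indicator_of_mem (show t ∈ Set.Icc a b from ⟨htab.1.le, htab.2.le⟩) _
    have hd : HasDerivWithinAt F (g t) (Set.Ioi t) t := (ht a).hasDerivWithinAt
    rw [hasDerivWithinAt_iff_tendsto_slope' Set.self_notMem_Ioi] at hd
    have hle : g t ≤ 0 := by
      refine le_of_tendsto hd ?_
      filter_upwards [Ioc_mem_nhdsGT htab.2] with s hs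
      rw [slope_def_field]
      refine div_nonpos_of_nonpos_of_nonneg ?_ (sub_nonneg.2 hs.1.le)
      by_contra h
      exact hO ⟨htab, s, hs, Or.inl (by linarith)⟩
    linarith

end RisingSun

/-! ### The sharp weak-type bound on the mean oscillation ball -/

section WeakType

variable {ψ : ℝ → ℝ}

theorem lintegral_sub_sq (hψ : MemLp ψ 2 (volume.restrict (Set.Icc (0 : ℝ) 1))) (k : ℝ)
    {u v : ℝ} (hu : 0 ≤ u) (huv : u ≤ v) (hv : v ≤ 1) :
    ∫⁻ s in Set.Ioo u v, ENNReal.ofReal ((ψ s - k) ^ 2) =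
      ENNReal.ofReal (∫ s in u..v, (ψ s - k) ^ 2) := by
  have hi := MemLp.intervalIntegrable_sub_sq_unit hψ k hu huv hv
  rw [intervalIntegrable_iff_integrableOn_Ioc_of_le huv] at hi
  rw [intervalIntegral.integral_of_le huv, restrict_Ioo_eq_restrict_Ioc,
    ofReal_integral_eq_lintegral_ofReal hi (Eventually.of_forall fun s => sq_nonneg _)]

/-- Raising the mean from `α` to `β = α + τ ε` costs at least a factor `1 + τ`. -/
theorem one_add_mul_integral_le {ε τ α β : ℝ} (hτ : 0 ≤ τ) (hβ : β = α + τ * ε)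
    (hψ : MemLp ψ 2 (volume.restrict (Set.Icc (0 : ℝ) 1)))
    (hbmo : bmoNormSq ψ ≤ ENNReal.ofReal (ε ^ 2)) {u v : ℝ} (hu : 0 ≤ u) (huv : u < v) (hv : v ≤ 1)
    (hm : mean ψ u v = β) :
    (1 + τ) * ∫ s in u..v, (ψ s - (β - ε)) ^ 2 ≤ ∫ s in u..v, (ψ s - (α - ε)) ^ 2 := by
  have hV := integral_sub_mean_sq_le (sq_nonneg ε) hbmo hu huv hv
  rw [integral_sub_mean_sq hψ (β - ε) hu huv hv, integral_sub_mean_sq hψ (α - ε) hu huv hv, hm]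
  rw [hm] at hV
  have e1 : β - (β - ε) = ε := by ring
  have e2 : β - (α - ε) = (1 + τ) * ε := by rw [hβ]; ring
  rw [e1, e2]
  nlinarith [mul_le_mul_of_nonneg_left hV hτ, mul_nonneg (mul_nonneg hτ hτ)
    (mul_nonneg (sq_nonneg ε) (sub_pos.2 huv).le)]

/-- The induction raises the mean in `n` equal steps to `-ε`, by means of the rising sun lemma, and
ends with the bound of Chebyshev at height `-2 ε`. -/
theorem measure_nonneg_le {ε τ : ℝ} (hε : 0 < ε) (hτ : 0 < τ)
    (hψ : MemLp ψ 2 (volume.restrict (Set.Icc (0 : ℝ) 1)))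
    (hbmo : bmoNormSq ψ ≤ ENNReal.ofReal (ε ^ 2)) (n : ℕ) :
    ∀ u v α : ℝ, 0 ≤ u → u < v → v ≤ 1 → mean ψ u v = α → α + n * (τ * ε) = -ε →
      ENNReal.ofReal (4 * ε ^ 2 * (1 + τ) ^ n) * volume ({s | 0 ≤ ψ s} ∩ Set.Ioo u v) ≤
        ∫⁻ s in Set.Ioo u v, ENNReal.ofReal ((ψ s - (α - ε)) ^ 2) := by
  have hsq : ∀ k (u v : ℝ), 0 ≤ u → v ≤ 1 →
      AEMeasurable (fun s => ENNReal.ofReal ((ψ s - k) ^ 2)) (volume.restrict (Set.Ioo u v)) := by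
    intro k u v hu hv
    have h1 : AEMeasurable ψ (volume.restrict (Set.Ioo u v)) :=
      hψ.aestronglyMeasurable.aemeasurable.mono_measure (Measure.restrict_mono
        (Set.Ioo_subset_Icc_self.trans (Set.Icc_subset_Icc hu hv)) le_rfl)
    exact ((h1.sub_const k).pow_const 2).ennreal_ofReal
  induction n with
  | zero =>
    intro u v α hu huv hv hm hα
    have hα' : α = -ε := by simpa using hα
    rw [← Measure.restrict_apply' measurableSet_Ioo]
    refine le_trans (mul_le_mul_right (measure_mono fun s hs => ?_) _)
      (mul_meas_ge_le_lintegral₀ (hsq _ u v hu hv) _)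
    simp only [Set.mem_ofPred_eq] at hs ⊢
    refine ENNReal.ofReal_le_ofReal ?_
    rw [hα']
    nlinarith
  | succ n ih =>
    intro u v α hu huv hv hm hα
    have hint : IntegrableOn ψ (Set.Icc u v) :=
      IntegrableOn.mono_set (hψ.integrable (by norm_num)) (Set.Icc_subset_Icc hu hv)
    have hτε : 0 < τ * ε := mul_pos hτ hε
    obtain ⟨I, hI, hdisj, hIp, hae⟩ := exists_intervals_mean_eq (β := α + τ * ε) huv hint (by linarith)
    push_cast at hα
    have hneg : α + τ * ε < 0 := by
      have : 0 ≤ (n : ℝ) * (τ * ε) := by positivity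
      linarith
    have hcover : volume ({s | 0 ≤ ψ s} ∩ Set.Ioo u v) ≤
        ∑' p : I, volume ({s | 0 ≤ ψ s} ∩ Set.Ioo p.1.1 p.1.2) := by
      refine le_trans (measure_mono_ae ?_)
        (measure_biUnion_le volume hI fun p => {s | 0 ≤ ψ s} ∩ Set.Ioo p.1 p.2)
      filter_upwards [hae] with t ht hmem
      by_contra hcon
      have hle := ht hmem.2 fun p hp htp => hcon (Set.mem_biUnion hp ⟨hmem.1, htp⟩)
      have h0 : 0 ≤ ψ t := hmem.1
      linarith
    have hone : ∀ p ∈ I, ENNReal.ofReal (4 * ε ^ 2 * (1 + τ) ^ (n + 1)) *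
        volume ({s | 0 ≤ ψ s} ∩ Set.Ioo p.1 p.2) ≤
        ∫⁻ s in Set.Ioo p.1 p.2, ENNReal.ofReal ((ψ s - (α - ε)) ^ 2) := by
      intro p hp
      obtain ⟨h1, h2, h3, h4⟩ := hIp p hp
      have hp0 : 0 ≤ p.1 := hu.trans h1
      have hp1 : p.2 ≤ 1 := h3.trans hv
      have h5 := ih p.1 p.2 (α + τ * ε) hp0 h2 hp1 h4 (by linarith)
      have e : 4 * ε ^ 2 * (1 + τ) ^ (n + 1) = (1 + τ) * (4 * ε ^ 2 * (1 + τ) ^ n) := by ring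
      rw [e, ENNReal.ofReal_mul (by linarith), mul_assoc]
      refine (mul_le_mul_right h5 _).trans ?_
      rw [lintegral_sub_sq hψ _ hp0 h2.le hp1, lintegral_sub_sq hψ _ hp0 h2.le hp1,
        ← ENNReal.ofReal_mul (by linarith)]
      exact ENNReal.ofReal_le_ofReal (one_add_mul_integral_le hτ.le rfl hψ hbmo hp0 h2 hp1 h4)
    calc ENNReal.ofReal (4 * ε ^ 2 * (1 + τ) ^ (n + 1)) * volume ({s | 0 ≤ ψ s} ∩ Set.Ioo u v)
        ≤ ENNReal.ofReal (4 * ε ^ 2 * (1 + τ) ^ (n + 1)) *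
          ∑' p : I, volume ({s | 0 ≤ ψ s} ∩ Set.Ioo p.1.1 p.1.2) := mul_le_mul_right hcover _
      _ = ∑' p : I, ENNReal.ofReal (4 * ε ^ 2 * (1 + τ) ^ (n + 1)) *
          volume ({s | 0 ≤ ψ s} ∩ Set.Ioo p.1.1 p.1.2) := ENNReal.tsum_mul_left.symm
      _ ≤ ∑' p : I, ∫⁻ s in Set.Ioo p.1.1 p.1.2, ENNReal.ofReal ((ψ s - (α - ε)) ^ 2) :=
          ENNReal.tsum_le_tsum fun p => hone p.1 p.2
      _ = ∫⁻ s in ⋃ p ∈ I, Set.Ioo p.1 p.2, ENNReal.ofReal ((ψ s - (α - ε)) ^ 2) :=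
          (lintegral_biUnion hI (fun _ _ => measurableSet_Ioo) hdisj _).symm
      _ ≤ ∫⁻ s in Set.Ioo u v, ENNReal.ofReal ((ψ s - (α - ε)) ^ 2) :=
          lintegral_mono_set (Set.iUnion₂_subset fun p hp =>
            Set.Ioo_subset_Ioo (hIp p hp).1 (hIp p hp).2.2.1)

/-- The bound of `measure_nonneg_le` with `n` steps and `τ = (-1 - ξ) / n` contains the factor
`(1 + τ) ^ n`, which tends to `exp (-1 - ξ)`. -/
theorem b_le_exp {ξ ε : ℝ} (hε : 0 < ε) (hξ : ξ ≤ -1) :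
    b chi ε (ε * ξ) ((ε * ξ) ^ 2 + ε ^ 2) ≤ ((Real.exp (1 + ξ) / 2 : ℝ) : EReal) := by
  refine sSup_le ?_
  rintro _ ⟨ψ, hψ, hx, hy, hbmo, rfl⟩
  rw [lintegral_chi hψ.aestronglyMeasurable.aemeasurable, ← restrict_Ioo_eq_restrict_Icc,
    Measure.restrict_apply' measurableSet_Ioo]
  set V := volume ({s | 0 ≤ ψ s} ∩ Set.Ioo 0 1) with hV
  have hVtop : V ≠ ⊤ := measure_ne_top_of_subset Set.inter_subset_right (by simp)
  have hmean : mean ψ 0 1 = ε * ξ := by rw [SquareBellman.mean, hx]; simp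
  have hint : ∫⁻ s in Set.Ioo (0 : ℝ) 1, ENNReal.ofReal ((ψ s - (ε * ξ - ε)) ^ 2) =
      ENNReal.ofReal (2 * ε ^ 2) := by
    rw [lintegral_sub_sq hψ _ le_rfl zero_le_one le_rfl,
      integral_sub_sq hψ _ le_rfl zero_le_one le_rfl, hx, hy]
    congr 1
    ring
  have hmain : ∀ (n : ℕ) (τ : ℝ), 0 < τ → ε * ξ + n * (τ * ε) = -ε →
      (1 + τ) ^ n * V.toReal ≤ 1 / 2 := by
    intro n τ hτ hn
    have h1 := measure_nonneg_le hε hτ hψ hbmo n 0 1 (ε * ξ) le_rfl one_pos le_rfl hmean hn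
    rw [hint, ← hV, ← ENNReal.ofReal_toReal hVtop, ← ENNReal.ofReal_mul (by positivity),
      ENNReal.ofReal_le_ofReal_iff (by positivity)] at h1
    have h2 : 0 < ε ^ 2 := by positivity
    nlinarith
  have hreal : V.toReal ≤ Real.exp (1 + ξ) / 2 := by
    rcases hξ.eq_or_lt with rfl | hξ
    · simpa using hmain 0 1 one_pos (by simp)
    have hlim := (Real.tendsto_one_add_div_pow_exp (-1 - ξ)).mul_const V.toReal
    have h3 : Real.exp (-1 - ξ) * V.toReal ≤ 1 / 2 := by
      refine le_of_tendsto hlim ?_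
      filter_upwards [eventually_gt_atTop 0] with n hn
      have hn' : (0 : ℝ) < n := by exact_mod_cast hn
      exact hmain n ((-1 - ξ) / n) (div_pos (by linarith) hn') (by field_simp; ring)
    have h4 : Real.exp (1 + ξ) * Real.exp (-1 - ξ) = 1 := by
      rw [← Real.exp_add]; simp
    nlinarith [Real.exp_pos (1 + ξ)]
  rw [← ENNReal.ofReal_toReal hVtop, EReal.coe_ennreal_ofReal, max_eq_left ENNReal.toReal_nonneg]
  exact_mod_cast hreal

end WeakType

/-! ### Comparison of the two Bellman functions -/

/-- For `ε = 0` only the constant function competes. -/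
theorem b_zero (x : ℝ) : b chi 0 x (x ^ 2) = (chi x : EReal) := by
  rcases le_or_gt 0 x with hx | hx
  · rw [chi_of_nonneg hx]
    refine le_antisymm b_le_one ?_
    simpa using one_le_b le_rfl hx
  rw [chi_of_neg hx]
  refine le_antisymm (sSup_le ?_) ?_
  · rintro _ ⟨ψ, hψ, h1, h2, -, rfl⟩
    have h3 : ∫ s in (0 : ℝ)..1, (ψ s - x) ^ 2 = 0 := by
      rw [integral_sub_sq hψ x le_rfl zero_le_one le_rfl, h1, h2]
      ring
    have hi := MemLp.intervalIntegrable_sub_sq_unit hψ x le_rfl zero_le_one le_rfl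
    rw [intervalIntegrable_iff_integrableOn_Ioc_of_le zero_le_one,
      ← integrableOn_Icc_iff_integrableOn_Ioc] at hi
    rw [intervalIntegral.integral_of_le zero_le_one, ← integral_Icc_eq_integral_Ioc,
      integral_eq_zero_iff_of_nonneg (fun s => sq_nonneg _) hi] at h3
    have h4 : ∫⁻ s in Set.Icc (0 : ℝ) 1, ENNReal.ofReal (chi (ψ s)) = 0 := by
      rw [lintegral_chi hψ.aestronglyMeasurable.aemeasurable, measure_eq_zero_iff_ae_notMem]
      filter_upwards [h3] with s hs h0
      have h5 : ψ s - x = 0 := by simpa using hs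
      have h6 : 0 ≤ ψ s := h0
      linarith
    rw [h4]
    simp
  · have := le_b_of_test (ψ := fun _ => x) (ε := 0) (x := x) (y := x ^ 2) (p := 0) (K := |x|)
      measurable_const (fun _ _ => le_rfl) (by simp) (by simp)
      (fun u v _ _ _ => ⟨x, by simp⟩) (by simp) le_rfl zero_le_one
    exact_mod_cast this

/-- Both sides of `cos η · exp η < 1 + sin η` agree at `η = 0`, and `sec η > 1` is the derivative of
`log ((1 + sin η) / cos η)`. -/
theorem cos_mul_exp_lt {η : ℝ} (h0 : 0 < η) (h1 : η < Real.pi / 2) :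
    Real.cos η * Real.exp η < 1 + Real.sin η := by
  have hcos : ∀ s ∈ Set.Ico 0 (Real.pi / 2), 0 < Real.cos s := fun s hs =>
    Real.cos_pos_of_mem_Ioo ⟨by linarith [hs.1, Real.pi_pos], hs.2⟩
  have hsin : ∀ s ∈ Set.Ico 0 (Real.pi / 2), 0 < 1 + Real.sin s := fun s hs => by
    linarith [Real.sin_nonneg_of_nonneg_of_le_pi hs.1 (by linarith [hs.2, Real.pi_pos])]
  have hd : ∀ s ∈ Set.Ico 0 (Real.pi / 2), HasDerivAt
      (fun s => Real.log (1 + Real.sin s) - Real.log (Real.cos s) - s) (1 / Real.cos s - 1) s := by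
    intro s hs
    have hc := hcos s hs
    have hp := hsin s hs
    refine (((((Real.hasDerivAt_sin s).const_add 1).log hp.ne').sub
      ((Real.hasDerivAt_cos s).log hc.ne')).sub (hasDerivAt_id s)).congr_deriv ?_
    field_simp
    linear_combination Real.sin_sq_add_cos_sq s
  have hmono : StrictMonoOn (fun s => Real.log (1 + Real.sin s) - Real.log (Real.cos s) - s)
      (Set.Ico 0 (Real.pi / 2)) := by
    refine strictMonoOn_of_deriv_pos (convex_Ico _ _)
      (fun s hs => (hd s hs).continuousAt.continuousWithinAt) fun s hs => ?_
    rw [interior_Ico] at hs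
    have hs' := Set.Ioo_subset_Ico_self hs
    have hc := hcos s hs'
    have hlt : Real.cos s < 1 := by
      simpa using Real.cos_lt_cos_of_nonneg_of_le_pi_div_two le_rfl hs.2.le hs.1
    rw [(hd s hs').deriv, sub_pos, lt_div_iff₀ hc]
    linarith
  have hη : η ∈ Set.Ico 0 (Real.pi / 2) := ⟨h0.le, h1⟩
  have h2 := hmono ⟨le_rfl, h0.trans h1⟩ hη h0
  simp only [Real.sin_zero, Real.cos_zero, add_zero, Real.log_one, sub_zero] at h2
  rw [← Real.log_lt_log_iff (mul_pos (hcos η hη) (Real.exp_pos η)) (hsin η hη),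
    Real.log_mul (hcos η hη).ne' (Real.exp_pos η).ne', Real.log_exp]
  linarith

/-- The three-valued function beats every martingale strictly inside `D₂`. -/
theorem sq_lt_defect {ξ : ℝ} (h0 : -1 < ξ) (h1 : ξ < 1) : (1 - ξ) ^ 2 / 8 < defect ξ := by
  have hs := sin_angle_sub_cos_angle (sq_le_two h0.le h1.le)
  have hc := cos_angle_pos h0.le h1
  have hsq := Real.sin_sq_add_cos_sq (angle ξ)
  have hpos : 0 < angle ξ := by
    refine lt_of_le_of_ne (angle_nonneg h0.le) fun h => ?_
    rw [← h] at hs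
    simp at hs
    linarith
  have hlt : angle ξ < Real.pi / 2 := by
    refine lt_of_le_of_ne (angle_le h1.le) fun h => ?_
    rw [h, Real.cos_pi_div_two] at hc
    exact lt_irrefl _ hc
  have hmain := cos_mul_exp_lt hpos hlt
  have hsn := sin_angle_nonneg h0.le h1.le
  unfold defect
  set s := Real.sin (angle ξ)
  set c := Real.cos (angle ξ)
  have hs1 : s < 1 := by nlinarith
  have hc1 : c ≤ 1 := Real.cos_le_one _
  have hee : Real.exp (angle ξ) * Real.exp (-angle ξ) = 1 := by rw [← Real.exp_add]; simp
  have hE := Real.exp_pos (-angle ξ)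
  have e : (1 - ξ) ^ 2 = 2 * ((1 - s) * (1 + c)) := by
    rw [← hs]; linear_combination hsq
  -- multiply by `exp (-η) (1 - s) / c` and use `(1 - s) (1 + s) = c ^ 2`
  have h2 : c < (1 + s) * Real.exp (-angle ξ) := by
    calc c = c * Real.exp (angle ξ) * Real.exp (-angle ξ) := by rw [mul_assoc, hee, mul_one]
      _ < _ := mul_lt_mul_of_pos_right hmain hE
  have h3 : 1 - s < c * Real.exp (-angle ξ) := by
    have h4 : c * (1 - s) < c * (c * Real.exp (-angle ξ)) := by
      have := mul_lt_mul_of_pos_left h2 (sub_pos.2 hs1)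
      have e2 : (1 - s) * ((1 + s) * Real.exp (-angle ξ)) = c * (c * Real.exp (-angle ξ)) := by
        linear_combination -Real.exp (-angle ξ) * hsq
      linarith
    exact lt_of_mul_lt_mul_left h4 hc.le
  rw [e]
  nlinarith

theorem defect_eq_rho {x y : ℝ} (h : (x / √(y - x ^ 2)) ^ 2 ≤ 2) :
    defect (x / √(y - x ^ 2)) = (√(1 - rho x y ^ 2) - rho x y) / (2 * √2) *
      Real.exp (-Real.arcsin (rho x y) - Real.pi / 4) := by
  have e : x / √(y - x ^ 2) / √2 = rho x y := by
    rw [rho, Real.sqrt_mul (by norm_num), div_div, mul_comm]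
  have hm := div_sqrt_two_mem h
  rw [e] at hm
  have h4 : √2 * √2 = (2 : ℝ) := Real.mul_self_sqrt (by norm_num)
  have h3 : (√2 : ℝ) ≠ 0 := by positivity
  rw [defect, angle, e, Real.cos_add, Real.cos_pi_div_four, Real.sin_pi_div_four,
    Real.sin_arcsin hm.1 hm.2, Real.cos_arcsin, neg_add', neg_sub_comm]
  field_simp
  linear_combination (√(1 - rho x y ^ 2) - rho x y) * h4

end SquareBellman

theorem mainTheorem5 {Ω : Type*} [MeasurableSpace Ω] (P : Measure Ω) [IsProbabilityMeasure P]
    (hP : SquareBellman.Atomless P) (x y : ℝ) (hxy : x ^ 2 ≤ y) (hyx : y ≤ x ^ 2 + 1) :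
    ((x, y) ∈ SquareBellman.D₁ (Real.sqrt (y - x ^ 2)) ∪ SquareBellman.D₃ (Real.sqrt (y - x ^ 2)) ∪
        SquareBellman.D₄ (Real.sqrt (y - x ^ 2)) →
      SquareBellman.B P SquareBellman.chi x y (Real.sqrt (1 - y + x ^ 2)) =
        SquareBellman.b SquareBellman.chi (Real.sqrt (y - x ^ 2)) x y) ∧
    (x ^ 2 < y → (x, y) ∈ SquareBellman.D₂ (Real.sqrt (y - x ^ 2)) →
      SquareBellman.B P SquareBellman.chi x y (Real.sqrt (1 - y + x ^ 2)) =
        ((1 - (Real.sqrt (1 - SquareBellman.rho x y ^ 2) - SquareBellman.rho x y) /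
            (2 * Real.sqrt 2) *
            Real.exp (-Real.arcsin (SquareBellman.rho x y) - Real.pi / 4) : ℝ) : EReal)) ∧
    ((x, y) ∈ SquareBellman.D₂ (Real.sqrt (y - x ^ 2)) → |x| < Real.sqrt (y - x ^ 2) →
      SquareBellman.B P SquareBellman.chi x y (Real.sqrt (1 - y + x ^ 2)) <
        SquareBellman.b SquareBellman.chi (Real.sqrt (y - x ^ 2)) x y) := by
  rw [SquareBellman.B_eq_value hP hxy hyx]
  rcases hxy.eq_or_lt with rfl | hlt
  · rw [sub_self, Real.sqrt_zero, SquareBellman.value_zero, SquareBellman.b_zero]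
    exact ⟨fun _ => rfl, fun h => absurd h (lt_irrefl _),
      fun _ h => absurd h (not_lt.2 (abs_nonneg x))⟩
  have ht : 0 < y - x ^ 2 := sub_pos.2 hlt
  have hε : 0 < √(y - x ^ 2) := Real.sqrt_pos.2 ht
  have hsq : √(y - x ^ 2) ^ 2 = y - x ^ 2 := Real.sq_sqrt ht.le
  have hy : y = x ^ 2 + √(y - x ^ 2) ^ 2 := by rw [hsq]; ring
  rw [SquareBellman.value_of_pos x ht]
  have hmem : |x| ≤ √(y - x ^ 2) → -1 ≤ x / √(y - x ^ 2) ∧ x / √(y - x ^ 2) ≤ 1 := fun h => by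
    rw [le_div_iff₀ hε, div_le_one hε, neg_one_mul]
    exact abs_le.1 h
  refine ⟨fun h => ?_, fun _ h => ?_, fun h h' => ?_⟩
  · have hcases : √(y - x ^ 2) ≤ x ∨ x ≤ -√(y - x ^ 2) := by
      -- on the upper boundary `y = x² + ε²` the conditions `y ≤ ± 2 ε x` force `x = ± ε`
      rcases h with ((⟨-, -, h⟩ | ⟨-, h⟩) | ⟨-, h⟩) | ⟨-, h, -⟩
      · exact Or.inl h
      · refine Or.inl ?_
        simp only at h
        nlinarith [sq_nonneg (x - √(y - x ^ 2))]
      · refine Or.inr ?_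
        simp only at h
        nlinarith [sq_nonneg (x + √(y - x ^ 2))]
      · exact Or.inr h
    rcases hcases with h | h
    · have h1 : 1 ≤ SquareBellman.b SquareBellman.chi (√(y - x ^ 2)) x y := by
        have := SquareBellman.one_le_b hε.le h
        rwa [← hy] at this
      rw [SquareBellman.profile_of_ge (by rwa [le_div_iff₀ hε, one_mul])]
      exact le_antisymm h1 SquareBellman.b_le_one
    · have hξ : x / √(y - x ^ 2) ≤ -1 := by rw [div_le_iff₀ hε]; linarith
      have h1 := SquareBellman.exp_le_b hε hξ
      have h2 := SquareBellman.b_le_exp hε hξ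
      rw [mul_div_cancel₀ _ hε.ne', ← hy] at h1 h2
      rw [SquareBellman.profile_of_le hξ]
      exact le_antisymm h1 h2
  · obtain ⟨h0, h1⟩ := hmem h.2.1
    rw [SquareBellman.profile_of_mem h0 h1,
      SquareBellman.defect_eq_rho (SquareBellman.sq_le_two h0 h1)]
  · obtain ⟨h0, h1⟩ := hmem h'.le
    have h2 : -1 < x / √(y - x ^ 2) := by
      rw [lt_div_iff₀ hε, neg_one_mul]; exact (abs_lt.1 h').1
    have h3 : x / √(y - x ^ 2) < 1 := by rw [div_lt_one hε]; exact (abs_lt.1 h').2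
    have h4 := SquareBellman.one_sub_sq_le_b hε.le h0 h1
    rw [mul_div_cancel₀ _ hε.ne', ← hy] at h4
    rw [SquareBellman.profile_of_mem h0 h1]
    refine lt_of_lt_of_le ?_ h4
    have := SquareBellman.sq_lt_defect h2 h3
    exact_mod_cast (by linarith)
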